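/- Conventions. Let $K$ be a perfect field and let $\mathcal C$ be a compact cluster category over $K$. That is: $\mathcal C$ is an idempotent complete, $K$-linear Frobenius extriangulated category which is algebraic (equivalent, as an extriangulated category, to $\mathcal E/\mathcal P$ with $\mathcal E$ exact and $\mathcal P$ a full additively closed subcategory of projective-injective objects), whose stable category is Hom-finite and 2-Calabi–Yau, and which has a cluster-tilting subcategory (written $\subseteq_{\mathrm{ct}}$); moreover $\mathcal C$ is a pseudocompact category, $d_X=\dim_K D_X<\infty$ for all $X$, where $D_X=\operatorname{End}(X)/\operatorname{rad}\operatorname{End}(X)$, and every cluster-tilting subcategory is pseudocompact in its radical topology. Cluster-tilting subcategories are strongly functorially finite by definition: all objects have left approximations that are inflations and right approximations that are deflations. For $\mathcal U\subseteq_{\mathrm{ct}}\mathcal C$ put $\operatorname{irr}_{\mathcal U}(X,Y)=\operatorname{rad}(X,Y)/\operatorname{rad}^2_{\mathcal U}(X,Y)$ and $b^{\mathcal U}_{X,Y}=\operatorname{rank}_{D_X}\operatorname{irr}_{\mathcal U}(X,Y)-\operatorname{rank}_{D_X^{\mathrm{op}}}\operatorname{irr}_{\mathcal U}(Y,X)$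 for indecomposable $X,Y$; the exchange matrix $B_{\mathcal U}$ has these entries with $X\in\operatorname{indec}\mathcal U$ and $Y\in\operatorname{indec}\mathcal U$ non-projective. There is no loop at $U$ if $\operatorname{irr}_{\mathcal U}(U,U)=0$, and no 2-cycle at $U$ if for all $Y\in\operatorname{indec}\mathcal U$ one of $\operatorname{irr}_{\mathcal U}(U,Y)$, $\operatorname{irr}_{\mathcal U}(Y,U)$ vanishes. An indecomposable $U\in\mathcal U$ is mutable if there is an indecomposable $U'=\mu_{\mathcal U}U\not\cong U$ such that $\mu_U\mathcal U=\operatorname{add}((\mathcal U\setminus U)\cup\{U'\})$ is cluster-tilting, and there are non-split conflations $U'\to U^+\to U$ and $U\xrightarrow{\,i\,}U^-\to U'$ given by a right, respectively a left, $(\mathcal U\setminus U)$-approximation of $U$; here $\mathcal U\setminus U$ consists of the objects of $\mathcal U$ without $U$ as a direct summand. The pair $(\mathcal C,\mathcal T)$ has a cluster structure if all non-projective indecomposable objects of cluster-tilting subcategories are mutable, all $\mathcal U$ reachable from $\mathcal T$ by finitely many mutations have no loops or 2-cycles at non-projective indecomposables, and the matrices $B_{\mathcal U}$ of reachable $\mathcal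 U$ mutate by the Fomin–Zelevinsky rule. For $\mathcal T,\mathcal U\subseteq_{\mathrm{ct}}\mathcal C$ the index $\operatorname{ind}_{\mathcal U}^{\mathcal T}\colon K_0(\mathcal U)\to K_0(\mathcal T)$ of split Grothendieck groups sends $[X]$ to $[R]-[N]$ for any conflation $N\to R\to X$ with $N,R\in\mathcal T$, and $\operatorname{coind}_{\mathcal T}^{\mathcal U}\colon K_0(\mathcal T)\to K_0(\mathcal U)$ sends $[T]$ to $[L]-[N]$ for any conflation $T\to L\to N$ with $L,N\in\mathcal U$. Let $K_0^{\mathrm{num}}(\mathrm{lfd}\,\mathcal T)$ be the Grothendieck group of locally finite-dimensional $\mathcal T$-modules modulo the kernel of the pairing $\langle[M],[T]\rangle=\dim_K M(T)$ with $K_0(\mathcal T)$, let $S^{\mathcal U}_X=\operatorname{Hom}(-,X)/\operatorname{rad}(-,X)$ on $\mathcal U$, and let $\overline{\operatorname{ind}}{}_{\mathcal U}^{\mathcal T}\colon K_0^{\mathrm{num}}(\mathrm{lfd}\,\mathcal U)\to K_0^{\mathrm{num}}(\mathrm{lfd}\,\mathcal T)$ be the adjoint of $\operatorname{coind}_{\mathcal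 T}^{\mathcal U}$ for these pairings. The map $\beta_{\mathcal T}$ from the Grothendieck group of finitely presented modules over the stable category of $\mathcal T$ to $K_0(\mathcal T)$ sends $[M]$ to minus the class of a bounded projective resolution of $M$ over the lift of $\mathcal T$ to an exact category $\mathcal E$ as above. Put $[a]_+=\max(a,0)$ and $[a]_-=\max(-a,0)$ for integers $a$; for $v\in K_0^{\mathrm{num}}(\mathrm{lfd}\,\mathcal T)$ the element $[v]_-$ is defined by $\langle[v]_-,[T]\rangle=[\langle v,[T]\rangle]_-$ for all $T\in\operatorname{indec}\mathcal T$. Theorem. Let $\mathcal T,\mathcal U\subseteq_{\mathrm{ct}}\mathcal C$. Then the maps $\operatorname{ind}_{\mathcal U}^{\mathcal T}$, $\operatorname{coind}_{\mathcal T}^{\mathcal U}$, $\overline{\operatorname{ind}}{}_{\mathcal U}^{\mathcal T}$ and $\beta_{\mathcal T}$ are well defined. Let $U\in\operatorname{indec}\mathcal U$ be mutable, with no loop or 2-cycle at $U$, put $\mathcal U'=\mu_U\mathcal U$, $U'=\mu_{\mathcal U}U$, $c=\overline{\operatorname{ind}}{}_{\mathcal U}^{\mathcal T}[S^{\mathcal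 U}_U]$, and let $i\colon U\to U^-$ be the inflation of an exchange conflation. Then $c$ pairs to zero with the projective objects of $\mathcal T$; only finitely many $W\in\operatorname{indec}\mathcal U$ have $b^{\mathcal U}_{W,U}\neq0$; the module $N=\operatorname{Ker}\operatorname{Ext}^1(-,i)|_{\mathcal T}$ is locally finite-dimensional, finitely presented over the stable category of $\mathcal T$, and has class $[c]_-$, so that we may write $\beta_{\mathcal T}[c]_-$ for $\beta_{\mathcal T}[N]$; and for every $V\in\operatorname{indec}\mathcal U'$ with $V\not\cong U'$ (so that $V\in\mathcal U$) we have $$\operatorname{ind}_{\mathcal U'}^{\mathcal T}[U']=-\operatorname{ind}_{\mathcal U}^{\mathcal T}[U]+\sum_{W\in\operatorname{indec}\mathcal U,\ W\not\cong U}[b^{\mathcal U}_{W,U}]_-\operatorname{ind}_{\mathcal U}^{\mathcal T}[W]-\beta_{\mathcal T}[c]_-,\qquad \operatorname{ind}_{\mathcal U'}^{\mathcal T}[V]=\operatorname{ind}_{\mathcal U}^{\mathcal T}[V],$$ $$\overline{\operatorname{ind}}{}_{\mathcal U'}^{\mathcal T}[S^{\mathcal U'}_{U'}]=-c,\qquad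 \overline{\operatorname{ind}}{}_{\mathcal U'}^{\mathcal T}[S^{\mathcal U'}_V]=\overline{\operatorname{ind}}{}_{\mathcal U}^{\mathcal T}[S^{\mathcal U}_V]+[b^{\mathcal U}_{U,V}]_+\,c+b^{\mathcal U}_{U,V}\,[c]_-.$$ Suppose moreover that $(\mathcal C,\mathcal T)$ has a cluster structure. Let $(T_i)_{i\in I}$ represent the indecomposable objects of $\mathcal T$, let $J\subseteq I$ be the set of $i$ with $T_i$ not projective, and consider the cluster algebra with principal coefficients $(y_j)_{j\in J}$, initial extended cluster $(x_i)_{i\in I}$ and initial exchange matrix $B_{\mathcal T}=(b^{\mathcal T}_{T_i,T_j})_{i\in I,j\in J}$. Its $\mathbf g$-vectors are the degrees in $\mathbb Z^I$ of cluster variables for $\deg x_i=e_i$, $\deg y_j=-(\text{column } j\text{ of }B_{\mathcal T})$, and the $\mathbf c$-vectors of a seed are the columns of its $J\times J$ coefficient matrix, which is the identity initially. Then every finite sequence of indices in $J$ is realized by a sequence of mutations starting at $\mathcal T$, every $\mathcal U$ reachable from $\mathcal T$ is obtained in this way, and whenever a sequence of mutations leads from $(\mathcal T,(T_i))$ to $(\mathcal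 U,(Y_i))$, the $Y_i$ represent the indecomposable objects of $\mathcal U$, and the corresponding seed has $\mathbf g$-vectors $g_i=(g_{ti})_{t\in I}$, $i\in I$, of finite support and $\mathbf c$-vectors $(c_{tj})_{t\in J}$, $j\in J$, of finite support with $$\operatorname{ind}_{\mathcal U}^{\mathcal T}[Y_i]=\sum_{t\in I}g_{ti}[T_t]\quad(i\in I),\qquad \overline{\operatorname{ind}}{}_{\mathcal U}^{\mathcal T}[S^{\mathcal U}_{Y_j}]=\sum_{t\in J}c_{tj}[S^{\mathcal T}_{T_t}]\quad(j\in J).$$ -/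

import Mathlib

open CategoryTheory CategoryTheory.Limits Opposite

universe x w v u v₁ u₁

attribute [local instance] hasBinaryBiproducts_of_finite_biproducts

noncomputable section

set_option linter.unusedSectionVars false
set_option linter.checkUnivs false

namespace ClusterCat

/-! ### Extriangulated categories -/

/-- A `K`-linear extriangulated structure (Nakaoka–Palu) on an additive category `C`:
a `K`-bilinear bifunctor `Ext Z X` (contravariant in `Z`, covariant in `X`), and an additive
realization, recorded by the predicate `Realizes δ x y`: the sequence `X ⟶ Y ⟶ Z` belongs to the
equivalence class of sequences attached to `δ : Ext Z X`. -/
structure Extri (K : Type w) [Field K] (C : Type u) [Category.{v} C] [Preadditive C] [Linear K C]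
    [HasFiniteBiproducts C] where
  Ext : C → C → Type v
  [grp : ∀ Z X, AddCommGroup (Ext Z X)]
  [mod : ∀ Z X, Module K (Ext Z X)]
  push : ∀ {Z X X' : C}, (X ⟶ X') → Ext Z X →ₗ[K] Ext Z X'
  pull : ∀ {Z' Z X : C}, (Z' ⟶ Z) → Ext Z X →ₗ[K] Ext Z' X
  push_id : ∀ {Z X : C} (δ : Ext Z X), push (𝟙 X) δ = δ
  push_comp : ∀ {Z X X' X'' : C} (a : X ⟶ X') (b : X' ⟶ X'') (δ : Ext Z X),
    push (a ≫ b) δ = push b (push a δ)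
  pull_id : ∀ {Z X : C} (δ : Ext Z X), pull (𝟙 Z) δ = δ
  pull_comp : ∀ {Z'' Z' Z X : C} (b : Z'' ⟶ Z') (a : Z' ⟶ Z) (δ : Ext Z X),
    pull (b ≫ a) δ = pull b (pull a δ)
  push_pull : ∀ {Z' Z X X' : C} (c : Z' ⟶ Z) (a : X ⟶ X') (δ : Ext Z X),
    push a (pull c δ) = pull c (push a δ)
  push_add : ∀ {Z X X' : C} (a b : X ⟶ X') (δ : Ext Z X), push (a + b) δ = push a δ + push b δ
  push_smul : ∀ {Z X X' : C} (r : K) (a : X ⟶ X') (δ : Ext Z X), push (r • a) δ = r • push a δ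
  pull_add : ∀ {Z' Z X : C} (a b : Z' ⟶ Z) (δ : Ext Z X), pull (a + b) δ = pull a δ + pull b δ
  pull_smul : ∀ {Z' Z X : C} (r : K) (a : Z' ⟶ Z) (δ : Ext Z X), pull (r • a) δ = r • pull a δ
  Realizes : ∀ {X Y Z : C}, Ext Z X → (X ⟶ Y) → (Y ⟶ Z) → Prop
  exists_realizes : ∀ {X Z : C} (δ : Ext Z X), ∃ (Y : C) (x : X ⟶ Y) (y : Y ⟶ Z), Realizes δ x y
  /-- two realizations of `δ` are equivalent sequences -/
  realizes_unique : ∀ {X Y Y' Z : C} {δ : Ext Z X} {x : X ⟶ Y} {y : Y ⟶ Z} {x' : X ⟶ Y'}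
    {y' : Y' ⟶ Z}, Realizes δ x y → Realizes δ x' y' →
      ∃ b : Y ≅ Y', x ≫ b.hom = x' ∧ b.hom ≫ y' = y
  /-- a sequence equivalent to a realization of `δ` is a realization of `δ` -/
  realizes_iso : ∀ {X Y Y' Z : C} {δ : Ext Z X} {x : X ⟶ Y} {y : Y ⟶ Z} (b : Y ≅ Y'),
    Realizes δ x y → Realizes δ (x ≫ b.hom) (b.inv ≫ y)
  /-- morphisms of extensions are realized -/
  realizes_map : ∀ {X Y Z X' Y' Z' : C} {δ : Ext Z X} {δ' : Ext Z' X'} {x : X ⟶ Y} {y : Y ⟶ Z}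
    {x' : X' ⟶ Y'} {y' : Y' ⟶ Z'}, Realizes δ x y → Realizes δ' x' y' →
    ∀ (a : X ⟶ X') (c : Z ⟶ Z'), push a δ = pull c δ' →
      ∃ b : Y ⟶ Y', x ≫ b = a ≫ x' ∧ y ≫ c = b ≫ y'
  realizes_zero : ∀ X Z : C,
    Realizes (0 : Ext Z X) (biprod.inl : X ⟶ X ⊞ Z) (biprod.snd : X ⊞ Z ⟶ Z)
  realizes_sum : ∀ {X Y Z X' Y' Z' : C} {δ : Ext Z X} {δ' : Ext Z' X'} {x : X ⟶ Y} {y : Y ⟶ Z}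
    {x' : X' ⟶ Y'} {y' : Y' ⟶ Z'}, Realizes δ x y → Realizes δ' x' y' →
      Realizes (push biprod.inl (pull biprod.fst δ) + push biprod.inr (pull biprod.snd δ') :
        Ext (Z ⊞ Z') (X ⊞ X')) (biprod.map x x') (biprod.map y y')
  et3 : ∀ {X Y Z X' Y' Z' : C} {δ : Ext Z X} {δ' : Ext Z' X'} {x : X ⟶ Y} {y : Y ⟶ Z}
    {x' : X' ⟶ Y'} {y' : Y' ⟶ Z'}, Realizes δ x y → Realizes δ' x' y' →
    ∀ (a : X ⟶ X') (b : Y ⟶ Y'), x ≫ b = a ≫ x' →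
      ∃ c : Z ⟶ Z', y ≫ c = b ≫ y' ∧ push a δ = pull c δ'
  et3op : ∀ {X Y Z X' Y' Z' : C} {δ : Ext Z X} {δ' : Ext Z' X'} {x : X ⟶ Y} {y : Y ⟶ Z}
    {x' : X' ⟶ Y'} {y' : Y' ⟶ Z'}, Realizes δ x y → Realizes δ' x' y' →
    ∀ (b : Y ⟶ Y') (c : Z ⟶ Z'), y ≫ c = b ≫ y' →
      ∃ a : X ⟶ X', x ≫ b = a ≫ x' ∧ push a δ = pull c δ'
  et4 : ∀ {A B D M F : C} {δ : Ext D A} {f : A ⟶ B} {f' : B ⟶ D} {δ' : Ext F B} {g : B ⟶ M}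
    {g' : M ⟶ F}, Realizes δ f f' → Realizes δ' g g' →
      ∃ (N : C) (d : D ⟶ N) (e : N ⟶ F) (h' : M ⟶ N) (δ'' : Ext N A),
        Realizes δ'' (f ≫ g) h' ∧ f' ≫ d = g ≫ h' ∧ h' ≫ e = g' ∧
        Realizes (push f' δ') d e ∧ pull d δ'' = δ ∧ push f δ'' = pull e δ'
  et4op : ∀ {A B D M F : C} {δ : Ext B D} {f' : D ⟶ A} {f : A ⟶ B} {δ' : Ext M F} {g' : F ⟶ B}
    {g : B ⟶ M}, Realizes δ f' f → Realizes δ' g' g →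
      ∃ (N : C) (d : D ⟶ N) (e : N ⟶ F) (h' : N ⟶ A) (δ'' : Ext M N),
        Realizes δ'' h' (f ≫ g) ∧ d ≫ h' = f' ∧ h' ≫ f = e ≫ g' ∧
        Realizes (pull g' δ) d e ∧ push e δ'' = δ' ∧ push d δ = pull g δ''

attribute [instance] Extri.grp Extri.mod

section

variable {K : Type w} [Field K] {C : Type u} [Category.{v} C] [Preadditive C] [Linear K C]
  [HasFiniteBiproducts C]

namespace Extri

variable (X : Extri K C)

/-- `A ⟶ B ⟶ D` is a conflation. -/
def Conflation {A B D : C} (i : A ⟶ B) (p : B ⟶ D) : Prop := ∃ δ : X.Ext D A, X.Realizes δ i p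

def IsInflation {A B : C} (i : A ⟶ B) : Prop := ∃ (D : C) (p : B ⟶ D), X.Conflation i p

def IsDeflation {B D : C} (p : B ⟶ D) : Prop := ∃ (A : C) (i : A ⟶ B), X.Conflation i p

def IsProj : ObjectProperty C := fun P => ∀ (A : C) (δ : X.Ext P A), δ = 0

def IsInj : ObjectProperty C := fun Q => ∀ (A : C) (δ : X.Ext A Q), δ = 0

structure IsFrobenius : Prop where
  enough_proj : ∀ D : C, ∃ (P : C) (p : P ⟶ D), X.IsProj P ∧ X.IsDeflation p
  enough_inj : ∀ A : C, ∃ (Q : C) (i : A ⟶ Q), X.IsInj Q ∧ X.IsInflation i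
  proj_iff_inj : ∀ P : C, X.IsProj P ↔ X.IsInj P

/-- An exact category is an extriangulated category in which all inflations are monomorphisms
and all deflations are epimorphisms. -/
structure IsExactCat : Prop where
  mono : ∀ {A B : C} (i : A ⟶ B), X.IsInflation i → Mono i
  epi : ∀ {B D : C} (p : B ⟶ D), X.IsDeflation p → Epi p

end Extri

/-- The morphism `f` factors through an object with property `P`. -/
def FactorsThrough {D : Type*} [Category D] (P : ObjectProperty D) {A B : D} (f : A ⟶ B) : Prop :=
  ∃ (Q : D) (a : A ⟶ Q) (b : Q ⟶ B), P Q ∧ f = a ≫ b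

/-- An algebraic presentation of an extriangulated category `(C, X)`: an exact category `E`, a full
additively closed subcategory `P` of projective-injective objects of `E`, and an equivalence
`E/P ≃ C` of extriangulated categories, given by the corresponding functor `F : E ⥤ C`. -/
structure AlgLift (X : Extri K C) where
  E : Type u₁
  [cat : Category.{v₁} E]
  [pre : Preadditive E]
  [lin : Linear K E]
  [bip : HasFiniteBiproducts E]
  XE : Extri K E
  exact : XE.IsExactCat
  P : ObjectProperty E
  P_zero : ∀ A : E, IsZero A → P A
  P_biprod : ∀ A B : E, P A → P B → P (A ⊞ B)
  P_retract : ∀ A B : E, Nonempty (Retract A B) → P B → P A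
  P_proj : ∀ A : E, P A → XE.IsProj A
  P_inj : ∀ A : E, P A → XE.IsInj A
  F : E ⥤ C
  F_add : ∀ {A B : E} (f g : A ⟶ B), F.map (f + g) = F.map f + F.map g
  F_smul : ∀ {A B : E} (r : K) (f : A ⟶ B), F.map (r • f) = r • F.map f
  F_full : F.Full
  F_essSurj : F.EssSurj
  F_zero_iff : ∀ {A B : E} (f : A ⟶ B), F.map f = 0 ↔ FactorsThrough P f
  extEquiv : ∀ A B : E, XE.Ext A B ≃ₗ[K] X.Ext (F.obj A) (F.obj B)
  extEquiv_push : ∀ {A B B' : E} (b : B ⟶ B') (δ : XE.Ext A B),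
    extEquiv A B' (XE.push b δ) = X.push (F.map b) (extEquiv A B δ)
  extEquiv_pull : ∀ {A' A B : E} (a : A' ⟶ A) (δ : XE.Ext A B),
    extEquiv A' B (XE.pull a δ) = X.pull (F.map a) (extEquiv A B δ)
  realizes : ∀ {A B D : E} (δ : XE.Ext D A) (i : A ⟶ B) (p : B ⟶ D),
    XE.Realizes δ i p → X.Realizes (extEquiv D A δ) (F.map i) (F.map p)

attribute [instance] AlgLift.cat AlgLift.pre AlgLift.lin AlgLift.bip

/-! ### The stable category -/

namespace Extri

variable (X : Extri K C)

theorem isProj_biprod {P Q : C} (hP : X.IsProj P) (hQ : X.IsProj Q) : X.IsProj (P ⊞ Q) := by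
  intro A δ
  rw [← X.pull_id δ, ← biprod.total, X.pull_add, X.pull_comp, X.pull_comp,
    hP _ (X.pull biprod.inl δ), hQ _ (X.pull biprod.inr δ)]
  simp

/-- Congruence modulo morphisms that factor through projective objects. -/
def stabRel : HomRel C := fun _ _ f g => FactorsThrough X.IsProj (f - g)

theorem exists_isProj : ∃ P : C, X.IsProj P := by
  obtain ⟨P, hP⟩ := HasZeroObject.zero (C := C)
  refine ⟨P, fun A δ => ?_⟩
  have h : 𝟙 P = (0 : K) • 𝟙 P := hP.eq_of_src _ _
  rw [← X.pull_id δ, h, X.pull_smul, zero_smul]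

theorem factors_zero (A B : C) : FactorsThrough X.IsProj (0 : A ⟶ B) := by
  obtain ⟨P, hP⟩ := X.exists_isProj
  exact ⟨P, 0, 0, hP, by simp⟩

theorem factors_add {A B : C} {f g : A ⟶ B} (hf : FactorsThrough X.IsProj f)
    (hg : FactorsThrough X.IsProj g) : FactorsThrough X.IsProj (f + g) := by
  obtain ⟨P, a, b, hP, rfl⟩ := hf
  obtain ⟨Q, a', b', hQ, rfl⟩ := hg
  exact ⟨P ⊞ Q, biprod.lift a a', biprod.desc b b', X.isProj_biprod hP hQ, by simp⟩

theorem factors_smul {A B : C} (r : K) {f : A ⟶ B} (hf : FactorsThrough X.IsProj f) :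
    FactorsThrough X.IsProj (r • f) := by
  obtain ⟨P, a, b, hP, rfl⟩ := hf
  exact ⟨P, r • a, b, hP, by simp⟩

instance stabRel_congruence : Congruence X.stabRel where
  equivalence := by
    refine ⟨fun f => ?_, fun {f g} h => ?_, fun {f g h} h₁ h₂ => ?_⟩
    · show FactorsThrough X.IsProj (f - f)
      rw [sub_self]
      exact X.factors_zero _ _
    · show FactorsThrough X.IsProj (g - f)
      have := X.factors_smul (-1) h
      simpa using this
    · show FactorsThrough X.IsProj (f - h)
      have := X.factors_add h₁ h₂
      simpa using this
  comp_left := by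
    rintro A B D f g g' ⟨P, a, b, hP, h⟩
    exact ⟨P, f ≫ a, b, hP, by rw [← Preadditive.comp_sub, h, Category.assoc]⟩
  comp_right := by
    rintro A B D f f' g ⟨P, a, b, hP, h⟩
    exact ⟨P, a, b ≫ g, hP, by rw [← Preadditive.sub_comp, h, Category.assoc]⟩

/-- The stable category: the quotient of `C` by the morphisms factoring through projectives. -/
abbrev Stab := CategoryTheory.Quotient X.stabRel

abbrev toStab : C ⥤ X.Stab := CategoryTheory.Quotient.functor X.stabRel

theorem stabRel_add ⦃A B : C⦄ (f₁ f₂ g₁ g₂ : A ⟶ B) (hf : X.stabRel f₁ f₂) (hg : X.stabRel g₁ g₂) :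
    X.stabRel (f₁ + g₁) (f₂ + g₂) := by
  show FactorsThrough X.IsProj (f₁ + g₁ - (f₂ + g₂))
  rw [add_sub_add_comm]
  exact X.factors_add hf hg

theorem stabRel_smul (r : K) ⦃A B : C⦄ (f g : A ⟶ B) (h : X.stabRel f g) :
    X.stabRel (r • f) (r • g) := by
  show FactorsThrough X.IsProj (r • f - r • g)
  rw [← smul_sub]
  exact X.factors_smul r h

instance : Preadditive X.Stab := CategoryTheory.Quotient.preadditive X.stabRel X.stabRel_add

instance : X.toStab.Additive := CategoryTheory.Quotient.functor_additive X.stabRel X.stabRel_add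

instance : Linear K X.Stab := CategoryTheory.Quotient.linear K X.stabRel X.stabRel_smul

/-- The stable category is Hom-finite and 2-Calabi–Yau: `S` is its suspension functor, which is
determined by `Hom (A, S B) ≅ Ext A B`, and `Hom (A, B)` is naturally dual to `Hom (B, S S A)`. -/
structure IsStablyTwoCY : Prop where
  finite : ∀ A B : X.Stab, FiniteDimensional K (A ⟶ B)
  two_cy : ∃ (S : X.Stab ⥤ X.Stab)
    (e : ∀ A B : C, (X.toStab.obj A ⟶ S.obj (X.toStab.obj B)) ≃ₗ[K] X.Ext A B)
    (D : ∀ A B : X.Stab, (A ⟶ B) ≃ₗ[K] Module.Dual K (B ⟶ S.obj (S.obj A))),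
    (∀ {A' A B B' : C} (a : A' ⟶ A) (b : B ⟶ B') (f : X.toStab.obj A ⟶ S.obj (X.toStab.obj B)),
      e A' B' (X.toStab.map a ≫ f ≫ S.map (X.toStab.map b)) = X.push b (X.pull a (e A B f))) ∧
    (∀ {A' A B B' : X.Stab} (a : A' ⟶ A) (f : A ⟶ B) (b : B ⟶ B') (g : B' ⟶ S.obj (S.obj A')),
      D A' B' (a ≫ f ≫ b) g = D A B f (b ≫ g ≫ S.map (S.map a)))

/-! ### Cluster-tilting subcategories -/

/-- Cluster-tilting subcategories, including strong functorial finiteness. -/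
structure IsCT (𝒯 : ObjectProperty C) : Prop where
  mem_iff_right : ∀ A : C, 𝒯 A ↔ ∀ T : C, 𝒯 T → ∀ δ : X.Ext T A, δ = 0
  mem_iff_left : ∀ A : C, 𝒯 A ↔ ∀ T : C, 𝒯 T → ∀ δ : X.Ext A T, δ = 0
  left_approx : ∀ A : C, ∃ (L : C) (i : A ⟶ L), 𝒯 L ∧ X.IsInflation i ∧
    ∀ (T : C), 𝒯 T → ∀ f : A ⟶ T, ∃ g : L ⟶ T, i ≫ g = f
  right_approx : ∀ A : C, ∃ (R : C) (p : R ⟶ A), 𝒯 R ∧ X.IsDeflation p ∧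
    ∀ (T : C), 𝒯 T → ∀ f : T ⟶ A, ∃ g : T ⟶ R, g ≫ p = f

/-- Cluster categories: idempotent complete, algebraic, stably 2-Calabi–Yau Frobenius
extriangulated categories with a cluster-tilting subcategory. -/
structure IsClusterCategory : Prop where
  idem : IsIdempotentComplete C
  algebraic : Nonempty (AlgLift.{w, v, u, v₁, u₁} X)
  frobenius : X.IsFrobenius
  twoCY : X.IsStablyTwoCY
  exists_ct : ∃ 𝒯 : ObjectProperty C, X.IsCT 𝒯

end Extri

/-! ### Radicals -/

theorem isIso_one_sub_comm {A B : C} (a : A ⟶ B) (b : B ⟶ A) (h : IsIso (𝟙 A - a ≫ b)) :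
    IsIso (𝟙 B - b ≫ a) := by
  obtain ⟨s, h₁, h₂⟩ := h.out
  refine ⟨𝟙 B + b ≫ s ≫ a, ?_, ?_⟩
  · have : b ≫ ((𝟙 A - a ≫ b) ≫ s) ≫ a = b ≫ a := by rw [h₁]; simp
    simp only [Preadditive.sub_comp, Preadditive.comp_sub, Preadditive.comp_add, Category.assoc,
      Category.id_comp, Category.comp_id] at this ⊢
    rw [← this]; abel
  · have : b ≫ (s ≫ (𝟙 A - a ≫ b)) ≫ a = b ≫ a := by rw [h₂]; simp
    simp only [Preadditive.sub_comp, Preadditive.comp_sub, Preadditive.add_comp, Category.assoc,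
      Category.id_comp, Category.comp_id] at this ⊢
    have h' : b ≫ a = b ≫ s ≫ a - b ≫ s ≫ a ≫ b ≫ a := this.symm
    calc _ = 𝟙 B + (b ≫ s ≫ a - b ≫ s ≫ a ≫ b ≫ a) - b ≫ a := by abel
      _ = 𝟙 B := by rw [← h']; abel

variable (K) in
/-- The radical `rad(A, B)`: all `f` such that `1 - g f` is invertible for every `g : B ⟶ A`. -/
def rad (A B : C) : Submodule K (A ⟶ B) where
  carrier := {f | ∀ g : B ⟶ A, IsIso (𝟙 A - f ≫ g)}
  zero_mem' := fun g => by simpa using (inferInstance : IsIso (𝟙 A))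
  add_mem' := by
    intro f f' hf hf' g
    have h₁ := hf g
    have h₂ : IsIso (𝟙 A - inv (𝟙 A - f ≫ g) ≫ (f' ≫ g)) := by
      apply isIso_one_sub_comm
      rw [Category.assoc]
      exact hf' _
    have h₃ : 𝟙 A - (f + f') ≫ g =
        (𝟙 A - f ≫ g) ≫ (𝟙 A - inv (𝟙 A - f ≫ g) ≫ (f' ≫ g)) := by
      rw [Preadditive.comp_sub, IsIso.hom_inv_id_assoc, Category.comp_id, Preadditive.add_comp]
      abel
    rw [h₃]
    infer_instance
  smul_mem' := by
    intro r f hf g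
    have := hf (r • g)
    simpa using this

theorem comp_mem_rad {A' A B : C} (a : A' ⟶ A) {f : A ⟶ B} (hf : f ∈ rad K A B) :
    a ≫ f ∈ rad K A' B := by
  intro g
  rw [Category.assoc]
  apply isIso_one_sub_comm
  rw [Category.assoc]
  exact hf _

theorem mem_rad_comp {A B B' : C} {f : A ⟶ B} (hf : f ∈ rad K A B) (b : B ⟶ B') :
    f ≫ b ∈ rad K A B' := by
  intro g
  rw [Category.assoc]
  exact hf _

variable (K) in
/-- The `n`-th power of the radical of the full subcategory `𝒯`: spanned by composites of `n`
radical morphisms through objects of `𝒯`. -/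
def radPow (𝒯 : ObjectProperty C) : ℕ → ∀ A B : C, Submodule K (A ⟶ B)
  | 0, _, _ => ⊤
  | 1, A, B => rad K A B
  | n + 2, A, B => Submodule.span K {h | ∃ (Z : C) (f : A ⟶ Z) (g : Z ⟶ B),
      𝒯 Z ∧ f ∈ rad K A Z ∧ g ∈ radPow 𝒯 (n + 1) Z B ∧ h = f ≫ g}

theorem radPow_succ_le (𝒯 : ObjectProperty C) (n : ℕ) :
    ∀ A B : C, radPow K 𝒯 (n + 1) A B ≤ radPow K 𝒯 n A B := by
  induction n with
  | zero => intro A B; exact le_top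
  | succ n ih =>
    intro A B
    cases n with
    | zero =>
      refine Submodule.span_le.2 ?_
      rintro _ ⟨Z, f, g, -, hf, -, rfl⟩
      exact mem_rad_comp hf g
    | succ n =>
      refine Submodule.span_mono ?_
      rintro _ ⟨Z, f, g, hZ, hf, hg, rfl⟩
      exact ⟨Z, f, g, hZ, hf, ih _ _ hg, rfl⟩

theorem radPow_antitone (𝒯 : ObjectProperty C) (A B : C) :
    Antitone fun n => radPow K 𝒯 n A B :=
  antitone_nat_of_succ_le fun n => radPow_succ_le 𝒯 n A B

variable (K) in
/-- The topology on `Hom(A, B)` for which the powers of the radical of `𝒯` are a basis of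
neighbourhoods of zero. -/
@[reducible] def radTop (𝒯 : ObjectProperty C) (A B : C) : TopologicalSpace (A ⟶ B) where
  IsOpen s := ∀ f ∈ s, ∃ n : ℕ, ∀ g : A ⟶ B, g - f ∈ radPow K 𝒯 n A B → g ∈ s
  isOpen_univ := fun _ _ => ⟨0, fun _ _ => Set.mem_univ _⟩
  isOpen_inter := by
    intro s t hs ht f hf
    obtain ⟨n, hn⟩ := hs f hf.1
    obtain ⟨m, hm⟩ := ht f hf.2
    exact ⟨max n m, fun g hg => ⟨hn g (radPow_antitone 𝒯 A B (le_max_left n m) hg),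
      hm g (radPow_antitone 𝒯 A B (le_max_right n m) hg)⟩⟩
  isOpen_sUnion := by
    intro S hS f hf
    obtain ⟨s, hs, hfs⟩ := hf
    obtain ⟨n, hn⟩ := hS s hs f hfs
    exact ⟨n, fun g hg => ⟨s, hs, hn g hg⟩⟩

variable (K) in
/-- The space `irr(A, B) = rad(A, B) / rad²(A, B)` of irreducible morphisms of `𝒯`. -/
abbrev Irr (𝒯 : ObjectProperty C) (A B : C) :=
  (rad K A B) ⧸ (radPow K 𝒯 2 A B).submoduleOf (rad K A B)

variable (K) in
/-- `d_A`, the dimension over `K` of the algebra `D_A = End(A) / rad End(A)`. -/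
def dimD (A : C) : ℕ := Module.finrank K ((A ⟶ A) ⧸ rad K A A)

variable (K) in
/-- The entry `b_{A,B}` of the exchange matrix of `𝒯`, the difference of the ranks of `irr(A, B)`
and of `irr(B, A)` over the division algebra `D_A`. The rank of a `D_A`-module is its dimension
over `K` divided by `d_A`, so the divisions are exact. -/
def exch (𝒯 : ObjectProperty C) (A B : C) : ℤ :=
  (Module.finrank K (Irr K 𝒯 A B) / dimD K A : ℕ) - (Module.finrank K (Irr K 𝒯 B A) / dimD K A : ℕ)

variable (K) in
def NoLoopAt (𝒯 : ObjectProperty C) (A : C) : Prop := Subsingleton (Irr K 𝒯 A A)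

variable (K) in
def NoTwoCycleAt (𝒯 : ObjectProperty C) (A : C) : Prop :=
  ∀ B : C, 𝒯 B → Indecomposable B → Subsingleton (Irr K 𝒯 A B) ∨ Subsingleton (Irr K 𝒯 B A)

/-! ### Compactness -/

variable (K) in
/-- Pseudocompact vector spaces (over the discrete field `K`): Hausdorff topological vector spaces
which are, topologically, the inverse limit of their finite-dimensional discrete quotients. -/
structure IsPseudocompact {V : Type*} [AddCommGroup V] [Module K V] (τ : TopologicalSpace V) :
    Prop where
  t2 : T2Space V
  continuous_add : Continuous fun p : V × V => p.1 + p.2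
  continuous_smul : ∀ r : K, Continuous fun x : V => r • x
  basis : ∀ s ∈ nhds (0 : V), ∃ W : Submodule K V, IsOpen (W : Set V) ∧
    FiniteDimensional K (V ⧸ W) ∧ (W : Set V) ⊆ s
  complete : ∀ x : {W : Submodule K V // IsOpen (W : Set V) ∧ FiniteDimensional K (V ⧸ W)} → V,
    (∀ W W', W.1 ≤ W'.1 → x W - x W' ∈ W'.1) → ∃ y : V, ∀ W, y - x W ∈ W.1

/-- Compactness of `(C, X)`: `C` is a pseudocompact category, the algebras `D_A` are
finite-dimensional, and every cluster-tilting subcategory is pseudocompact in its radical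
topology (composition is automatically continuous for that topology). -/
structure Extri.IsCompactCat (X : Extri K C) : Prop where
  pseudocompact : ∃ τ : ∀ A B : C, TopologicalSpace (A ⟶ B),
    (∀ A B, IsPseudocompact K (τ A B)) ∧
    ∀ A B D : C, @Continuous _ _ (@instTopologicalSpaceProd _ _ (τ A B) (τ B D)) (τ A D)
      (fun p : (A ⟶ B) × (B ⟶ D) => p.1 ≫ p.2)
  finite : ∀ A : C, FiniteDimensional K ((A ⟶ A) ⧸ rad K A A)
  radical : ∀ 𝒯 : ObjectProperty C, X.IsCT 𝒯 → ∀ A B : C, 𝒯 A → 𝒯 B →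
    IsPseudocompact K (radTop K 𝒯 A B)

/-! ### Mutation -/

/-- Objects of `𝒯` without `T₀` as a direct summand. -/
def without (𝒯 : ObjectProperty C) (T₀ : C) : ObjectProperty C :=
  fun A => 𝒯 A ∧ ¬ Nonempty (Retract T₀ A)

/-- Direct summands of finite direct sums of objects in `S`. -/
def addClosure (S : ObjectProperty C) : ObjectProperty C :=
  fun A => ∃ (n : ℕ) (Y : Fin n → C), (∀ i, S (Y i)) ∧ Nonempty (Retract A (⨁ Y))

theorem mem_addClosure {S : ObjectProperty C} {A : C} (h : S A) : addClosure S A :=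
  ⟨1, fun _ => A, fun _ => h, ⟨⟨biproduct.ι (fun _ : Fin 1 => A) 0,
    biproduct.π (fun _ : Fin 1 => A) 0, by simp⟩⟩⟩

/-- The subcategory obtained from `𝒯` by replacing `T₀` by `T₁`. -/
def mutSub (𝒯 : ObjectProperty C) (T₀ T₁ : C) : ObjectProperty C :=
  addClosure fun A => without 𝒯 T₀ A ∨ A = T₁

theorem mem_mutSub (𝒯 : ObjectProperty C) (T₀ T₁ : C) : mutSub 𝒯 T₀ T₁ T₁ :=
  mem_addClosure (Or.inr rfl)

namespace Extri

variable (X : Extri K C)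

/-- Exchange conflations `T₁ ⟶ T⁺ ⟶ T₀` and `T₀ ⟶ T⁻ ⟶ T₁`. -/
structure Exchange (𝒯 : ObjectProperty C) (T₀ T₁ : C) where
  Tp : C
  Tm : C
  mem_p : without 𝒯 T₀ Tp
  mem_m : without 𝒯 T₀ Tm
  ip : T₁ ⟶ Tp
  pp : Tp ⟶ T₀
  im : T₀ ⟶ Tm
  pm : Tm ⟶ T₁
  δp : X.Ext T₀ T₁
  δm : X.Ext T₁ T₀
  real_p : X.Realizes δp ip pp
  real_m : X.Realizes δm im pm
  nonsplit_p : δp ≠ 0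
  nonsplit_m : δm ≠ 0
  approx_p : ∀ A : C, without 𝒯 T₀ A → ∀ f : A ⟶ T₀, ∃ g : A ⟶ Tp, g ≫ pp = f
  approx_m : ∀ A : C, without 𝒯 T₀ A → ∀ f : T₀ ⟶ A, ∃ g : Tm ⟶ A, im ≫ g = f

/-- `T₀` is a mutable indecomposable object of `𝒯` and `T₁` is its mutation. -/
structure IsMutation (𝒯 : ObjectProperty C) (T₀ T₁ : C) : Prop where
  mem : 𝒯 T₀
  indec : Indecomposable T₀
  indec' : Indecomposable T₁
  not_iso : ¬ Nonempty (T₀ ≅ T₁)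
  ct : X.IsCT (mutSub 𝒯 T₀ T₁)
  exchange : Nonempty (X.Exchange 𝒯 T₀ T₁)

/-- Cluster-tilting subcategories reachable from `𝒯` by finite sequences of mutations. -/
inductive Reachable (𝒯 : ObjectProperty C) : ObjectProperty C → Prop
  | refl : Reachable 𝒯 𝒯
  | step {𝒰 : ObjectProperty C} {T₀ T₁ : C} : Reachable 𝒯 𝒰 → X.IsMutation 𝒰 T₀ T₁ →
      Reachable 𝒯 (mutSub 𝒰 T₀ T₁)

/-- `(C, 𝒯)` has a cluster structure: all non-projective indecomposables of cluster-tilting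
subcategories are mutable, there are no loops or 2-cycles in the reachable cluster-tilting
subcategories, and their exchange matrices mutate by the Fomin–Zelevinsky rule. -/
structure HasClusterStructure (𝒯 : ObjectProperty C) : Prop where
  weak : ∀ 𝒰 : ObjectProperty C, X.IsCT 𝒰 → ∀ U : C, 𝒰 U → Indecomposable U → ¬ X.IsProj U →
    ∃ U' : C, X.IsMutation 𝒰 U U'
  no_loop : ∀ 𝒰, X.Reachable 𝒯 𝒰 → ∀ U : C, 𝒰 U → Indecomposable U → ¬ X.IsProj U →
    NoLoopAt K 𝒰 U ∧ NoTwoCycleAt K 𝒰 U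
  exch_left : ∀ 𝒰, X.Reachable 𝒯 𝒰 → ∀ U U' : C, X.IsMutation 𝒰 U U' →
    ∀ B : C, 𝒰 B → Indecomposable B → ¬ X.IsProj B → ¬ Nonempty (B ≅ U) →
      exch K (mutSub 𝒰 U U') U' B = - exch K 𝒰 U B
  exch_right : ∀ 𝒰, X.Reachable 𝒯 𝒰 → ∀ U U' : C, X.IsMutation 𝒰 U U' →
    ∀ A : C, 𝒰 A → Indecomposable A → ¬ Nonempty (A ≅ U) →
      exch K (mutSub 𝒰 U U') A U' = - exch K 𝒰 A U
  exch_other : ∀ 𝒰, X.Reachable 𝒯 𝒰 → ∀ U U' : C, X.IsMutation 𝒰 U U' →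
    ∀ A B : C, 𝒰 A → Indecomposable A → ¬ Nonempty (A ≅ U) →
      𝒰 B → Indecomposable B → ¬ X.IsProj B → ¬ Nonempty (B ≅ U) →
      exch K (mutSub 𝒰 U U') A B = exch K 𝒰 A B
        + max (exch K 𝒰 A U) 0 * max (exch K 𝒰 U B) 0
        - max (- exch K 𝒰 A U) 0 * max (- exch K 𝒰 U B) 0

end Extri

/-- A complete irredundant family of representatives of the isomorphism classes of indecomposable
objects of `𝒯`. -/
structure IsIndecFamily (𝒯 : ObjectProperty C) {I : Type*} (Y : I → C) : Prop where
  mem : ∀ i, 𝒯 (Y i)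
  indec : ∀ i, Indecomposable (Y i)
  inj : ∀ i j, Nonempty (Y i ≅ Y j) → i = j
  complete : ∀ A : C, 𝒯 A → Indecomposable A → ∃ i, Nonempty (A ≅ Y i)

/-! ### Grothendieck groups -/

/-- The additive (split) Grothendieck group of a full additive subcategory. -/
def K0 (𝒯 : ObjectProperty C) : Type u :=
  FreeAbelianGroup {A : C // 𝒯 A} ⧸ AddSubgroup.closure
    {x | ∃ A B D : {A : C // 𝒯 A}, Nonempty (D.1 ≅ A.1 ⊞ B.1) ∧
      x = FreeAbelianGroup.of D - FreeAbelianGroup.of A - FreeAbelianGroup.of B}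

instance (𝒯 : ObjectProperty C) : AddCommGroup (K0 𝒯) :=
  inferInstanceAs (AddCommGroup (_ ⧸ _))

/-- The class of an object. -/
def K0.cls {𝒯 : ObjectProperty C} (A : C) (hA : 𝒯 A) : K0 𝒯 :=
  QuotientAddGroup.mk (FreeAbelianGroup.of ⟨A, hA⟩)

variable (K) in
/-- `𝒯`-modules: contravariant `K`-linear functors from `𝒯` to vector spaces. -/
structure TMod (𝒯 : ObjectProperty C) where
  F : 𝒯.FullSubcategoryᵒᵖ ⥤ ModuleCat.{v} K
  map_add : ∀ {A B : 𝒯.FullSubcategory} (f g : A ⟶ B), F.map (f + g).op = F.map f.op + F.map g.op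
  map_smul : ∀ {A B : 𝒯.FullSubcategory} (r : K) (f : A ⟶ B), F.map (r • f).op = r • F.map f.op

namespace TMod

variable {𝒯 : ObjectProperty C}

/-- The value of a module at an object of `𝒯`. -/
abbrev val (M : TMod K 𝒯) (A : C) (hA : 𝒯 A) : Type v := M.F.obj (op ⟨A, hA⟩)

/-- The action of a morphism. -/
def act (M : TMod K 𝒯) {A B : C} (hA : 𝒯 A) (hB : 𝒯 B) (f : A ⟶ B) :
    M.val B hB →ₗ[K] M.val A hA :=
  (M.F.map (ObjectProperty.homMk f : (⟨A, hA⟩ : 𝒯.FullSubcategory) ⟶ ⟨B, hB⟩).op).hom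

theorem act_id (M : TMod K 𝒯) {A : C} (hA : 𝒯 A) (m : M.val A hA) : M.act hA hA (𝟙 A) m = m := by
  have : (ObjectProperty.homMk (𝟙 A) : (⟨A, hA⟩ : 𝒯.FullSubcategory) ⟶ ⟨A, hA⟩) = 𝟙 _ := rfl
  simp [act, this]

theorem act_comp (M : TMod K 𝒯) {A B D : C} (hA : 𝒯 A) (hB : 𝒯 B) (hD : 𝒯 D) (f : A ⟶ B)
    (g : B ⟶ D) (m : M.val D hD) : M.act hA hD (f ≫ g) m = M.act hA hB f (M.act hB hD g m) := by
  have : (ObjectProperty.homMk (f ≫ g) : (⟨A, hA⟩ : 𝒯.FullSubcategory) ⟶ ⟨D, hD⟩) =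
    (ObjectProperty.homMk f : (⟨A, hA⟩ : 𝒯.FullSubcategory) ⟶ ⟨B, hB⟩) ≫
      (ObjectProperty.homMk g : (⟨B, hB⟩ : 𝒯.FullSubcategory) ⟶ ⟨D, hD⟩) := rfl
  simp [act, this]

theorem act_add (M : TMod K 𝒯) {A B : C} (hA : 𝒯 A) (hB : 𝒯 B) (f g : A ⟶ B)
    (m : M.val B hB) : M.act hA hB (f + g) m = M.act hA hB f m + M.act hA hB g m := by
  have := M.map_add (ObjectProperty.homMk f : (⟨A, hA⟩ : 𝒯.FullSubcategory) ⟶ ⟨B, hB⟩)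
    (ObjectProperty.homMk g : (⟨A, hA⟩ : 𝒯.FullSubcategory) ⟶ ⟨B, hB⟩)
  have h := congrArg (fun z => z.hom m) this
  exact h

/-- Short exact sequences of modules. -/
def ShortExact (M' M M'' : TMod K 𝒯) : Prop :=
  ∃ (f : M'.F ⟶ M.F) (g : M.F ⟶ M''.F), ∀ A, Function.Injective (f.app A).hom ∧
    Function.Exact (f.app A).hom (g.app A).hom ∧ Function.Surjective (g.app A).hom

/-- Locally finite-dimensional modules. -/
def IsLfd (M : TMod K 𝒯) : Prop := ∀ (A : C) (hA : 𝒯 A), FiniteDimensional K (M.val A hA)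

/-- Finitely presented modules over the stable category of `𝒯`, as `𝒯`-modules: cokernels of maps
`Hom(-, T₁) ⟶ Hom(-, T₀)` of stable Hom-functors; `m` is the image of the identity of `T₀`. -/
def IsFpStable (X : Extri K C) (M : TMod K 𝒯) : Prop :=
  ∃ (T₀ T₁ : C) (h₀ : 𝒯 T₀) (_ : 𝒯 T₁) (f : T₁ ⟶ T₀) (m : M.val T₀ h₀),
    ∀ (A : C) (hA : 𝒯 A), (∀ y : M.val A hA, ∃ a : A ⟶ T₀, M.act hA h₀ a m = y) ∧
      ∀ a : A ⟶ T₀, M.act hA h₀ a m = 0 ↔ ∃ g : A ⟶ T₁, FactorsThrough X.IsProj (a - g ≫ f)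

end TMod

/-- The Grothendieck group of a class `P` of modules: generators the modules in `P`, relations the
short exact sequences with all terms in `P`. -/
def K0Mod {𝒯 : ObjectProperty C} (P : TMod K 𝒯 → Prop) : Type _ :=
  FreeAbelianGroup {M : TMod K 𝒯 // P M} ⧸ AddSubgroup.closure
    {x | ∃ M' M M'' : {M : TMod K 𝒯 // P M}, M'.1.ShortExact M.1 M''.1 ∧
      x = FreeAbelianGroup.of M - FreeAbelianGroup.of M' - FreeAbelianGroup.of M''}

instance {𝒯 : ObjectProperty C} (P : TMod K 𝒯 → Prop) : AddCommGroup (K0Mod P) :=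
  inferInstanceAs (AddCommGroup (_ ⧸ _))

/-- The class of a module. -/
def K0Mod.cls {𝒯 : ObjectProperty C} {P : TMod K 𝒯 → Prop} (M : TMod K 𝒯) (hM : P M) : K0Mod P :=
  QuotientAddGroup.mk (FreeAbelianGroup.of ⟨M, hM⟩)

section Pairing

variable {𝒯 : ObjectProperty C}

theorem finrank_act_iso (M : TMod K 𝒯) {A B D : C} (hA : 𝒯 A) (hB : 𝒯 B) (hD : 𝒯 D)
    (e : D ≅ A ⊞ B) (hM : M.IsLfd) :
    Module.finrank K (M.val D hD) = Module.finrank K (M.val A hA) + Module.finrank K (M.val B hB) := by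
  have := hM A hA
  have := hM B hB
  rw [← Module.finrank_prod]
  refine LinearEquiv.finrank_eq (LinearEquiv.ofLinearMap
    ((M.act hA hD (biprod.inl ≫ e.inv)).prod (M.act hB hD (biprod.inr ≫ e.inv)))
    ((M.act hD hA (e.hom ≫ biprod.fst)).coprod (M.act hD hB (e.hom ≫ biprod.snd))) ?_ ?_)
  · have h0 : ∀ {P Q : C} (hP : 𝒯 P) (hQ : 𝒯 Q) (m : M.val Q hQ), M.act hP hQ 0 m = 0 := by
      intro P Q hP hQ m
      have := M.act_add hP hQ 0 0 m
      simpa using this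
    apply LinearMap.ext
    rintro ⟨a, b⟩
    simp [← M.act_comp, M.act_id, h0]
  · apply LinearMap.ext
    intro m
    have h : (e.hom ≫ biprod.fst) ≫ biprod.inl ≫ e.inv +
        (e.hom ≫ biprod.snd) ≫ biprod.inr ≫ e.inv = 𝟙 D := by
      have : e.hom ≫ (biprod.fst ≫ biprod.inl + biprod.snd ≫ biprod.inr) ≫ e.inv = 𝟙 D := by
        rw [biprod.total]; simp
      rw [← this]
      simp only [Preadditive.add_comp, Preadditive.comp_add, Category.assoc]
    show M.act hD hA _ (M.act hA hD _ m) + M.act hD hB _ (M.act hB hD _ m) = m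
    rw [← M.act_comp, ← M.act_comp, ← M.act_add, h, M.act_id]

/-- `[A] ↦ dim M(A)` for a locally finite-dimensional module `M`. -/
def dimHom (M : TMod K 𝒯) (hM : M.IsLfd) : K0 𝒯 →+ ℤ :=
  QuotientAddGroup.lift _
    (FreeAbelianGroup.lift fun A : {A : C // 𝒯 A} => (Module.finrank K (M.val A.1 A.2) : ℤ)) (by
      rw [AddSubgroup.closure_le]
      rintro _ ⟨A, B, D, ⟨e⟩, rfl⟩
      have := finrank_act_iso M A.2 B.2 D.2 e hM
      simp [this])

@[simp] theorem dimHom_cls (M : TMod K 𝒯) (hM : M.IsLfd) (A : C) (hA : 𝒯 A) :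
    dimHom M hM (K0.cls A hA) = Module.finrank K (M.val A hA) := by
  show FreeAbelianGroup.lift _ (FreeAbelianGroup.of _) = _
  rw [FreeAbelianGroup.lift_apply_of]

theorem K0_hom_ext {G : Type*} [AddCommGroup G] {f g : K0 𝒯 →+ G}
    (h : ∀ A (hA : 𝒯 A), f (K0.cls A hA) = g (K0.cls A hA)) : f = g := by
  refine QuotientAddGroup.addMonoidHom_ext _ (FreeAbelianGroup.lift_ext _ _ ?_)
  rintro ⟨A, hA⟩
  exact h A hA

/-- The pairing `⟨[M], [A]⟩ = dim M(A)`. -/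
def pairingLfd : K0Mod (TMod.IsLfd (K := K) (𝒯 := 𝒯)) →+ K0 𝒯 →+ ℤ :=
  QuotientAddGroup.lift _
    (FreeAbelianGroup.lift fun M : {M : TMod K 𝒯 // M.IsLfd} => dimHom M.1 M.2) (by
      rw [AddSubgroup.closure_le]
      rintro _ ⟨M', M, M'', ⟨f, g, hfg⟩, rfl⟩
      rw [SetLike.mem_coe, AddMonoidHom.mem_ker]
      refine K0_hom_ext fun A hA => ?_
      obtain ⟨h₁, h₂, h₃⟩ := hfg (op ⟨A, hA⟩)
      have := M.2 A hA
      have := M'.2 A hA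
      have := M''.2 A hA
      have e₁ := LinearMap.finrank_range_add_finrank_ker (g.app (op ⟨A, hA⟩)).hom
      have e₂ := LinearMap.finrank_range_of_inj h₁
      rw [LinearMap.range_eq_top.2 h₃, finrank_top, h₂.linearMap_ker_eq, e₂] at e₁
      simp [← e₁])

variable (K 𝒯) in
/-- The numerical Grothendieck group of locally finite-dimensional `𝒯`-modules: the quotient of
their Grothendieck group by the kernel of the pairing with `K0 𝒯`. -/
def K0num : Type _ :=
  K0Mod (TMod.IsLfd (K := K) (𝒯 := 𝒯)) ⧸ (pairingLfd (K := K) (𝒯 := 𝒯)).ker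

instance : AddCommGroup (K0num K 𝒯) := inferInstanceAs (AddCommGroup (_ ⧸ _))

/-- The class of a locally finite-dimensional module. -/
def K0num.cls (M : TMod K 𝒯) (hM : M.IsLfd) : K0num K 𝒯 := QuotientAddGroup.mk (K0Mod.cls M hM)

/-- The induced pairing of the numerical Grothendieck group with `K0 𝒯`. -/
def pairing : K0num K 𝒯 →+ K0 𝒯 →+ ℤ := QuotientAddGroup.lift _ pairingLfd le_rfl

/-- `w` is the negative part `[v]_-` of `v`: its coordinates (in terms of the classes of simple
modules, equivalently the pairings with indecomposable objects) are the negative parts of those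
of `v`. -/
def IsNegPart (v w : K0num K 𝒯) : Prop :=
  ∀ (T : C) (hT : 𝒯 T), Indecomposable T →
    pairing w (K0.cls T hT) = max (- pairing v (K0.cls T hT)) 0

end Pairing

/-! ### Simple modules and error modules -/

variable (K) in
/-- The module `S_U = Hom(-, U) / rad(-, U)` on `𝒰`. -/
def simple (𝒰 : ObjectProperty C) (U : C) : TMod K 𝒰 where
  F :=
    { obj := fun A => ModuleCat.of K ((A.unop.obj ⟶ U) ⧸ rad K A.unop.obj U)
      map := fun {A B} a => ModuleCat.ofHom (Submodule.mapQ (rad K A.unop.obj U)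
        (rad K B.unop.obj U) (Linear.leftComp K U a.unop.hom) (fun _ hf => comp_mem_rad _ hf))
      map_id := fun A => by
        ext f
        simp [Submodule.mapQ_apply]
      map_comp := fun a b => by
        ext f
        exact congrArg (Submodule.Quotient.mk) (Category.assoc b.unop.hom a.unop.hom f) }
  map_add := fun a b => by
    ext f
    exact congrArg (Submodule.Quotient.mk) (Preadditive.add_comp _ _ _ a.hom b.hom f)
  map_smul := fun r a => by
    ext f
    exact congrArg (Submodule.Quotient.mk) (Linear.smul_comp _ _ _ r a.hom f)

theorem simple_isLfd (h : ∀ A : C, FiniteDimensional K ((A ⟶ A) ⧸ rad K A A))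
    (𝒰 : ObjectProperty C) (U : C) : (simple K 𝒰 U).IsLfd := by
  intro A hA
  have := h (A ⊞ U)
  let φ : (A ⟶ U) →ₗ[K] ((A ⊞ U : C) ⟶ A ⊞ U) :=
    (Linear.leftComp K (A ⊞ U) (biprod.fst : A ⊞ U ⟶ A)).comp
      (Linear.rightComp K A (biprod.inr : U ⟶ A ⊞ U))
  have hφ : ∀ f, φ f = biprod.fst ≫ f ≫ biprod.inr := fun f => rfl
  have hle : rad K A U ≤ (rad K (A ⊞ U) (A ⊞ U)).comap φ := fun f hf =>
    comp_mem_rad _ (mem_rad_comp hf _)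
  suffices hinj : Function.Injective (Submodule.mapQ (rad K A U) _ φ hle) from
    FiniteDimensional.of_injective (Submodule.mapQ (rad K A U) _ φ hle) hinj
  rw [← LinearMap.ker_eq_bot, Submodule.ker_mapQ, Submodule.eq_bot_iff]
  rintro _ ⟨f, hf, rfl⟩
  rw [Submodule.mkQ_apply, Submodule.Quotient.mk_eq_zero]
  have h₂ : (biprod.inl ≫ φ f) ≫ biprod.snd ∈ rad K A U :=
    mem_rad_comp (comp_mem_rad (biprod.inl : A ⟶ A ⊞ U) hf) (biprod.snd : A ⊞ U ⟶ U)
  simpa [hφ] using h₂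

/-- The module `Ker Ext(-, i)` on `𝒯`. -/
def kerExt (X : Extri K C) (𝒯 : ObjectProperty C) {A B : C} (i : A ⟶ B) : TMod K 𝒯 where
  F :=
    { obj := fun T => ModuleCat.of K (LinearMap.ker (X.push (Z := T.unop.obj) i))
      map := fun {T T'} t => ModuleCat.ofHom ((X.pull t.unop.hom).restrict (fun δ hδ => by
        rw [LinearMap.mem_ker] at hδ ⊢
        rw [X.push_pull, hδ, map_zero]))
      map_id := fun T => by
        ext δ
        simp [X.pull_id]
      map_comp := fun s t => by
        ext δ
        simp [X.pull_comp] }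
  map_add := fun s t => by
    ext δ
    exact X.pull_add s.hom t.hom δ.1
  map_smul := fun r t => by
    ext δ
    exact X.pull_smul r t.hom δ.1

/-! ### Index, coindex, the adjoint of the coindex, and `β` -/

namespace Extri

variable (X : Extri K C)

/-- The defining property of the index `K0 𝒰 ⟶ K0 𝒯`: `ind [U] = [R] - [N]` for conflations
`N ⟶ R ⟶ U` with `N` and `R` in `𝒯`. -/
def IsIndex (𝒰 𝒯 : ObjectProperty C) (φ : K0 𝒰 →+ K0 𝒯) : Prop :=
  ∀ (U : C) (hU : 𝒰 U),
    (∃ (N R : C) (i : N ⟶ R) (p : R ⟶ U), 𝒯 N ∧ 𝒯 R ∧ X.Conflation i p) ∧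
    ∀ (N R : C) (hN : 𝒯 N) (hR : 𝒯 R) (i : N ⟶ R) (p : R ⟶ U), X.Conflation i p →
      φ (K0.cls U hU) = K0.cls R hR - K0.cls N hN

/-- The defining property of the coindex `K0 𝒰 ⟶ K0 𝒯`: `coind [U] = [L] - [N]` for conflations
`U ⟶ L ⟶ N` with `L` and `N` in `𝒯`. -/
def IsCoindex (𝒰 𝒯 : ObjectProperty C) (φ : K0 𝒰 →+ K0 𝒯) : Prop :=
  ∀ (U : C) (hU : 𝒰 U),
    (∃ (L N : C) (i : U ⟶ L) (p : L ⟶ N), 𝒯 L ∧ 𝒯 N ∧ X.Conflation i p) ∧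
    ∀ (L N : C) (hL : 𝒯 L) (hN : 𝒯 N) (i : U ⟶ L) (p : L ⟶ N), X.Conflation i p →
      φ (K0.cls U hU) = K0.cls L hL - K0.cls N hN

open Classical in
/-- The index `ind_𝒰^𝒯`. -/
def ind (𝒰 𝒯 : ObjectProperty C) : K0 𝒰 →+ K0 𝒯 :=
  if h : ∃ φ, X.IsIndex 𝒰 𝒯 φ then h.choose else 0

open Classical in
/-- The coindex `coind_𝒰^𝒯`. -/
def coind (𝒰 𝒯 : ObjectProperty C) : K0 𝒰 →+ K0 𝒯 :=
  if h : ∃ φ, X.IsCoindex 𝒰 𝒯 φ then h.choose else 0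

/-- `φ` is adjoint to the coindex `coind_𝒯^𝒰` for the pairings. -/
def IsIndbar (𝒰 𝒯 : ObjectProperty C) (φ : K0num K 𝒰 →+ K0num K 𝒯) : Prop :=
  ∀ (v : K0num K 𝒰) (t : K0 𝒯), pairing (φ v) t = pairing v (X.coind 𝒯 𝒰 t)

open Classical in
/-- The adjoint `indbar_𝒰^𝒯` of the coindex. -/
def indbar (𝒰 𝒯 : ObjectProperty C) : K0num K 𝒰 →+ K0num K 𝒯 :=
  if h : ∃ φ, X.IsIndbar 𝒰 𝒯 φ then h.choose else 0

end Extri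

/-- A bounded resolution of the `𝒯`-module `M` by representable modules over the lift of `𝒯` to the
exact category of an algebraic presentation. -/
structure Resolution {X : Extri K C} (L : AlgLift.{w, v, u, v₁, u₁} X) {𝒯 : ObjectProperty C}
    (M : TMod K 𝒯) where
  n : ℕ
  obj : ℕ → L.E
  mem : ∀ i, 𝒯 (L.F.obj (obj i))
  isZero : ∀ i, n < i → IsZero (obj i)
  d : ∀ i, obj (i + 1) ⟶ obj i
  /-- the augmentation, the image of the identity of `obj 0` -/
  aug : M.val (L.F.obj (obj 0)) (mem 0)
  surj : ∀ (A : L.E) (hA : 𝒯 (L.F.obj A)) (y : M.val (L.F.obj A) hA),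
    ∃ a : A ⟶ obj 0, M.act hA (mem 0) (L.F.map a) aug = y
  exact_zero : ∀ (A : L.E) (hA : 𝒯 (L.F.obj A)) (a : A ⟶ obj 0),
    M.act hA (mem 0) (L.F.map a) aug = 0 ↔ ∃ b : A ⟶ obj 1, b ≫ d 0 = a
  exact_succ : ∀ (A : L.E) (_ : 𝒯 (L.F.obj A)) (i : ℕ) (a : A ⟶ obj (i + 1)),
    a ≫ d i = 0 ↔ ∃ b : A ⟶ obj (i + 2), b ≫ d (i + 1) = a

/-- The alternating sum of the terms of a resolution, in `K0 𝒯`. -/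
def Resolution.euler {X : Extri K C} {L : AlgLift.{w, v, u, v₁, u₁} X} {𝒯 : ObjectProperty C}
    {M : TMod K 𝒯} (R : Resolution L M) : K0 𝒯 :=
  ∑ i ∈ Finset.range (R.n + 1), (-1 : ℤ) ^ i • K0.cls (L.F.obj (R.obj i)) (R.mem i)

/-- The defining property of the map `β` from the Grothendieck group of finitely presented stable
`𝒯`-modules to `K0 𝒯`: minus the class of a bounded projective resolution over a lift of `𝒯`. -/
def Extri.IsBeta (X : Extri K C) (𝒯 : ObjectProperty C)
    (φ : K0Mod (TMod.IsFpStable (𝒯 := 𝒯) X) →+ K0 𝒯) : Prop :=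
  ∀ (L : AlgLift.{w, v, u, v₁, u₁} X) (M : TMod K 𝒯) (hM : M.IsFpStable X),
    Nonempty (Resolution L M) ∧ ∀ R : Resolution L M, φ (K0Mod.cls M hM) = - R.euler

open Classical in
/-- The map `β_𝒯`. -/
def Extri.beta (X : Extri K C) (𝒯 : ObjectProperty C) :
    K0Mod (TMod.IsFpStable (𝒯 := 𝒯) X) →+ K0 𝒯 :=
  if h : ∃ φ, Extri.IsBeta.{w, v, u, v₁, u₁} X 𝒯 φ then h.choose else 0

/-- Cluster-tilting subcategories with labelled families of indecomposables obtained from an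
initial one by sequences of mutations (the last mutation is the head of the list). -/
inductive Extri.LabelledReach (X : Extri K C) {I : Type*} (p : I → Prop) (𝒯 : ObjectProperty C)
    (T : I → C) : List {i // p i} → ObjectProperty C → (I → C) → Prop
  | nil : LabelledReach X p 𝒯 T [] 𝒯 T
  | cons {l : List {i // p i}} {𝒰 : ObjectProperty C} {Y Y' : I → C} (k : {i // p i}) :
      LabelledReach X p 𝒯 T l 𝒰 Y → X.IsMutation 𝒰 (Y k) (Y' k) → (∀ i, i ≠ k.1 → Y' i = Y i) →
      LabelledReach X p 𝒯 T (k :: l) (mutSub 𝒰 (Y k) (Y' k)) Y'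

end

/-! ### Cluster algebras: seeds, `g`-vectors and `c`-vectors -/

section ClusterAlgebra

variable {I : Type*} (p : I → Prop)

/-- The ambient field of the cluster algebra with principal coefficients: rational functions in the
initial cluster variables (indexed by `I`) and the coefficients (indexed by the mutable indices). -/
abbrev Ambient := FractionRing (MvPolynomial (I ⊕ {i // p i}) ℚ)

/-- A seed with principal coefficients: extended cluster `x`, exchange matrix `B` (rows indexed by
all indices, columns by the mutable ones), and `C`-matrix (coefficient rows). -/
structure Seed where
  x : I → Ambient p
  B : I → {i // p i} → ℤ
  Cm : {i // p i} → {i // p i} → ℤ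

variable {p}

/-- The coefficient variable `y_j`. -/
def yVar (j : {i // p i}) : Ambient p :=
  algebraMap (MvPolynomial (I ⊕ {i // p i}) ℚ) _ (MvPolynomial.X (Sum.inr j))

open Classical in
/-- The initial seed with exchange matrix `B`. -/
def Seed.initial (B : I → {i // p i} → ℤ) : Seed p where
  x i := algebraMap (MvPolynomial (I ⊕ {i // p i}) ℚ) _ (MvPolynomial.X (Sum.inl i))
  B := B
  Cm i j := if i = j then 1 else 0

open Classical in
/-- Fomin–Zelevinsky mutation of seeds at `k`. -/
def Seed.mutate (s : Seed p) (k : {i // p i}) : Seed p where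
  x i := if i = k.1 then
      ((∏ᶠ j, yVar j ^ (s.Cm j k).toNat) * (∏ᶠ i, s.x i ^ (s.B i k).toNat) +
        (∏ᶠ j, yVar j ^ (- s.Cm j k).toNat) * (∏ᶠ i, s.x i ^ (- s.B i k).toNat)) / s.x k
    else s.x i
  B i j := if i = k.1 ∨ j = k then - s.B i j else
    s.B i j + max (s.B i k) 0 * max (s.B k j) 0 - max (- s.B i k) 0 * max (- s.B k j) 0
  Cm i j := if j = k then - s.Cm i j else
    s.Cm i j + max (s.Cm i k) 0 * max (s.B k j) 0 - max (- s.Cm i k) 0 * max (- s.B k j) 0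

/-- The seed obtained from the initial one by a sequence of mutations (the last mutation is the
head of the list). Column `j` of its matrix `Cm` is the `j`-th `c`-vector. -/
def seedAt (B : I → {i // p i} → ℤ) : List {i // p i} → Seed p
  | [] => Seed.initial B
  | k :: l => (seedAt B l).mutate k

open Classical in
/-- The `g`-vector grading: `x_i` has degree `e_i`, and `y_j` has degree minus the `j`-th column of
the initial exchange matrix. -/
def gWeight (B : I → {i // p i} → ℤ) : I ⊕ {i // p i} → I → ℤ
  | Sum.inl i => Pi.single i 1
  | Sum.inr j => fun i => - B i j

/-- `g` is the `g`-vector of the element `z` of the ambient field: `z` is a quotient of non-zero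
homogeneous polynomials and has degree `g`. -/
def IsGVector (B : I → {i // p i} → ℤ) (z : Ambient p) (g : I → ℤ) : Prop :=
  ∃ (P Q : MvPolynomial (I ⊕ {i // p i}) ℚ) (a b : I → ℤ), P ≠ 0 ∧ Q ≠ 0 ∧
    MvPolynomial.IsWeightedHomogeneous (gWeight B) P a ∧
    MvPolynomial.IsWeightedHomogeneous (gWeight B) Q b ∧
    z * algebraMap _ _ Q = algebraMap _ _ P ∧ g = a - b

end ClusterAlgebra

end ClusterCat

end

open ClusterCat

noncomputable section

set_option linter.unusedSectionVars false
set_option linter.checkUnivs false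

namespace ClusterCat

variable {K : Type w} [Field K] {C : Type u} [Category.{v} C] [Preadditive C] [Linear K C]
  [HasFiniteBiproducts C]
/-! ### Conflations -/

namespace Extri

variable (X : Extri K C)

/-! The mutation of `c` is read off from coresolutions T ⟶ L ⟶ N of objects T of 𝒯 by objects of 𝒰:
the coindex of T is [L] - [N], so `c` pairs with T as the count of U in L minus the count of U in N.
As T is rigid, a summand U common to L and N can be cancelled (`ExPair.exists_cores`), so U occurs
on one side only. If it occurs in N, a pullback along copies of U' ⟶ U⁺ ⟶ U yields a coresolution in
𝒰'; if it occurs in L, composition with copies of U ⟶ U⁻ ⟶ U' does (`ExPair.exists_cores_change`).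
The multiplicity of U reappears as that of U' on the other side, and the other multiplicities change
by those in U⁺ or U⁻. This gives the formulae for the adjoint of the coindex. By 2-Calabi–Yau
duality (`Extri.IsStablyTwoCY.finrank_ker_push`), Ker Ext(T, i) has the dimension of the cokernel of
Ext(U⁻, T) ⟶ Ext(U, T), which is the count of U in N, so the error module has class [c]_-.

The index fails to be additive on U ⟶ U⁻ ⟶ U', and β measures the failure. A conflation A ⟶ B ⟶ D
lifts to an exact category, where Hom is left exact; on the lift of 𝒯 the cokernel of Hom(-, B) ⟶
Hom(-, D) is Ker Ext(-, A ⟶ B). Each Hom(-, Z) has a two-term resolution with Euler characteristic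
ind Z, so mapping cones resolve the cokernel with Euler characteristic ind D - ind B + ind A
(`Pres.exists_resolution`). Euler characteristics of resolutions are unique, whence β and the error
term.

Without loops, radical maps from and to U factor through the exchange maps
(`ExPair.noLoop_of_noLoopAt`), so the exchange matrix records multiplicities in U⁺ and U⁻.
Multiplicities make sense since completeness for the radical topology lifts idempotents and makes
indecomposables local.

For the cluster algebra, `SeedInv` compares seeds with labelled cluster-tilting subcategories and is
preserved by mutation (`SeedInv.mutate`). The c-vectors follow the formula above. For g-vectors, the
defect ind B - ind A - ind D of a conflation depends only on the dimension vector of its cokernel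
module, each simple factor at t contributing column t of the exchange matrix of 𝒯 (`defect_eq_sum`).
As y_t has minus this column as degree, both monomials of the exchange relation have degree ind U +
ind U'. -/

theorem push_zero {Z A B : C} (δ : X.Ext Z A) : X.push (0 : A ⟶ B) δ = 0 := by
  have := X.push_smul (0 : K) (0 : A ⟶ B) δ
  simpa using this

theorem pull_zero {Z Z' A : C} (δ : X.Ext Z A) : X.pull (0 : Z' ⟶ Z) δ = 0 := by
  have := X.pull_smul (0 : K) (0 : Z' ⟶ Z) δ
  simpa using this

theorem push_sub {Z A B : C} (a b : A ⟶ B) (δ : X.Ext Z A) :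
    X.push (a - b) δ = X.push a δ - X.push b δ := by
  have := X.push_add (a - b) b δ
  rw [sub_add_cancel] at this
  rw [this, add_sub_cancel_right]

theorem pull_sub {Z Z' A : C} (a b : Z' ⟶ Z) (δ : X.Ext Z A) :
    X.pull (a - b) δ = X.pull a δ - X.pull b δ := by
  have := X.pull_add (a - b) b δ
  rw [sub_add_cancel] at this
  rw [this, add_sub_cancel_right]

theorem isZero_ext_right {Z A : C} (hA : IsZero A) (δ : X.Ext Z A) : δ = 0 := by
  rw [← X.push_id δ, hA.eq_of_src (𝟙 A) 0, X.push_zero]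

section

variable {X}
variable {A B D : C} {δ : X.Ext D A} {i : A ⟶ B} {p : B ⟶ D}

/-- Transport of a realization along an isomorphism of the middle terms. -/
theorem realizes_of_iso (h : X.Realizes δ i p) {B' : C} (b : B ≅ B') {i' : A ⟶ B'} {p' : B' ⟶ D}
    (h₁ : i ≫ b.hom = i') (h₂ : b.hom ≫ p' = p) : X.Realizes δ i' p' := by
  have := X.realizes_iso b h
  rwa [h₁, ← h₂, Iso.inv_hom_id_assoc] at this

/-- Split sequences realize zero. -/
theorem realizes_split {A D B : C} (i : A ⟶ B) (p : B ⟶ D) (r : B ⟶ A) (s : D ⟶ B)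
    (h₁ : i ≫ r = 𝟙 A) (h₂ : s ≫ p = 𝟙 D) (h₃ : i ≫ p = 0) (h₄ : r ≫ i + p ≫ s = 𝟙 B) :
    X.Realizes (0 : X.Ext D A) i p := by
  have h₅ : s ≫ r = 0 := by
    have h : s ≫ (r ≫ i + p ≫ s) ≫ r = s ≫ r := by rw [h₄]; simp
    simp only [Preadditive.add_comp, Preadditive.comp_add, Category.assoc, h₁, Category.comp_id] at h
    rw [reassoc_of% h₂] at h
    simpa using h
  refine realizes_of_iso (X.realizes_zero A D) ⟨biprod.desc i s, biprod.lift r p, ?_, ?_⟩ ?_ ?_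
  · ext <;> simp [h₁, h₂, h₃, h₅]
  · simpa using h₄
  · simp
  · ext <;> simp [h₂, h₃]

/-- ET3 applied to the maps 1 and i from the split conflation A = A ⟶ 0 factors i ≫ p through a zero
object. -/
theorem Realizes.comp_zero (h : X.Realizes δ i p) : i ≫ p = 0 := by
  obtain ⟨O, hO⟩ := HasZeroObject.zero (C := C)
  have h0 : X.Realizes (0 : X.Ext O A) (𝟙 A) (0 : A ⟶ O) :=
    realizes_split _ _ (𝟙 A) 0 (by simp) (hO.eq_of_src _ _) (by simp) (by simp)
  obtain ⟨c, hc, -⟩ := X.et3 h0 h (𝟙 A) i (by simp)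
  simpa using hc.symm

/-- The split conflation on A ⊞ B maps to the given one by (i, 1) and p; ET3op then writes the
pulled back class as a push of zero. -/
theorem Realizes.pull_deflation (h : X.Realizes δ i p) : X.pull p δ = 0 := by
  obtain ⟨a, -, ha⟩ := X.et3op (X.realizes_zero A B) h (biprod.desc i (𝟙 B)) p (by
    ext <;> simp [h.comp_zero])
  rw [← ha, map_zero]

theorem Realizes.push_inflation (h : X.Realizes δ i p) : X.push i δ = 0 := by
  obtain ⟨c, -, hc⟩ := X.et3 h (X.realizes_zero B D) i (biprod.lift (𝟙 B) p) (by
    ext <;> simp [h.comp_zero])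
  rw [hc, map_zero]

/-- Exactness of `Hom(T, A) ⟶ Hom(T, B) ⟶ Hom(T, D)`. -/
theorem Realizes.exists_lift (h : X.Realizes δ i p) {T : C} (f : T ⟶ B) (hf : f ≫ p = 0) :
    ∃ g : T ⟶ A, g ≫ i = f := by
  obtain ⟨O, hO⟩ := HasZeroObject.zero (C := C)
  have h0 : X.Realizes (0 : X.Ext O T) (𝟙 T) (0 : T ⟶ O) :=
    realizes_split _ _ (𝟙 T) 0 (by simp) (hO.eq_of_src _ _) (by simp) (by simp)
  obtain ⟨a, ha, -⟩ := X.et3op h0 h f 0 (by simp [hf])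
  exact ⟨a, by simpa using ha.symm⟩

/-- Exactness of `Hom(D, T) ⟶ Hom(B, T) ⟶ Hom(A, T)`. -/
theorem Realizes.exists_desc (h : X.Realizes δ i p) {T : C} (f : B ⟶ T) (hf : i ≫ f = 0) :
    ∃ g : D ⟶ T, p ≫ g = f := by
  obtain ⟨O, hO⟩ := HasZeroObject.zero (C := C)
  have h0 : X.Realizes (0 : X.Ext T O) (0 : O ⟶ T) (𝟙 T) :=
    realizes_split _ _ 0 (𝟙 T) (hO.eq_of_src _ _) (by simp) (by simp) (by simp)
  obtain ⟨c, hc, -⟩ := X.et3 h h0 0 f (by simp [hf])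
  exact ⟨c, by simpa using hc⟩

/-- Exactness of `Hom(T, B) ⟶ Hom(T, D) ⟶ Ext(T, A)`. -/
theorem Realizes.pull_eq_zero_iff (h : X.Realizes δ i p) {T : C} (f : T ⟶ D) :
    X.pull f δ = 0 ↔ ∃ g : T ⟶ B, g ≫ p = f := by
  constructor
  · intro hf
    obtain ⟨b, -, hb⟩ := X.realizes_map (X.realizes_zero A T) h (𝟙 A) f (by simp [hf])
    exact ⟨biprod.inr ≫ b, by rw [Category.assoc, ← hb]; simp⟩
  · rintro ⟨g, rfl⟩
    rw [X.pull_comp, h.pull_deflation, map_zero]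

/-- Exactness of `Hom(B, T) ⟶ Hom(A, T) ⟶ Ext(D, T)`. -/
theorem Realizes.push_eq_zero_iff (h : X.Realizes δ i p) {T : C} (f : A ⟶ T) :
    X.push f δ = 0 ↔ ∃ g : B ⟶ T, i ≫ g = f := by
  constructor
  · intro hf
    obtain ⟨b, hb, -⟩ := X.realizes_map h (X.realizes_zero T D) f (𝟙 D) (by simp [hf])
    exact ⟨b ≫ biprod.fst, by rw [← Category.assoc, hb]; simp⟩
  · rintro ⟨g, rfl⟩
    rw [X.push_comp, h.push_inflation, map_zero]

/-- Exactness of `Hom(T, D) ⟶ Ext(T, A) ⟶ Ext(T, B)`. -/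
theorem Realizes.exists_pull (h : X.Realizes δ i p) {T : C} (ε : X.Ext T A) (hε : X.push i ε = 0) :
    ∃ f : T ⟶ D, X.pull f δ = ε := by
  -- Realizing ε turns the vanishing of its push along i into an extension of i to the middle term
  -- of ε; ET3 supplies the map of third terms.
  obtain ⟨M, m, q, hM⟩ := X.exists_realizes ε
  obtain ⟨g, hg⟩ := (hM.push_eq_zero_iff i).1 hε
  obtain ⟨c, -, hc⟩ := X.et3 hM h (𝟙 A) g (by simp [hg])
  exact ⟨c, by rw [← hc, X.push_id]⟩

/-- Exactness of `Hom(A, T) ⟶ Ext(D, T) ⟶ Ext(B, T)`. -/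
theorem Realizes.exists_push (h : X.Realizes δ i p) {T : C} (ε : X.Ext D T) (hε : X.pull p ε = 0) :
    ∃ f : A ⟶ T, X.push f δ = ε := by
  obtain ⟨M, m, q, hM⟩ := X.exists_realizes ε
  obtain ⟨g, hg⟩ := (hM.pull_eq_zero_iff p).1 hε
  obtain ⟨a, -, ha⟩ := X.et3op h hM g (𝟙 D) (by simp [hg])
  exact ⟨a, by rw [ha, X.pull_id]⟩

end

/-- The inverse of 1 - n with n² = 0 is 1 + n. This plays the role of the five lemma below:
endomorphisms compatible with identities on a conflation differ from 1 by a square-zero map. -/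
theorem isIso_of_one_sub_sq_zero {A : C} (f : A ⟶ A) (h : (𝟙 A - f) ≫ (𝟙 A - f) = 0) : IsIso f := by
  refine ⟨𝟙 A + (𝟙 A - f), ?_, ?_⟩ <;>
  · simp only [Preadditive.sub_comp, Preadditive.comp_sub, Preadditive.comp_add,
      Preadditive.add_comp, Category.id_comp, Category.comp_id] at h ⊢
    rw [sub_eq_zero] at h
    rw [← sub_eq_zero, ← neg_eq_zero, ← sub_eq_zero.2 h]
    abel

theorem iso_of_isIso_comp {A B : C} (f : A ⟶ B) (g : B ⟶ A) (h₁ : IsIso (f ≫ g))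
    (h₂ : IsIso (g ≫ f)) : IsIso f := by
  have : IsSplitMono f := ⟨⟨g ≫ inv (f ≫ g), by rw [← Category.assoc]; simp⟩⟩
  have : Epi f := by
    have : Epi (g ≫ f) := inferInstance
    exact epi_of_epi g f
  exact isIso_of_epi_of_isSplitMono f

/-! ### Transport of conflations along isomorphisms, pullbacks and pushouts. -/

variable {X}

/-- Realizations of the images of an extension under isomorphisms of the end terms. -/
theorem realizes_of_iso_ends {A B D A' D' : C} {δ : X.Ext D A} {i : A ⟶ B} {p : B ⟶ D}
    (h : X.Realizes δ i p) (a : A' ≅ A) (d : D ≅ D') :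
    X.Realizes (X.push a.inv (X.pull d.inv δ)) (a.hom ≫ i) (p ≫ d.hom) := by
  obtain ⟨M, m, q, hM⟩ := X.exists_realizes (X.push a.inv (X.pull d.inv δ))
  obtain ⟨b, hb₁, hb₂⟩ := X.realizes_map h hM a.inv d.hom (by
    rw [← X.push_pull, ← X.pull_comp]; simp [X.pull_id])
  obtain ⟨b', hb₁', hb₂'⟩ := X.realizes_map hM h a.hom d.inv (by
    rw [← X.push_comp]; simp [X.push_id])
  -- Such an f differs from 1 by a map which factors as g ≫ i, and i is killed by 1 - f.
  have key : ∀ {A B D : C} {δ : X.Ext D A} {i : A ⟶ B} {p : B ⟶ D}, X.Realizes δ i p →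
      ∀ f : B ⟶ B, i ≫ f = i → f ≫ p = p → IsIso f := by
    intro A B D δ i p h f h₁ h₂
    apply isIso_of_one_sub_sq_zero
    obtain ⟨g, hg⟩ := h.exists_lift (𝟙 B - f) (by simp [h₂])
    rw [← hg, Category.assoc, hg, Preadditive.comp_sub, h₁]
    simp
  have h₁ : IsIso (b ≫ b') := key h _ (by rw [reassoc_of% hb₁, hb₁']; simp)
    (by rw [Category.assoc, ← hb₂', ← reassoc_of% hb₂]; simp)
  have h₂ : IsIso (b' ≫ b) := key hM _ (by rw [reassoc_of% hb₁', hb₁]; simp)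
    (by rw [Category.assoc, ← hb₂, ← reassoc_of% hb₂']; simp)
  have h₃ := iso_of_isIso_comp b' b h₂ h₁
  refine realizes_of_iso hM (asIso b') hb₁' ?_
  simp [← reassoc_of% hb₂']

theorem Conflation.of_iso_ends {A B D A' D' : C} {i : A ⟶ B} {p : B ⟶ D}
    (h : X.Conflation i p) (a : A' ≅ A) (d : D ≅ D') : X.Conflation (a.hom ≫ i) (p ≫ d.hom) := by
  obtain ⟨δ, h⟩ := h
  exact ⟨_, realizes_of_iso_ends h a d⟩

theorem Conflation.biprod {A B D A' B' D' : C} {i : A ⟶ B} {p : B ⟶ D} {i' : A' ⟶ B'}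
    {p' : B' ⟶ D'} (h : X.Conflation i p) (h' : X.Conflation i' p') :
    X.Conflation (biprod.map i i') (biprod.map p p') := by
  obtain ⟨δ, h⟩ := h
  obtain ⟨δ', h'⟩ := h'
  exact ⟨_, X.realizes_sum h h'⟩

theorem conflation_id_zero (A : C) {O : C} (hO : IsZero O) :
    X.Conflation (𝟙 A) (0 : A ⟶ O) :=
  ⟨0, realizes_split _ _ (𝟙 A) 0 (by simp) (hO.eq_of_src _ _) (by simp) (by simp)⟩

theorem conflation_zero_id (A : C) {O : C} (hO : IsZero O) :
    X.Conflation (0 : O ⟶ A) (𝟙 A) :=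
  ⟨0, realizes_split _ _ 0 (𝟙 A) (hO.eq_of_src _ _) (by simp) (by simp) (by simp)⟩

/-- A realization of a zero extension is split. -/
theorem Realizes.iso_biprod {A B D : C} {i : A ⟶ B} {p : B ⟶ D}
    (h : X.Realizes (0 : X.Ext D A) i p) : Nonempty (B ≅ A ⊞ D) := by
  obtain ⟨b, -, -⟩ := X.realizes_unique h (X.realizes_zero A D)
  exact ⟨b⟩

/-- The kernel of a deflation is unique. -/
theorem kernel_unique {A A' B D : C} {δ : X.Ext D A} {δ' : X.Ext D A'} {i : A ⟶ B} {i' : A' ⟶ B}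
    {p : B ⟶ D} (h : X.Realizes δ i p) (h' : X.Realizes δ' i' p) : Nonempty (A ≅ A') := by
  obtain ⟨a, ha, hδ⟩ := X.et3op h h' (𝟙 B) (𝟙 D) (by simp)
  obtain ⟨a', ha', hδ'⟩ := X.et3op h' h (𝟙 B) (𝟙 D) (by simp)
  simp only [Category.comp_id, X.pull_id] at ha ha' hδ hδ'
  have key : ∀ {A : C} {δ : X.Ext D A} {i : A ⟶ B}, X.Realizes δ i p → ∀ f : A ⟶ A, f ≫ i = i →
      X.push f δ = δ → IsIso f := by
    intro A δ i h f h₁ h₂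
    apply isIso_of_one_sub_sq_zero
    obtain ⟨g, hg⟩ := (h.push_eq_zero_iff (𝟙 A - f)).1 (by rw [X.push_sub, X.push_id, h₂, sub_self])
    nth_rw 2 [← hg]
    rw [← Category.assoc, Preadditive.sub_comp, h₁]
    simp
  have h₁ : IsIso (a ≫ a') := key h _ (by rw [Category.assoc, ← ha', ← ha])
    (by rw [X.push_comp, hδ, hδ'])
  have h₂ : IsIso (a' ≫ a) := key h' _ (by rw [Category.assoc, ← ha, ← ha'])
    (by rw [X.push_comp, hδ', hδ])
  have := iso_of_isIso_comp a a' h₁ h₂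
  exact ⟨asIso a⟩

/-- The cokernel of an inflation is unique. -/
theorem cokernel_unique {A B D D' : C} {δ : X.Ext D A} {δ' : X.Ext D' A} {i : A ⟶ B} {p : B ⟶ D}
    {p' : B ⟶ D'} (h : X.Realizes δ i p) (h' : X.Realizes δ' i p') : Nonempty (D ≅ D') := by
  obtain ⟨a, ha, hδ⟩ := X.et3 h h' (𝟙 A) (𝟙 B) (by simp)
  obtain ⟨a', ha', hδ'⟩ := X.et3 h' h (𝟙 A) (𝟙 B) (by simp)
  simp only [Category.id_comp, X.push_id] at ha ha' hδ hδ'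
  have key : ∀ {D : C} {δ : X.Ext D A} {p : B ⟶ D}, X.Realizes δ i p → ∀ f : D ⟶ D, p ≫ f = p →
      X.pull f δ = δ → IsIso f := by
    intro D δ p h f h₁ h₂
    apply isIso_of_one_sub_sq_zero
    obtain ⟨g, hg⟩ := (h.pull_eq_zero_iff (𝟙 D - f)).1 (by rw [X.pull_sub, X.pull_id, h₂, sub_self])
    rw [← hg, Category.assoc, hg, Preadditive.comp_sub, h₁]
    simp
  have h₁ : IsIso (a ≫ a') := key h _ (by rw [reassoc_of% ha, ha'])
    (by rw [X.pull_comp, ← hδ', ← hδ])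
  have h₂ : IsIso (a' ≫ a) := key h' _ (by rw [reassoc_of% ha', ha])
    (by rw [X.pull_comp, ← hδ, ← hδ'])
  have := iso_of_isIso_comp a a' h₁ h₂
  exact ⟨asIso a⟩

/-- Adding a morphism `f : W ⟶ D` to a deflation `p : B ⟶ D`. -/
theorem Realizes.desc_deflation {A B D : C} {δ : X.Ext D A} {i : A ⟶ B} {p : B ⟶ D}
    (h : X.Realizes δ i p) {W : C} (f : W ⟶ D) :
    ∃ (N : C) (k : N ⟶ B ⊞ W) (d : A ⟶ N) (e : N ⟶ W), X.Conflation k (biprod.desc p f) ∧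
      X.Realizes (X.pull f δ) d e := by
  obtain ⟨O, hO⟩ := HasZeroObject.zero (C := C)
  have h0 : X.Realizes (0 : X.Ext W O) (0 : O ⟶ W) (𝟙 W) :=
    realizes_split _ _ 0 (𝟙 W) (hO.eq_of_src _ _) (by simp) (by simp) (by simp)
  have h₁ : X.Realizes (X.pull biprod.fst δ : X.Ext (D ⊞ W) A) (i ≫ biprod.inl)
      (biprod.map p (𝟙 W)) := by
    have := realizes_of_iso_ends (X.realizes_sum h h0)
      (A' := A) ⟨biprod.inl, biprod.fst, by simp, by
        ext
        · simp
        · simp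
        · exact hO.eq_of_src _ _
        · exact hO.eq_of_src _ _⟩ (Iso.refl _)
    simpa [X.pull_id, ← X.push_comp, X.push_id] using this
  -- The map (p, f) is the composite of the deflation p ⊕ 1 onto D ⊞ W with the split deflation (1,
  -- f), whose kernel is W embedded by (-f, 1). ET4op gives the kernel of the composite.
  have h₂ : X.Realizes (0 : X.Ext D W) (biprod.lift (-f) (𝟙 W)) (biprod.desc (𝟙 D) f) :=
    realizes_split _ _ biprod.snd biprod.inl (by simp) (by simp) (by simp) (by
      ext <;> simp)
  obtain ⟨N, d, e, h', δ'', r₁, -, -, r₂, -, -⟩ := X.et4op h₁ h₂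
  have hp : biprod.map p (𝟙 W) ≫ biprod.desc (𝟙 D) f = biprod.desc p f := by ext <;> simp
  rw [hp] at r₁
  rw [← X.pull_comp, biprod.lift_fst] at r₂
  -- ET4op produces the pullback along -f; the sign is absorbed by the automorphism -1 of A.
  refine ⟨N, h', (-𝟙 A) ≫ d, e, ⟨_, r₁⟩, ?_⟩
  have := realizes_of_iso_ends r₂ ⟨-𝟙 A, -𝟙 A, by simp, by simp⟩ (Iso.refl W)
  convert this using 1
  · simp only [Iso.refl_inv, X.pull_id]
    have e₁ : X.pull (-f) δ = - X.pull f δ := by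
      have := X.pull_sub 0 f δ
      simpa [X.pull_zero] using this
    have e₂ : X.push (-𝟙 A) δ = - δ := by
      have := X.push_sub 0 (𝟙 A) δ
      simpa [X.push_zero, X.push_id] using this
    rw [e₁, map_neg, X.push_pull, e₂, map_neg, neg_neg]
  · simp

/-- Adding a morphism `f : A ⟶ W` to an inflation `i : A ⟶ B`. -/
theorem Realizes.lift_inflation {A B D : C} {δ : X.Ext D A} {i : A ⟶ B} {p : B ⟶ D}
    (h : X.Realizes δ i p) {W : C} (f : A ⟶ W) :
    ∃ (N : C) (k : B ⊞ W ⟶ N) (d : W ⟶ N) (e : N ⟶ D), X.Conflation (biprod.lift i f) k ∧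
      X.Realizes (X.push f δ) d e := by
  obtain ⟨O, hO⟩ := HasZeroObject.zero (C := C)
  have h0 : X.Realizes (0 : X.Ext O W) (𝟙 W) (0 : W ⟶ O) :=
    realizes_split _ _ (𝟙 W) 0 (by simp) (hO.eq_of_src _ _) (by simp) (by simp)
  have h₁ : X.Realizes (X.push biprod.inl δ : X.Ext D (A ⊞ W)) (biprod.map i (𝟙 W))
      (biprod.fst ≫ p) := by
    have := realizes_of_iso_ends (X.realizes_sum h h0) (Iso.refl _)
      (D' := D) ⟨biprod.fst, biprod.inl, by
        ext
        · simp
        · simp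
        · exact hO.eq_of_src _ _
        · exact hO.eq_of_src _ _, by simp⟩
    simpa [X.push_id, X.push_pull, ← X.pull_comp, X.pull_id] using this
  have h₂ : X.Realizes (0 : X.Ext W A) (biprod.lift (𝟙 A) f) (biprod.desc (-f) (𝟙 W)) :=
    realizes_split _ _ biprod.fst biprod.inr (by simp) (by simp) (by simp) (by
      ext <;> simp)
  obtain ⟨N, d, e, h', δ'', r₁, -, -, r₂, -, -⟩ := X.et4 h₂ h₁
  have hp : biprod.lift (𝟙 A) f ≫ biprod.map i (𝟙 W) = biprod.lift i f := by ext <;> simp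
  rw [hp] at r₁
  rw [← X.push_comp, biprod.inl_desc] at r₂
  refine ⟨N, h', d, e ≫ (-𝟙 D), ⟨_, r₁⟩, ?_⟩
  have := realizes_of_iso_ends r₂ (Iso.refl W) ⟨-𝟙 D, -𝟙 D, by simp, by simp⟩
  convert this using 1
  · simp only [Iso.refl_inv, X.push_id, ← X.push_pull]
    have e₁ : X.pull (-𝟙 D) δ = - δ := by
      have := X.pull_sub 0 (𝟙 D) δ
      simpa [X.pull_zero, X.pull_id] using this
    have e₂ : ∀ ε : X.Ext D A, X.push (-f) ε = - X.push f ε := by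
      intro ε
      have := X.push_sub 0 f ε
      simpa [X.push_zero] using this
    rw [e₁, e₂, map_neg, neg_neg]
  · simp

/-- The pullback of two conflations with the same third term. -/
theorem pullback_conflations {A B A' B' D : C} {δ : X.Ext D A} {δ' : X.Ext D A'} {i : A ⟶ B}
    {p : B ⟶ D} {i' : A' ⟶ B'} {p' : B' ⟶ D} (h : X.Realizes δ i p) (h' : X.Realizes δ' i' p') :
    ∃ (N : C) (a : A ⟶ N) (b : N ⟶ B') (a' : A' ⟶ N) (b' : N ⟶ B),
      X.Realizes (X.pull p' δ) a b ∧ X.Realizes (X.pull p δ') a' b' := by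
  obtain ⟨N, k, a, b, ⟨ε, hk⟩, hab⟩ := h.desc_deflation p'
  obtain ⟨N', k', a', b', ⟨ε', hk'⟩, hab'⟩ := h'.desc_deflation p
  -- Both pullbacks are the kernel of (p, p') on the direct sum of the middle terms, so they are
  -- isomorphic.
  have hk'' := realizes_of_iso hk' (biprod.braiding B' B) (i' := k' ≫ (biprod.braiding B' B).hom)
    (p' := biprod.desc p p') rfl (by ext <;> simp)
  obtain ⟨φ⟩ := kernel_unique hk'' hk
  exact ⟨N, a, b, a' ≫ φ.hom, φ.inv ≫ b', hab, X.realizes_iso φ hab'⟩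

/-- The pushout of two conflations with the same first term. -/
theorem pushout_conflations {A B B' D D' : C} {δ : X.Ext D A} {δ' : X.Ext D' A} {i : A ⟶ B}
    {p : B ⟶ D} {i' : A ⟶ B'} {p' : B' ⟶ D'} (h : X.Realizes δ i p) (h' : X.Realizes δ' i' p') :
    ∃ (N : C) (a : B' ⟶ N) (b : N ⟶ D) (a' : B ⟶ N) (b' : N ⟶ D'),
      X.Realizes (X.push i' δ) a b ∧ X.Realizes (X.push i δ') a' b' := by
  obtain ⟨N, k, a, b, ⟨ε, hk⟩, hab⟩ := h.lift_inflation i'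
  obtain ⟨N', k', a', b', ⟨ε', hk'⟩, hab'⟩ := h'.lift_inflation i
  have hk'' := realizes_of_iso hk' (biprod.braiding B' B) (i' := biprod.lift i i')
    (p' := (biprod.braiding B' B).inv ≫ k') (by ext <;> simp) (by simp)
  obtain ⟨φ⟩ := cokernel_unique hk'' hk
  exact ⟨N, a, b, a' ≫ φ.hom, φ.inv ≫ b', hab, X.realizes_iso φ hab'⟩

end Extri

/-! ### Radicals and the Krull–Schmidt property -/

theorem rad_ext_iso {A B : C} {f : A ⟶ B} (h : f ∈ rad K A B) (g : B ⟶ A) :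
    IsIso (𝟙 B - g ≫ f) :=
  isIso_one_sub_comm f g (h g)

theorem isZero_of_id_mem_rad {A : C} (h : 𝟙 A ∈ rad K A A) : IsZero A := by
  have h₁ := h (𝟙 A)
  simp only [Category.comp_id, sub_self] at h₁
  rw [IsZero.iff_id_eq_zero]
  have : IsIso (0 : A ⟶ A) := h₁
  rw [← IsIso.hom_inv_id (0 : A ⟶ A), zero_comp]

theorem radPow_left (𝒯 : ObjectProperty C) (n : ℕ) {A' A B : C} (a : A' ⟶ A) {f : A ⟶ B}
    (hf : f ∈ radPow K 𝒯 n A B) : a ≫ f ∈ radPow K 𝒯 n A' B := by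
  match n with
  | 0 => exact Submodule.mem_top
  | 1 => exact comp_mem_rad a hf
  | n + 2 =>
    refine Submodule.span_induction (p := fun f _ => a ≫ f ∈ radPow K 𝒯 (n + 2) A' B)
      ?_ ?_ ?_ ?_ hf
    · rintro _ ⟨Z, g, h, hZ, hg, hh, rfl⟩
      exact Submodule.subset_span ⟨Z, a ≫ g, h, hZ, comp_mem_rad a hg, hh, by simp⟩
    · simp
    · intro x y _ _ hx hy
      rw [Preadditive.comp_add]
      exact add_mem hx hy
    · intro r x _ hx
      rw [Linear.comp_smul]
      exact Submodule.smul_mem _ r hx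

theorem radPow_mul (𝒯 : ObjectProperty C) (m : ℕ) : ∀ (n : ℕ) {A Z B : C} (_ : 𝒯 Z) {f : A ⟶ Z}
    {g : Z ⟶ B} (_ : f ∈ radPow K 𝒯 m A Z) (_ : g ∈ radPow K 𝒯 n Z B),
    f ≫ g ∈ radPow K 𝒯 (m + n) A B := by
  induction m with
  | zero =>
    intro n A Z B hZ f g _ hg
    rw [zero_add]
    exact radPow_left 𝒯 n f hg
  | succ m ih =>
    intro n A Z B hZ f g hf hg
    match m with
    | 0 =>
      match n with
      | 0 => exact mem_rad_comp hf g
      | n + 1 =>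
        rw [show 0 + 1 + (n + 1) = n + 2 by ring]
        exact Submodule.subset_span ⟨Z, f, g, hZ, hf, hg, rfl⟩
    | m + 1 =>
      rw [show m + 1 + 1 + n = (m + n) + 2 by ring]
      refine Submodule.span_induction (p := fun f _ => f ≫ g ∈ radPow K 𝒯 (m + n + 2) A B)
        ?_ ?_ ?_ ?_ hf
      · rintro _ ⟨Z', f', f'', hZ', hf', hf'', rfl⟩
        have := ih n hZ hf'' hg
        rw [show m + 1 + n = m + n + 1 by ring] at this
        exact Submodule.subset_span ⟨Z', f', f'' ≫ g, hZ', hf', this, by simp⟩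
      · simp
      · intro x y _ _ hx hy
        rw [Preadditive.add_comp]
        exact add_mem hx hy
      · intro r x _ hx
        rw [Linear.smul_comp]
        exact Submodule.smul_mem _ r hx

/-! ### Limits in the radical topology and lifting of idempotents. -/

section Complete

variable {𝒯 : ObjectProperty C} {A B : C}


theorem isOpen_radPow (𝒯 : ObjectProperty C) (A B : C) (n : ℕ) :
    @IsOpen _ (radTop K 𝒯 A B) (radPow K 𝒯 n A B : Set (A ⟶ B)) := by
  intro f hf
  refine ⟨n, fun g hg => ?_⟩
  have := add_mem hg hf
  simpa using this

theorem eq_zero_of_mem_radPow (h : IsPseudocompact K (radTop K 𝒯 A B)) (y : A ⟶ B)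
    (hy : ∀ n, y ∈ radPow K 𝒯 n A B) : y = 0 := by
  by_contra hne
  let _ := radTop K 𝒯 A B
  have := h.t2
  obtain ⟨s, t, hs, -, h0, hyt, hd⟩ := t2_separation (Ne.symm hne)
  obtain ⟨n, hn⟩ := hs 0 h0
  exact Set.disjoint_left.1 hd (hn y (by simpa using hy n)) hyt

theorem exists_radLim (h : IsPseudocompact K (radTop K 𝒯 A B)) (z : ℕ → (A ⟶ B))
    (hz : ∀ n, z (n + 1) - z n ∈ radPow K 𝒯 n A B) :
    ∃ y : A ⟶ B, ∀ n, y - z n ∈ radPow K 𝒯 n A B := by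
  classical
  let _ := radTop K 𝒯 A B
  have hz' : ∀ n m, n ≤ m → z m - z n ∈ radPow K 𝒯 n A B := by
    intro n m hnm
    induction m, hnm using Nat.le_induction with
    | base => simp
    | succ m hm ih =>
      have := add_mem (radPow_antitone 𝒯 A B hm (hz m)) ih
      simpa using this
  have hex : ∀ W : Submodule K (A ⟶ B), IsOpen (W : Set (A ⟶ B)) → ∃ n, radPow K 𝒯 n A B ≤ W := by
    intro W hW
    obtain ⟨n, hn⟩ := hW 0 W.zero_mem
    exact ⟨n, fun f hf => hn f (by simpa using hf)⟩
  -- An open subspace W is assigned the term of z whose index is the least n with rad^n ≤ W. Smaller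
  -- W have larger indices, so the family is compatible.
  obtain ⟨y, hy⟩ := h.complete (fun W => z (Nat.find (hex W.1 W.2.1))) (by
    intro W W' hWW'
    exact Nat.find_spec (hex W'.1 W'.2.1)
      (hz' _ _ (Nat.find_min' _ ((Nat.find_spec (hex W.1 W.2.1)).trans hWW'))))
  refine ⟨y, fun n => ?_⟩
  have hfin : FiniteDimensional K ((A ⟶ B) ⧸ radPow K 𝒯 n A B) := by
    obtain ⟨W, -, hW, hWn⟩ := h.basis _ ((isOpen_radPow 𝒯 A B n).mem_nhds (zero_mem _))
    exact Module.Finite.of_surjective (Submodule.factor hWn) (Submodule.factor_surjective hWn)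
  have h₁ := hy ⟨radPow K 𝒯 n A B, isOpen_radPow 𝒯 A B n, hfin⟩
  -- The least index m for rad^n may be smaller than n; then rad^m ≤ rad^n, and the limit condition
  -- at m suffices.
  set m := Nat.find (hex (radPow K 𝒯 n A B) (isOpen_radPow 𝒯 A B n)) with hm
  have h₂ : radPow K 𝒯 m A B ≤ radPow K 𝒯 n A B := Nat.find_spec (hex _ (isOpen_radPow 𝒯 A B n))
  have h₃ : m ≤ n := Nat.find_min' _ le_rfl
  have h₄ := sub_mem h₁ (h₂ (hz' m n h₃))
  simpa using h₄

/-- Idempotents lift modulo the radical. -/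
theorem exists_idempotent_lift (h : IsPseudocompact K (radTop K 𝒯 A A)) (hA : 𝒯 A) (z : A ⟶ A)
    (hz : z ≫ z - z ∈ rad K A A) : ∃ e : A ⟶ A, e ≫ e = e ∧ e - z ∈ rad K A A := by
  -- Newton iteration a ↦ 3a² - 2a³: the new error of idempotency is a multiple of the square of the
  -- old one (`e₂`), and the correction is a multiple of the old error (`e₁`), so the iterates
  -- converge.
  let nx : (A ⟶ A) → (A ⟶ A) := fun a => (3 : ℤ) • (a ≫ a) - (2 : ℤ) • (a ≫ a ≫ a)
  let s : ℕ → (A ⟶ A) := fun n => nx^[n] z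
  have hs : ∀ n, s (n + 1) = nx (s n) := fun n => Function.iterate_succ_apply' nx n z
  have e₁ : ∀ a : A ⟶ A, nx a - a = (a ≫ a - a) ≫ (𝟙 A - (2 : ℤ) • a) := by
    intro a
    simp only [nx, Preadditive.sub_comp, Preadditive.comp_sub, Preadditive.comp_zsmul,
      Category.comp_id, Category.assoc]
    abel
  have e₂ : ∀ a : A ⟶ A, nx a ≫ nx a - nx a =
      ((a ≫ a - a) ≫ (a ≫ a - a)) ≫ ((4 : ℤ) • (a ≫ a) - (4 : ℤ) • a - (3 : ℤ) • 𝟙 A) := by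
    intro a
    simp only [nx, Preadditive.sub_comp, Preadditive.comp_sub, Preadditive.comp_zsmul,
      Preadditive.zsmul_comp, Category.comp_id, Category.assoc, smul_sub, smul_smul]
    abel
  have h₁ : ∀ n, s n ≫ s n - s n ∈ radPow K 𝒯 (n + 1) A A := by
    intro n
    induction n with
    | zero => exact hz
    | succ n ih =>
      rw [hs, e₂]
      have := radPow_mul 𝒯 _ 0 hA (radPow_mul 𝒯 _ _ hA ih ih)
        (g := (4 : ℤ) • (s n ≫ s n) - (4 : ℤ) • s n - (3 : ℤ) • 𝟙 A) Submodule.mem_top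
      exact radPow_antitone 𝒯 A A (by omega) this
  have h₂ : ∀ n, s (n + 1) - s n ∈ radPow K 𝒯 (n + 1) A A := by
    intro n
    rw [hs, e₁]
    exact radPow_mul 𝒯 _ 0 hA (h₁ n) Submodule.mem_top
  obtain ⟨y, hy⟩ := exists_radLim h (fun n => s n) (fun n => radPow_succ_le 𝒯 n A A (h₂ n))
  refine ⟨y, ?_, ?_⟩
  · rw [← sub_eq_zero]
    refine eq_zero_of_mem_radPow h _ fun n => ?_
    have e₃ : y ≫ y - y = (y - s n) ≫ y + s n ≫ (y - s n) - (y - s n) + (s n ≫ s n - s n) := by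
      simp only [Preadditive.sub_comp, Preadditive.comp_sub]
      abel
    rw [e₃]
    exact add_mem (sub_mem (add_mem (radPow_mul 𝒯 _ 0 hA (hy n) Submodule.mem_top)
      (radPow_left 𝒯 n _ (hy n))) (hy n)) (radPow_succ_le 𝒯 n A A (h₁ n))
  · have h₃ := hy 1
    have h₄ : s 1 - s 0 ∈ rad K A A := h₂ 0
    have := add_mem (show y - s 1 ∈ rad K A A from h₃) h₄
    simpa [s] using this

end Complete

/-! #### Local endomorphism rings -/

/-- Endomorphisms of `A` are invertible or radical. -/
structure IsLocalObj (K : Type w) [Field K] [Linear K C] (A : C) : Prop where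
  not_isZero : ¬ IsZero A
  isIso_or_mem : ∀ f : A ⟶ A, IsIso f ∨ f ∈ rad K A A

theorem Retract.exists_compl [IsIdempotentComplete C] {A B : C} (r : Retract A B) :
    ∃ D : C, Nonempty (B ≅ A ⊞ D) := by
  obtain ⟨D, i, e, h₁, h₂⟩ := IsIdempotentComplete.idempotents_split B (𝟙 B - r.r ≫ r.i) (by
    simp)
  have hi : i ≫ r.r = 0 := by
    have : i ≫ (e ≫ i) ≫ r.r = 0 := by rw [h₂]; simp
    rwa [Category.assoc, reassoc_of% h₁] at this
  have he : r.i ≫ e = 0 := by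
    have : r.i ≫ (e ≫ i) ≫ e = 0 := by rw [h₂]; simp
    rwa [Category.assoc, h₁, Category.comp_id] at this
  refine ⟨D, ⟨⟨biprod.lift r.r e, biprod.desc r.i i, ?_, ?_⟩⟩⟩
  · simp [h₂]
  · ext <;> simp [h₁, hi, he]

theorem Indecomposable.of_iso {A B : C} (hA : Indecomposable A) (e : A ≅ B) : Indecomposable B :=
  ⟨fun h => hA.1 (h.of_iso e), fun Y Z f => hA.2 Y Z (e ≪≫ f)⟩

/-- A non-zero retract of an indecomposable object is isomorphic to it. -/
theorem Retract.iso_of_indecomposable [IsIdempotentComplete C] {A B : C} (r : Retract A B)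
    (hA : ¬ IsZero A) (hB : Indecomposable B) : Nonempty (A ≅ B) := by
  obtain ⟨D, ⟨e⟩⟩ := Retract.exists_compl r
  rcases hB.2 _ _ e with h | h
  · exact (hA h).elim
  · refine ⟨Iso.symm (e ≪≫ ⟨biprod.fst, biprod.inl, ?_, by simp⟩)⟩
    ext
    · simp
    · simp
    · exact h.eq_of_src _ _
    · exact h.eq_of_src _ _

theorem idempotent_indecomposable [IsIdempotentComplete C] {A : C} (hA : Indecomposable A)
    (e : A ⟶ A) (he : e ≫ e = e) : e = 0 ∨ e = 𝟙 A := by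
  obtain ⟨Y, i, q, h₁, h₂⟩ := IsIdempotentComplete.idempotents_split A e he
  by_cases hY : IsZero Y
  · left
    rw [← h₂, hY.eq_of_tgt q 0, zero_comp]
  · right
    obtain ⟨Y', i', q', h₁', h₂'⟩ := IsIdempotentComplete.idempotents_split A (𝟙 A - e) (by simp [he])
    have hiso : A ≅ Y ⊞ Y' := ⟨biprod.lift q q', biprod.desc i i', by simp [h₂, h₂'], by
      have z₁ : i ≫ q' = 0 := by
        have : i ≫ (q' ≫ i') ≫ q' = 0 := by
          rw [h₂', ← h₂]; simp [reassoc_of% h₁]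
        rwa [Category.assoc, h₁', Category.comp_id] at this
      have z₂ : i' ≫ q = 0 := by
        have : i' ≫ (q' ≫ i') ≫ q = 0 := by
          rw [h₂', ← h₂]; simp [h₁]
        rwa [Category.assoc, reassoc_of% h₁'] at this
      ext <;> simp [h₁, h₁', z₁, z₂]⟩
    rcases hA.2 _ _ hiso with h | h
    · exact (hY h).elim
    · rw [h.eq_of_tgt q' 0, zero_comp] at h₂'
      exact (sub_eq_zero.1 h₂'.symm).symm

theorem isIso_of_comp_eq_of_comm {A : C} (f g : A ⟶ A) (h : IsIso (f ≫ g)) (hc : f ≫ g = g ≫ f) :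
    IsIso f :=
  Extri.iso_of_isIso_comp f g h (hc ▸ h)

theorem isIso_of_one_sub_mem_rad {A : C} {f : A ⟶ A} (h : 𝟙 A - f ∈ rad K A A) : IsIso f := by
  have := h (𝟙 A)
  simpa using this

open Polynomial in
/-- Fitting decomposition modulo a left ideal of finite codimension. -/
theorem exists_fitting {R : Type*} [Ring R] [Algebra K R] (J : Submodule K R)
    (hJ : ∀ a b : R, b ∈ J → a * b ∈ J) [FiniteDimensional K (R ⧸ J)] (f : R) :
    ∃ (n : ℕ) (z g : R), z * z - z ∈ J ∧ 1 - z = f * g ∧ f * g = g * f ∧ f ^ (n + 1) * z ∈ J := by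
  let ev : K[X] →ₐ[K] R := aeval f
  have hX : ev X = f := aeval_X f
  obtain ⟨q, hq0, hq⟩ : ∃ q : K[X], q ≠ 0 ∧ ev q ∈ J := by
    let φ : K[X] →ₗ[K] (R ⧸ J) := J.mkQ ∘ₗ ev.toLinearMap
    by_contra hcon
    push Not at hcon
    have hinj : Function.Injective φ := by
      rw [injective_iff_map_eq_zero]
      intro p hp
      by_contra hp0
      exact hcon p hp0 ((Submodule.Quotient.mk_eq_zero J).1 hp)
    have := FiniteDimensional.of_injective φ hinj
    exact Polynomial.not_finite this
  -- Modulo J the element f satisfies q = X^n r with r prime to X. A Bézout relation a X^(n+1) + b r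
  -- = 1 gives z = (b r)(f). The exponent n + 1 rather than n makes 1 - z divisible by f even for n
  -- = 0.
  obtain ⟨r, hr, hdvd⟩ := exists_eq_pow_rootMultiplicity_mul_and_not_dvd q hq0 0
  set n := q.rootMultiplicity 0
  rw [map_zero, sub_zero] at hr hdvd
  have hcop : IsCoprime (X ^ (n + 1)) r :=
    ((irreducible_X).coprime_iff_not_dvd.2 hdvd).pow_left
  obtain ⟨a, b, hab⟩ := hcop
  have hXr : ev (X ^ (n + 1) * r) ∈ J := by
    rw [pow_succ', mul_assoc, ← hr, map_mul]
    exact hJ _ _ hq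
  refine ⟨n, ev (b * r), ev (a * X ^ n), ?_, ?_, ?_, ?_⟩
  · have h₁ : ev (b * r) * ev (b * r) - ev (b * r) = - (ev (a * b) * ev (X ^ (n + 1) * r)) := by
      have h₂ : b * r * (b * r) - b * r = - (a * b * (X ^ (n + 1) * r)) := by
        linear_combination (b * r) * hab
      rw [← map_mul, ← map_mul, ← map_sub, ← map_neg, h₂]
    rw [h₁]
    exact neg_mem (hJ _ _ hXr)
  · have h₂ : 1 - b * r = X * (a * X ^ n) := by linear_combination - hab
    rw [← map_one ev, ← map_sub, h₂, map_mul, hX]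
  · have h₂ : X * (a * X ^ n) = a * X ^ n * X := mul_comm _ _
    rw [← hX, ← map_mul, h₂, map_mul]
  · have h₁ : f ^ (n + 1) * ev (b * r) = ev b * ev (X ^ (n + 1) * r) := by
      have h₂ : X ^ (n + 1) * (b * r) = b * (X ^ (n + 1) * r) := by ring
      rw [← map_mul, ← h₂, map_mul ev (X ^ (n + 1)), map_pow, hX]
    rw [h₁]
    exact hJ _ _ hXr

/-- Fitting's lemma: the idempotent lifting z is 0 or 1. In the first case z is radical, so 1 - z, a
product with factor f, is invertible; in the second 1 - z is radical, and so is a power of f. -/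
theorem isIso_or_pow_mem_rad [IsIdempotentComplete C] {A : C} (hA : Indecomposable A)
    (hfin : FiniteDimensional K ((A ⟶ A) ⧸ rad K A A))
    (hlift : ∀ z : A ⟶ A, z ≫ z - z ∈ rad K A A → ∃ e : A ⟶ A, e ≫ e = e ∧ e - z ∈ rad K A A)
    (f : End A) : @IsIso C _ A A f ∨ ∃ n : ℕ, (f ^ (n + 1) : End A) ∈ (rad K A A : Set (A ⟶ A)) := by
  have : FiniteDimensional K (End A ⧸ (rad K A A : Submodule K (End A))) := hfin
  obtain ⟨n, z, g, hz, hg, hc, hn⟩ := exists_fitting (K := K) (R := End A) (rad K A A)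
    (fun a b hb => mem_rad_comp (K := K) hb a) f
  obtain ⟨e, he, hez⟩ := hlift z hz
  rcases idempotent_indecomposable hA e he with rfl | rfl
  · left
    have h₁ : z ∈ (rad K A A : Submodule K (End A)) := by
      have := neg_mem hez
      rwa [zero_sub, neg_neg] at this
    have h₂ : @IsIso C _ A A (g * f : End A) := by
      apply isIso_of_one_sub_mem_rad (K := K)
      have h₃ : (1 : End A) - g * f = z := by rw [← hc, ← hg, sub_sub_cancel]
      exact (h₃ ▸ h₁ : (1 : End A) - g * f ∈ (rad K A A : Submodule K (End A)))
    exact isIso_of_comp_eq_of_comm (A := A) f g h₂ hc.symm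
  · right
    refine ⟨n, ?_⟩
    have h₁ : (f ^ (n + 1) : End A) = f ^ (n + 1) * (1 - z) + f ^ (n + 1) * z := by
      rw [← mul_add, sub_add_cancel, mul_one]
    have h₂ : (f ^ (n + 1) * (1 - z) + f ^ (n + 1) * z : End A) ∈
        (rad K A A : Submodule K (End A)) := add_mem (mem_rad_comp (K := K) hez _) hn
    exact (h₁ ▸ h₂ : (f ^ (n + 1) : End A) ∈ (rad K A A : Submodule K (End A)))

/-- Being radical concerns all products f ≫ g, so the dichotomy is applied to these. If one is
invertible, f has a right inverse g', and the idempotent g' ≫ f is 0 or 1, hence f is invertible. If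
a power of it is radical, 1 - f ≫ g divides an invertible geometric difference. -/
theorem isLocalObj_of_indecomposable [IsIdempotentComplete C] {A : C} (hA : Indecomposable A)
    (hfin : FiniteDimensional K ((A ⟶ A) ⧸ rad K A A))
    (hlift : ∀ z : A ⟶ A, z ≫ z - z ∈ rad K A A →
      ∃ e : A ⟶ A, e ≫ e = e ∧ e - z ∈ rad K A A) : IsLocalObj K A := by
  refine ⟨hA.1, fun f => or_iff_not_imp_left.2 fun hf g => ?_⟩
  rcases isIso_or_pow_mem_rad hA hfin hlift (show End A from f ≫ g) with h | ⟨n, h⟩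
  · exfalso
    let g' := g ≫ inv (f ≫ g)
    have h₁ : f ≫ g' = 𝟙 A := by
      have : IsIso (f ≫ g) := h
      rw [← Category.assoc]
      exact IsIso.hom_inv_id (f ≫ g)
    rcases idempotent_indecomposable hA (g' ≫ f) (by rw [Category.assoc, reassoc_of% h₁]) with h₂ | h₂
    · apply hA.1
      rw [IsZero.iff_id_eq_zero, ← h₁, ← Category.comp_id g', ← h₁, reassoc_of% h₂]
      simp
    · exact hf ⟨g', h₁, h₂⟩
  · let y : End A := f ≫ g
    have h₁ : @IsIso C _ A A (1 - y ^ (n + 1) : End A) := by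
      have := h (𝟙 A)
      rwa [Category.comp_id] at this
    have h₂ : (1 - y) * (∑ i ∈ Finset.range (n + 1), y ^ i) = 1 - y ^ (n + 1) := mul_neg_geom_sum y _
    have h₃ : (∑ i ∈ Finset.range (n + 1), y ^ i) * (1 - y) = 1 - y ^ (n + 1) := geom_sum_mul_neg y _
    exact isIso_of_comp_eq_of_comm (A := A) (1 - y : End A) (∑ i ∈ Finset.range (n + 1), y ^ i : End A)
      (h₃ ▸ h₁ : @IsIso C _ A A ((∑ i ∈ Finset.range (n + 1), y ^ i) * (1 - y) : End A))
      (h₃.trans h₂.symm)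

namespace IsLocalObj

variable {U : C} (hU : IsLocalObj K U)

include hU

theorem id_notMem : 𝟙 U ∉ rad K U U := fun h => hU.not_isZero (isZero_of_id_mem_rad h)

theorem not_mem_iff {f : U ⟶ U} : f ∉ rad K U U ↔ IsIso f := by
  refine ⟨fun h => (hU.isIso_or_mem f).resolve_right h, fun h hf => hU.id_notMem ?_⟩
  rw [← IsIso.hom_inv_id f]
  exact mem_rad_comp hf _

/-- Morphisms to `U` outside the radical are split epimorphisms. -/
theorem exists_section {A : C} {f : A ⟶ U} (hf : f ∉ rad K A U) : ∃ s : U ⟶ A, s ≫ f = 𝟙 U := by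
  have : ∃ g : U ⟶ A, ¬ IsIso (𝟙 A - f ≫ g) := by
    by_contra h
    push Not at h
    exact hf h
  obtain ⟨g, hg⟩ := this
  have h₁ : g ≫ f ∉ rad K U U := by
    intro h
    apply hg
    apply isIso_one_sub_comm
    have := h (𝟙 U)
    rwa [Category.comp_id] at this
  have := hU.not_mem_iff.1 h₁
  exact ⟨inv (g ≫ f) ≫ g, by rw [Category.assoc, IsIso.inv_hom_id]⟩

/-- Morphisms from `U` outside the radical are split monomorphisms. -/
theorem exists_retraction {A : C} {f : U ⟶ A} (hf : f ∉ rad K U A) : ∃ r : A ⟶ U, f ≫ r = 𝟙 U := by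
  have : ∃ g : A ⟶ U, ¬ IsIso (𝟙 U - f ≫ g) := by
    by_contra h
    push Not at h
    exact hf h
  obtain ⟨g, hg⟩ := this
  have h₁ : f ≫ g ∉ rad K U U := by
    intro h
    apply hg
    have := h (𝟙 U)
    rwa [Category.comp_id] at this
  have := hU.not_mem_iff.1 h₁
  exact ⟨g ≫ inv (f ≫ g), by rw [← Category.assoc, IsIso.hom_inv_id]⟩

theorem mem_rad_to {A : C} (hA : ¬ Nonempty (Retract U A)) (f : A ⟶ U) : f ∈ rad K A U := by
  by_contra hf
  obtain ⟨s, hs⟩ := hU.exists_section hf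
  exact hA ⟨⟨s, f, hs⟩⟩

theorem mem_rad_from {A : C} (hA : ¬ Nonempty (Retract U A)) (f : U ⟶ A) : f ∈ rad K U A := by
  by_contra hf
  obtain ⟨r, hr⟩ := hU.exists_retraction hf
  exact hA ⟨⟨f, r, hr⟩⟩

/-- If U were a summand of neither factor, both components of the identity of U would be radical,
contradicting locality. -/
theorem retract_biprod {A B : C} (r : Retract U (A ⊞ B)) :
    Nonempty (Retract U A) ∨ Nonempty (Retract U B) := by
  by_contra h
  push Not at h
  apply hU.id_notMem
  rw [← r.retract, ← Category.id_comp r.r, ← biprod.total, Preadditive.add_comp,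
    Preadditive.comp_add]
  refine add_mem ?_ ?_
  · rw [Category.assoc]
    exact comp_mem_rad _ (comp_mem_rad _ (hU.mem_rad_to (not_nonempty_iff.2 h.1) _))
  · rw [Category.assoc]
    exact comp_mem_rad _ (comp_mem_rad _ (hU.mem_rad_to (not_nonempty_iff.2 h.2) _))

theorem retract_biproduct {n : ℕ} {Y : Fin n → C} (r : Retract U (⨁ Y)) :
    ∃ i, Nonempty (Retract U (Y i)) := by
  by_contra h
  push Not at h
  apply hU.id_notMem
  rw [← r.retract, ← Category.id_comp r.r, ← biproduct.total, Preadditive.sum_comp,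
    Preadditive.comp_sum]
  refine Submodule.sum_mem _ fun i _ => ?_
  rw [Category.assoc]
  exact comp_mem_rad _ (comp_mem_rad _ (hU.mem_rad_to (not_nonempty_iff.2 (h i)) _))

end IsLocalObj

/-! #### Dimensions modulo the radical -/

variable (K) in
/-- `dim Hom(A, V) / rad(A, V)`. -/
def topDim (V A : C) : ℕ := Module.finrank K ((A ⟶ V) ⧸ rad K A V)

variable (K) in
/-- `dim Hom(V, A) / rad(V, A)`. -/
def socDim (V A : C) : ℕ := Module.finrank K ((V ⟶ A) ⧸ rad K V A)

section

variable (hfin : ∀ A : C, FiniteDimensional K ((A ⟶ A) ⧸ rad K A A))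

include hfin

/-- `topDim K V` is the dimension function of the simple module of V over the whole category, so
additivity is that of modules. -/
theorem topDim_biprod (V : C) {A B D : C} (e : D ≅ A ⊞ B) :
    topDim K V D = topDim K V A + topDim K V B :=
  finrank_act_iso (simple K ⊤ V) (𝒯 := ⊤) trivial trivial trivial e (simple_isLfd hfin ⊤ V)

theorem finite_top (V A : C) : FiniteDimensional K ((A ⟶ V) ⧸ rad K A V) :=
  simple_isLfd hfin ⊤ V A trivial

/-- This strict decrease drives the decomposition into indecomposables. The embedding of residue
algebras misses the projection onto B, whose class would otherwise force the identity of B to be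
radical. -/
theorem dimD_lt {A B D : C} (e : D ≅ A ⊞ B) (hB : ¬ IsZero B) : dimD K A < dimD K D := by
  have := hfin D
  have := hfin A
  let φ : (A ⟶ A) →ₗ[K] (D ⟶ D) :=
    (Linear.leftComp K D (e.hom ≫ biprod.fst)).comp (Linear.rightComp K A (biprod.inl ≫ e.inv))
  have hφ : ∀ f, φ f = (e.hom ≫ biprod.fst) ≫ f ≫ biprod.inl ≫ e.inv := fun f => rfl
  have hle : rad K A A ≤ (rad K D D).comap φ := fun f hf => comp_mem_rad _ (mem_rad_comp hf _)
  let ψ := Submodule.mapQ _ _ φ hle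
  have hinj : Function.Injective ψ := by
    rw [← LinearMap.ker_eq_bot, Submodule.ker_mapQ, Submodule.eq_bot_iff]
    rintro _ ⟨f, hf, rfl⟩
    rw [Submodule.mkQ_apply, Submodule.Quotient.mk_eq_zero]
    have h₂ : (biprod.inl ≫ e.inv) ≫ φ f ≫ (e.hom ≫ biprod.fst) ∈ rad K A A :=
      comp_mem_rad _ (mem_rad_comp hf _)
    simpa [hφ] using h₂
  have hlt : LinearMap.range ψ < ⊤ := by
    rw [lt_top_iff_ne_top]
    intro htop
    have : Submodule.Quotient.mk (e.hom ≫ biprod.snd ≫ biprod.inr ≫ e.inv) ∈ LinearMap.range ψ :=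
      htop ▸ Submodule.mem_top
    obtain ⟨z, hz⟩ := this
    obtain ⟨f, rfl⟩ := Submodule.Quotient.mk_surjective _ z
    have h₁ : φ f - (e.hom ≫ biprod.snd ≫ biprod.inr ≫ e.inv) ∈ rad K D D :=
      (Submodule.Quotient.eq _).1 hz
    apply hB
    apply isZero_of_id_mem_rad (K := K)
    have h₂ := neg_mem (comp_mem_rad (K := K) (biprod.inr ≫ e.inv)
      (mem_rad_comp h₁ (e.hom ≫ biprod.snd)))
    simpa [hφ] using h₂
  have h₁ := Submodule.finrank_lt hlt.ne
  rwa [LinearMap.finrank_range_of_inj hinj] at h₁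

end

theorem topDim_iso {V A B : C} (e : A ≅ B) : topDim K V A = topDim K V B := by
  refine LinearEquiv.finrank_eq (Submodule.Quotient.equiv _ _ (Linear.homCongr K e (Iso.refl V)) ?_)
  ext f
  constructor
  · rintro ⟨g, hg, rfl⟩
    exact mem_rad_comp (comp_mem_rad _ hg) _
  · intro hf
    exact ⟨e.hom ≫ f, comp_mem_rad _ hf, by simp [Linear.homCongr]⟩

theorem topDim_self_iso {V V' A : C} (e : V ≅ V') : topDim K V A = topDim K V' A := by
  refine LinearEquiv.finrank_eq (Submodule.Quotient.equiv _ _ (Linear.homCongr K (Iso.refl A) e) ?_)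
  ext f
  constructor
  · rintro ⟨g, hg, rfl⟩
    exact mem_rad_comp (comp_mem_rad _ hg) _
  · intro hf
    exact ⟨f ≫ e.inv, mem_rad_comp hf _, by simp [Linear.homCongr]⟩

theorem socDim_iso {V A B : C} (e : A ≅ B) : socDim K V A = socDim K V B := topDim_self_iso e

theorem topDim_eq_zero {V A : C} (h : ∀ f : A ⟶ V, f ∈ rad K A V) : topDim K V A = 0 := by
  have : Subsingleton ((A ⟶ V) ⧸ rad K A V) := by
    rw [Submodule.Quotient.subsingleton_iff]
    exact eq_top_iff.2 fun f _ => h f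
  exact Module.finrank_zero_of_subsingleton

theorem socDim_eq_zero {V A : C} (h : ∀ f : V ⟶ A, f ∈ rad K V A) : socDim K V A = 0 :=
  topDim_eq_zero h

theorem socDim_biprod (hfin : ∀ A : C, FiniteDimensional K ((A ⟶ A) ⧸ rad K A A)) (V A B : C) :
    socDim K V (A ⊞ B) = socDim K V A + socDim K V B := by
  have := finite_top hfin A V
  have := finite_top hfin B V
  let φ : (V ⟶ A ⊞ B) →ₗ[K] ((V ⟶ A) ⧸ rad K V A) × ((V ⟶ B) ⧸ rad K V B) :=
    ((rad K V A).mkQ ∘ₗ Linear.rightComp K V biprod.fst).prod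
      ((rad K V B).mkQ ∘ₗ Linear.rightComp K V biprod.snd)
  have hφ : ∀ f, φ f = (Submodule.Quotient.mk (f ≫ biprod.fst),
    Submodule.Quotient.mk (f ≫ biprod.snd)) := fun f => rfl
  have hker : LinearMap.ker φ = rad K V (A ⊞ B) := by
    ext f
    rw [LinearMap.mem_ker, hφ, Prod.mk_eq_zero, Submodule.Quotient.mk_eq_zero,
      Submodule.Quotient.mk_eq_zero]
    refine ⟨fun h => ?_, fun h => ⟨mem_rad_comp h _, mem_rad_comp h _⟩⟩
    rw [← Category.comp_id f, ← biprod.total, Preadditive.comp_add]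
    refine add_mem ?_ ?_
    · rw [← Category.assoc]
      exact mem_rad_comp h.1 _
    · rw [← Category.assoc]
      exact mem_rad_comp h.2 _
  have hsurj : Function.Surjective φ := by
    rintro ⟨a, b⟩
    obtain ⟨a, rfl⟩ := Submodule.Quotient.mk_surjective _ a
    obtain ⟨b, rfl⟩ := Submodule.Quotient.mk_surjective _ b
    exact ⟨biprod.lift a b, by simp [hφ]⟩
  rw [socDim, ← hker, (φ.quotKerEquivOfSurjective hsurj).finrank_eq, Module.finrank_prod]
  rfl

/-! ### Cluster-tilting subcategories -/

namespace Extri.IsCT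

variable {X : Extri K C} {𝒯 : ObjectProperty C} (h : X.IsCT 𝒯)

include h

theorem ext_zero {A B : C} (hA : 𝒯 A) (hB : 𝒯 B) (δ : X.Ext A B) : δ = 0 :=
  (h.mem_iff_right B).1 hB A hA δ

theorem of_retract {A B : C} (r : Retract A B) (hB : 𝒯 B) : 𝒯 A := by
  rw [h.mem_iff_right]
  intro T hT δ
  rw [← X.push_id δ, ← r.retract, X.push_comp, h.ext_zero hT hB (X.push r.i δ), map_zero]

theorem of_iso {A B : C} (e : A ≅ B) (hA : 𝒯 A) : 𝒯 B := h.of_retract (Retract.ofIso e.symm) hA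

theorem biprod {A B : C} (hA : 𝒯 A) (hB : 𝒯 B) : 𝒯 (A ⊞ B) := by
  rw [h.mem_iff_right]
  intro T hT δ
  rw [← X.push_id δ, ← biprod.total, X.push_add, X.push_comp, X.push_comp,
    h.ext_zero hT hA (X.push biprod.fst δ), h.ext_zero hT hB (X.push biprod.snd δ)]
  simp

theorem of_isZero {A : C} (hA : IsZero A) : 𝒯 A := by
  rw [h.mem_iff_right]
  intro T hT δ
  exact X.isZero_ext_right hA δ

theorem of_isProj {P : C} (hP : X.IsProj P) : 𝒯 P := by
  rw [h.mem_iff_left]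
  intro T _ δ
  exact hP T δ

/-- The kernel N of a right approximation R ⟶ A lies in 𝒯: for T in 𝒯, Hom(T, R) ⟶ Hom(T, A) is
surjective and Ext(T, R) = 0, so Ext(T, N) = 0. -/
theorem exists_index (A : C) : ∃ (N R : C) (i : N ⟶ R) (p : R ⟶ A), 𝒯 N ∧ 𝒯 R ∧
    X.Conflation i p := by
  obtain ⟨R, p, hR, ⟨N, i, δ, hδ⟩, hp⟩ := h.right_approx A
  refine ⟨N, R, i, p, ?_, hR, δ, hδ⟩
  rw [h.mem_iff_right]
  intro T hT ε
  obtain ⟨f, rfl⟩ := hδ.exists_pull ε (h.ext_zero hT hR _)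
  exact (hδ.pull_eq_zero_iff f).2 (hp T hT f)

theorem exists_coindex (A : C) : ∃ (L N : C) (i : A ⟶ L) (p : L ⟶ N), 𝒯 L ∧ 𝒯 N ∧
    X.Conflation i p := by
  obtain ⟨L, i, hL, ⟨N, p, δ, hδ⟩, hi⟩ := h.left_approx A
  refine ⟨L, N, i, p, hL, ?_, δ, hδ⟩
  rw [h.mem_iff_left]
  intro T hT ε
  obtain ⟨f, rfl⟩ := hδ.exists_push ε (h.ext_zero hL hT _)
  exact (hδ.push_eq_zero_iff f).2 (hi T hT f)

end Extri.IsCT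

/-! ### Split Grothendieck groups. -/

section K0

variable {𝒯 : ObjectProperty C}

theorem K0.cls_biprod {A B D : C} (hA : 𝒯 A) (hB : 𝒯 B) (hD : 𝒯 D) (e : D ≅ A ⊞ B) :
    K0.cls D hD = K0.cls A hA + K0.cls B hB := by
  rw [← sub_eq_zero, ← sub_sub]
  refine (QuotientAddGroup.eq_zero_iff (N := AddSubgroup.closure
    {x | ∃ A B D : {A : C // 𝒯 A}, Nonempty (D.1 ≅ A.1 ⊞ B.1) ∧
      x = FreeAbelianGroup.of D - FreeAbelianGroup.of A - FreeAbelianGroup.of B}) _).2 ?_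
  exact AddSubgroup.subset_closure ⟨⟨A, hA⟩, ⟨B, hB⟩, ⟨D, hD⟩, ⟨e⟩, rfl⟩

def biprodZeroIso (A : C) {O : C} (hO : IsZero O) : A ≅ A ⊞ O :=
  ⟨biprod.inl, biprod.fst, by simp, by
    ext
    · simp
    · simp
    · exact hO.eq_of_src _ _
    · exact hO.eq_of_src _ _⟩

theorem K0.cls_zero {A : C} (hA : 𝒯 A) (h0 : IsZero A) : K0.cls A hA = 0 := by
  have := K0.cls_biprod hA hA hA (biprodZeroIso A h0)
  simpa using this

/-- The defining relations only concern direct sums, so an isomorphism is read as A ≅ B ⊞ 0. -/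
theorem K0.cls_iso (h : ∀ A, IsZero A → 𝒯 A) {A B : C} (hA : 𝒯 A) (hB : 𝒯 B) (e : A ≅ B) :
    K0.cls A hA = K0.cls B hB := by
  obtain ⟨O, hO⟩ := HasZeroObject.zero (C := C)
  rw [K0.cls_biprod hB (h O hO) hA (e ≪≫ biprodZeroIso B hO), K0.cls_zero (h O hO) hO, add_zero]

/-- Additive homomorphisms on `K0` from additive functions on objects. -/
def K0.lift {G : Type*} [AddCommGroup G] (f : C → G)
    (hf : ∀ A B D : C, 𝒯 A → 𝒯 B → 𝒯 D → (D ≅ A ⊞ B) → f D = f A + f B) : K0 𝒯 →+ G :=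
  QuotientAddGroup.lift _ (FreeAbelianGroup.lift fun A : {A : C // 𝒯 A} => f A.1) (by
    rw [AddSubgroup.closure_le]
    rintro _ ⟨A, B, D, ⟨e⟩, rfl⟩
    simp [hf A B D A.2 B.2 D.2 e])

theorem K0.lift_cls {G : Type*} [AddCommGroup G] (f : C → G)
    (hf : ∀ A B D : C, 𝒯 A → 𝒯 B → 𝒯 D → (D ≅ A ⊞ B) → f D = f A + f B) (A : C) (hA : 𝒯 A) :
    K0.lift f hf (K0.cls A hA) = f A := by
  show FreeAbelianGroup.lift _ (FreeAbelianGroup.of _) = _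
  rw [FreeAbelianGroup.lift_apply_of]

end K0

/-! ### Index and coindex of objects -/

section Index

variable {X : Extri K C} {𝒯 : ObjectProperty C} (h : X.IsCT 𝒯)

include h

/-- Schanuel's argument: the pullback M of the two deflations sits in conflations N ⟶ M ⟶ R' and N'
⟶ M ⟶ R, which split because Ext vanishes on 𝒯. Hence N ⊞ R' ≅ M ≅ N' ⊞ R. -/
theorem index_unique {A N R N' R' : C} {i : N ⟶ R} {p : R ⟶ A} {i' : N' ⟶ R'} {p' : R' ⟶ A}
    (hN : 𝒯 N) (hR : 𝒯 R) (hN' : 𝒯 N') (hR' : 𝒯 R') (hc : X.Conflation i p)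
    (hc' : X.Conflation i' p') :
    K0.cls R hR - K0.cls N hN = K0.cls R' hR' - K0.cls N' hN' := by
  obtain ⟨δ, hδ⟩ := hc
  obtain ⟨δ', hδ'⟩ := hc'
  obtain ⟨M, a, b, a', b', h₁, h₂⟩ := Extri.pullback_conflations hδ hδ'
  rw [h.ext_zero hR' hN (X.pull p' δ)] at h₁
  rw [h.ext_zero hR hN' (X.pull p δ')] at h₂
  obtain ⟨e₁⟩ := h₁.iso_biprod
  obtain ⟨e₂⟩ := h₂.iso_biprod
  have hM := h.of_iso e₁.symm (h.biprod hN hR')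
  have := (K0.cls_biprod hN hR' hM e₁).symm.trans (K0.cls_biprod hN' hR hM e₂)
  rw [sub_eq_sub_iff_add_eq_add, add_comm, ← this, add_comm]

theorem coindex_unique {A N L N' L' : C} {i : A ⟶ L} {p : L ⟶ N} {i' : A ⟶ L'} {p' : L' ⟶ N'}
    (hN : 𝒯 N) (hL : 𝒯 L) (hN' : 𝒯 N') (hL' : 𝒯 L') (hc : X.Conflation i p)
    (hc' : X.Conflation i' p') :
    K0.cls L hL - K0.cls N hN = K0.cls L' hL' - K0.cls N' hN' := by
  obtain ⟨δ, hδ⟩ := hc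
  obtain ⟨δ', hδ'⟩ := hc'
  obtain ⟨M, a, b, a', b', h₁, h₂⟩ := Extri.pushout_conflations hδ hδ'
  rw [h.ext_zero hN hL' (X.push i' δ)] at h₁
  rw [h.ext_zero hN' hL (X.push i δ')] at h₂
  obtain ⟨e₁⟩ := h₁.iso_biprod
  obtain ⟨e₂⟩ := h₂.iso_biprod
  have hM := h.of_iso e₁.symm (h.biprod hL' hN)
  have := (K0.cls_biprod hL' hN hM e₁).symm.trans (K0.cls_biprod hL hN' hM e₂)
  rw [sub_eq_sub_iff_add_eq_add, this]

/-- The index of an object with respect to a cluster-tilting subcategory. -/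
def indObj (A : C) : K0 𝒯 :=
  K0.cls _ (h.exists_index A).choose_spec.choose_spec.choose_spec.choose_spec.2.1 -
    K0.cls _ (h.exists_index A).choose_spec.choose_spec.choose_spec.choose_spec.1

theorem indObj_eq {A N R : C} {i : N ⟶ R} {p : R ⟶ A} (hN : 𝒯 N) (hR : 𝒯 R)
    (hc : X.Conflation i p) : indObj h A = K0.cls R hR - K0.cls N hN :=
  index_unique h _ _ _ _ (h.exists_index A).choose_spec.choose_spec.choose_spec.choose_spec.2.2 hc

/-- The coindex of an object with respect to a cluster-tilting subcategory. -/
def coindObj (A : C) : K0 𝒯 :=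
  K0.cls _ (h.exists_coindex A).choose_spec.choose_spec.choose_spec.choose_spec.1 -
    K0.cls _ (h.exists_coindex A).choose_spec.choose_spec.choose_spec.choose_spec.2.1

theorem coindObj_eq {A N L : C} {i : A ⟶ L} {p : L ⟶ N} (hL : 𝒯 L) (hN : 𝒯 N)
    (hc : X.Conflation i p) : coindObj h A = K0.cls L hL - K0.cls N hN :=
  coindex_unique h _ _ _ _ (h.exists_coindex A).choose_spec.choose_spec.choose_spec.choose_spec.2.2
    hc

theorem indObj_biprod {A B D : C} (e : D ≅ A ⊞ B) : indObj h D = indObj h A + indObj h B := by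
  obtain ⟨N, R, i, p, hN, hR, hc⟩ := h.exists_index A
  obtain ⟨N', R', i', p', hN', hR', hc'⟩ := h.exists_index B
  have := (hc.biprod hc').of_iso_ends (Iso.refl _) e.symm
  rw [indObj_eq h hN hR hc, indObj_eq h hN' hR' hc',
    indObj_eq h (h.biprod hN hN') (h.biprod hR hR') this,
    K0.cls_biprod hN hN' _ (Iso.refl _), K0.cls_biprod hR hR' _ (Iso.refl _)]
  abel

theorem coindObj_biprod {A B D : C} (e : D ≅ A ⊞ B) :
    coindObj h D = coindObj h A + coindObj h B := by
  obtain ⟨N, R, i, p, hN, hR, hc⟩ := h.exists_coindex A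
  obtain ⟨N', R', i', p', hN', hR', hc'⟩ := h.exists_coindex B
  have := (hc.biprod hc').of_iso_ends e (Iso.refl _)
  rw [coindObj_eq h hN hR hc, coindObj_eq h hN' hR' hc',
    coindObj_eq h (h.biprod hN hN') (h.biprod hR hR') this,
    K0.cls_biprod hN hN' _ (Iso.refl _), K0.cls_biprod hR hR' _ (Iso.refl _)]
  abel

theorem indObj_iso {A B : C} (e : A ≅ B) : indObj h A = indObj h B := by
  obtain ⟨N, R, i, p, hN, hR, hc⟩ := h.exists_index A
  rw [indObj_eq h hN hR hc, indObj_eq h hN hR (hc.of_iso_ends (Iso.refl _) e)]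

theorem indObj_self {A : C} (hA : 𝒯 A) : indObj h A = K0.cls A hA := by
  obtain ⟨O, hO⟩ := HasZeroObject.zero (C := C)
  rw [indObj_eq h (h.of_isZero hO) hA (Extri.conflation_zero_id A hO), K0.cls_zero _ hO, sub_zero]

theorem exists_isIndex (𝒰 : ObjectProperty C) : ∃ φ, X.IsIndex 𝒰 𝒯 φ :=
  ⟨K0.lift (indObj h) fun _ _ _ _ _ _ e => indObj_biprod h e, fun U hU =>
    ⟨h.exists_index U, fun N R hN hR i p hc => by rw [K0.lift_cls, indObj_eq h hN hR hc]⟩⟩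

theorem exists_isCoindex (𝒰 : ObjectProperty C) : ∃ φ, X.IsCoindex 𝒰 𝒯 φ :=
  ⟨K0.lift (coindObj h) fun _ _ _ _ _ _ e => coindObj_biprod h e, fun U hU =>
    ⟨h.exists_coindex U, fun L N hL hN i p hc => by rw [K0.lift_cls, coindObj_eq h hL hN hc]⟩⟩

theorem isIndex_ind (𝒰 : ObjectProperty C) : X.IsIndex 𝒰 𝒯 (X.ind 𝒰 𝒯) := by
  have := exists_isIndex h 𝒰
  rw [Extri.ind, dif_pos this]
  exact this.choose_spec

theorem isCoindex_coind (𝒰 : ObjectProperty C) : X.IsCoindex 𝒰 𝒯 (X.coind 𝒰 𝒯) := by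
  have := exists_isCoindex h 𝒰
  rw [Extri.coind, dif_pos this]
  exact this.choose_spec

theorem ind_cls {𝒰 : ObjectProperty C} (A : C) (hA : 𝒰 A) :
    X.ind 𝒰 𝒯 (K0.cls A hA) = indObj h A := by
  obtain ⟨N, R, i, p, hN, hR, hc⟩ := h.exists_index A
  rw [indObj_eq h hN hR hc, (isIndex_ind h 𝒰 A hA).2 N R hN hR i p hc]

theorem coind_cls {𝒰 : ObjectProperty C} (A : C) (hA : 𝒰 A) :
    X.coind 𝒰 𝒯 (K0.cls A hA) = coindObj h A := by
  obtain ⟨N, R, i, p, hN, hR, hc⟩ := h.exists_coindex A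
  rw [coindObj_eq h hN hR hc, (isCoindex_coind h 𝒰 A hA).2 N R hN hR i p hc]

end Index

/-! ### Decomposition into indecomposable objects -/

section KrullSchmidt

variable {X : Extri K C} {𝒯 : ObjectProperty C}

/-- Induction over decompositions into indecomposable objects. -/
theorem Extri.IsCT.induction (h : X.IsCT 𝒯)
    (hfin : ∀ A : C, FiniteDimensional K ((A ⟶ A) ⧸ rad K A A)) {Q : C → Prop}
    (iso : ∀ A B : C, (A ≅ B) → Q A → Q B) (zero : ∀ A, IsZero A → Q A)
    (sum : ∀ A B : C, 𝒯 A → 𝒯 B → Q A → Q B → Q (A ⊞ B))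
    (indec : ∀ A : C, 𝒯 A → Indecomposable A → Q A) (A : C) (hA : 𝒯 A) : Q A := by
  induction hn : dimD K A using Nat.strong_induction_on generalizing A with
  | _ n ih =>
    subst hn
    by_cases h0 : IsZero A
    · exact zero A h0
    by_cases hi : Indecomposable A
    · exact indec A hA hi
    have : ∃ Y Z : C, ∃ _ : A ≅ Y ⊞ Z, ¬ IsZero Y ∧ ¬ IsZero Z := by
      by_contra hcon
      push Not at hcon
      exact hi ⟨h0, fun Y Z e => or_iff_not_imp_left.2 (hcon Y Z e)⟩
    obtain ⟨Y, Z, e, hY, hZ⟩ := this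
    have mY : 𝒯 Y := h.of_retract ⟨biprod.inl ≫ e.inv, e.hom ≫ biprod.fst, by simp⟩ hA
    have mZ : 𝒯 Z := h.of_retract ⟨biprod.inr ≫ e.inv, e.hom ≫ biprod.snd, by simp⟩ hA
    exact iso _ _ e.symm (sum Y Z mY mZ (ih _ (dimD_lt hfin e hZ) Y mY rfl)
      (ih _ (dimD_lt hfin (e ≪≫ biprod.braiding Y Z) hY) Z mZ rfl))

theorem isLocalObj_of_mem (hidem : IsIdempotentComplete C) (hK : X.IsCompactCat) (h : X.IsCT 𝒯)
    {A : C} (hA : 𝒯 A) (hi : Indecomposable A) : IsLocalObj K A :=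
  isLocalObj_of_indecomposable hi (hK.finite A)
    fun z hz => exists_idempotent_lift (hK.radical 𝒯 h A A hA hA) hA z hz

theorem IsIndecFamily.topDim_ne (hidem : IsIdempotentComplete C) (hK : X.IsCompactCat)
    (h : X.IsCT 𝒯) {I : Type*} {W : I → C} (hW : IsIndecFamily 𝒯 W) {i j : I} (hij : i ≠ j) :
    topDim K (W i) (W j) = 0 ∧ socDim K (W i) (W j) = 0 := by
  have hl := isLocalObj_of_mem hidem hK h (hW.mem i) (hW.indec i)
  have hn : ¬ Nonempty (Retract (W i) (W j)) := by
    rintro ⟨r⟩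
    exact hij (hW.inj i j (Retract.iso_of_indecomposable r hl.not_isZero (hW.indec j)))
  exact ⟨topDim_eq_zero (hl.mem_rad_to hn), socDim_eq_zero (hl.mem_rad_from hn)⟩

theorem dimD_pos (hfin : ∀ A : C, FiniteDimensional K ((A ⟶ A) ⧸ rad K A A)) {A : C}
    (hA : IsLocalObj K A) : 0 < dimD K A := by
  have := hfin A
  have : Nontrivial ((A ⟶ A) ⧸ rad K A A) :=
    ⟨Submodule.Quotient.mk (𝟙 A), 0, fun h => hA.id_notMem ((Submodule.Quotient.mk_eq_zero _).1 h)⟩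
  exact Module.finrank_pos

/-- The class of an object in terms of indecomposable objects. -/
theorem IsIndecFamily.exists_cls (hidem : IsIdempotentComplete C) (hK : X.IsCompactCat)
    (h : X.IsCT 𝒯) {I : Type*} {W : I → C} (hW : IsIndecFamily 𝒯 W) (A : C) (hA : 𝒯 A) :
    ∃ m : I →₀ ℕ, K0.cls A hA = m.sum (fun i n => n • K0.cls (W i) (hW.mem i)) ∧
      (∀ i, topDim K (W i) A = m i * dimD K (W i)) ∧
      ∀ i, socDim K (W i) A = m i * dimD K (W i) := by
  classical
  -- The same multiplicities are measured by maps to and by maps from the W i; the two directions of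
  -- irreducible morphisms need one count each.
  refine h.induction hK.finite (Q := fun A => ∃ m : I →₀ ℕ, (∀ hA : 𝒯 A,
      K0.cls A hA = m.sum (fun i n => n • K0.cls (W i) (hW.mem i))) ∧
      (∀ i, topDim K (W i) A = m i * dimD K (W i)) ∧
      ∀ i, socDim K (W i) A = m i * dimD K (W i)) ?_ ?_ ?_ ?_ A hA |>.imp
        fun m hm => ⟨hm.1 hA, hm.2⟩
  · rintro A B e ⟨m, h₁, h₂, h₃⟩
    refine ⟨m, fun hB => ?_, fun i => ?_, fun i => ?_⟩
    · rw [← h₁ (h.of_iso e.symm hB), K0.cls_iso (fun A => h.of_isZero) _ _ e]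
    · rw [← h₂, topDim_iso e]
    · rw [← h₃, socDim_iso e]
  · intro A h0
    refine ⟨0, fun hA => ?_, fun i => ?_, fun i => ?_⟩
    · rw [K0.cls_zero hA h0, Finsupp.sum_zero_index]
    · rw [topDim_eq_zero fun f => by rw [h0.eq_of_src f 0]; exact zero_mem _]
      simp
    · rw [socDim_eq_zero fun f => by rw [h0.eq_of_tgt f 0]; exact zero_mem _]
      simp
  · rintro A B hA hB ⟨m, h₁, h₂, h₃⟩ ⟨n, h₁', h₂', h₃'⟩
    refine ⟨m + n, fun hAB => ?_, fun i => ?_, fun i => ?_⟩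
    · rw [K0.cls_biprod hA hB hAB (Iso.refl _), h₁, h₁', Finsupp.sum_add_index']
      · simp
      · intro i a b
        exact add_smul a b _
    · rw [topDim_biprod hK.finite _ (Iso.refl _), h₂, h₂', Finsupp.add_apply, add_mul]
    · rw [socDim_biprod hK.finite, h₃, h₃', Finsupp.add_apply, add_mul]
  · intro A hA hi
    obtain ⟨j, ⟨e⟩⟩ := hW.complete A hA hi
    refine ⟨Finsupp.single j 1, fun hA => ?_, fun i => ?_, fun i => ?_⟩
    · rw [Finsupp.sum_single_index (by simp), one_smul, K0.cls_iso (fun A => h.of_isZero) _ _ e]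
    · rw [topDim_iso e]
      by_cases hij : i = j
      · subst hij
        simp [topDim, dimD]
      · rw [(hW.topDim_ne hidem hK h hij).1, Finsupp.single_apply, if_neg (Ne.symm hij), zero_mul]
    · rw [socDim_iso e]
      by_cases hij : i = j
      · subst hij
        simp [socDim, dimD]
      · rw [(hW.topDim_ne hidem hK h hij).2, Finsupp.single_apply, if_neg (Ne.symm hij), zero_mul]

end KrullSchmidt

/-! ### Modules -/

namespace TMod

variable {𝒯 : ObjectProperty C}

theorem act_smul (M : TMod K 𝒯) {A B : C} (hA : 𝒯 A) (hB : 𝒯 B) (r : K) (f : A ⟶ B)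
    (m : M.val B hB) : M.act hA hB (r • f) m = r • M.act hA hB f m := by
  have := M.map_smul r (ObjectProperty.homMk f : (⟨A, hA⟩ : 𝒯.FullSubcategory) ⟶ ⟨B, hB⟩)
  exact congrArg (fun z => z.hom m) this

theorem act_sub (M : TMod K 𝒯) {A B : C} (hA : 𝒯 A) (hB : 𝒯 B) (f g : A ⟶ B)
    (m : M.val B hB) : M.act hA hB (f - g) m = M.act hA hB f m - M.act hA hB g m := by
  have := M.act_add hA hB (f - g) g m
  rw [sub_add_cancel] at this
  rw [this, add_sub_cancel_right]

/-- A module from its values and the action of morphisms. -/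
def ofActs (V : ∀ A : C, 𝒯 A → Type v) [∀ A h, AddCommGroup (V A h)] [∀ A h, Module K (V A h)]
    (act : ∀ {A B : C} (hA : 𝒯 A) (hB : 𝒯 B), (A ⟶ B) → (V B hB →ₗ[K] V A hA))
    (act_id : ∀ {A : C} (hA : 𝒯 A) (m : V A hA), act hA hA (𝟙 A) m = m)
    (act_comp : ∀ {A B D : C} (hA : 𝒯 A) (hB : 𝒯 B) (hD : 𝒯 D) (f : A ⟶ B) (g : B ⟶ D)
      (m : V D hD), act hA hD (f ≫ g) m = act hA hB f (act hB hD g m))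
    (act_add : ∀ {A B : C} (hA : 𝒯 A) (hB : 𝒯 B) (f g : A ⟶ B) (m : V B hB),
      act hA hB (f + g) m = act hA hB f m + act hA hB g m)
    (act_smul : ∀ {A B : C} (hA : 𝒯 A) (hB : 𝒯 B) (r : K) (f : A ⟶ B) (m : V B hB),
      act hA hB (r • f) m = r • act hA hB f m) : TMod K 𝒯 where
  F :=
    { obj := fun A => ModuleCat.of K (V A.unop.obj A.unop.property)
      map := fun {A B} f => ModuleCat.ofHom (act B.unop.property A.unop.property f.unop.hom)
      map_id := fun A => by
        ext m
        exact act_id _ m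
      map_comp := fun f g => by
        ext m
        exact act_comp _ _ _ _ _ m }
  map_add := fun f g => by
    ext m
    exact act_add _ _ _ _ m
  map_smul := fun r f => by
    ext m
    exact act_smul _ _ _ _ m

end TMod

/-! ### The adjoint of the coindex -/

section Pairing

variable {𝒯 : ObjectProperty C}

theorem pairing_injective : Function.Injective (pairing (K := K) (𝒯 := 𝒯)) := by
  rw [injective_iff_map_eq_zero]
  intro v
  obtain ⟨w, rfl⟩ := QuotientAddGroup.mk_surjective v
  intro hw
  exact (QuotientAddGroup.eq_zero_iff w).2 hw

theorem pairing_cls (M : TMod K 𝒯) (hM : M.IsLfd) (A : C) (hA : 𝒯 A) :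
    pairing (K0num.cls M hM) (K0.cls A hA) = Module.finrank K (M.val A hA) := by
  have : pairing (K0num.cls M hM) = dimHom M hM := by
    show FreeAbelianGroup.lift (fun M : {M : TMod K 𝒯 // M.IsLfd} => dimHom M.1 M.2)
      (FreeAbelianGroup.of ⟨M, hM⟩) = _
    rw [FreeAbelianGroup.lift_apply_of]
  rw [this, dimHom_cls]

theorem pairing_simple (hfin : ∀ A : C, FiniteDimensional K ((A ⟶ A) ⧸ rad K A A)) (V A : C)
    (hA : 𝒯 A) :
    pairing (K0num.cls (simple K 𝒯 V) (simple_isLfd hfin 𝒯 V)) (K0.cls A hA) = topDim K V A :=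
  pairing_cls _ _ _ _

theorem K0num_ext {v w : K0num K 𝒯}
    (h : ∀ A (hA : 𝒯 A), pairing v (K0.cls A hA) = pairing w (K0.cls A hA)) : v = w :=
  pairing_injective (K0_hom_ext h)

theorem K0num_induction {P : K0num K 𝒯 → Prop} (h : ∀ M hM, P (K0num.cls M hM)) (h0 : P 0)
    (hn : ∀ v, P v → P (-v)) (ha : ∀ v w, P v → P w → P (v + w)) (v : K0num K 𝒯) : P v := by
  obtain ⟨w, rfl⟩ := QuotientAddGroup.mk_surjective v
  obtain ⟨z, rfl⟩ := QuotientAddGroup.mk_surjective w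
  induction z using FreeAbelianGroup.induction_on with
  | zero => exact h0
  | of M => exact h M.1 M.2
  | neg M hM => exact hn _ hM
  | add z z' hz hz' => exact ha _ _ hz hz'

end Pairing

/-! ### Functoriality of coresolutions and existence of the adjoint. -/

section Coresolution

variable (X : Extri K C) (𝒰 : ObjectProperty C)

/-- A conflation `A ⟶ L ⟶ N` with `L` and `N` in `𝒰`. -/
structure Cores (A : C) where
  L : C
  N : C
  i : A ⟶ L
  p : L ⟶ N
  δ : X.Ext N A
  memL : 𝒰 L
  memN : 𝒰 N
  real : X.Realizes δ i p

variable {X 𝒰}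

/-- A choice of coresolutions. -/
def Extri.IsCT.cores (h : X.IsCT 𝒰) (A : C) : Cores X 𝒰 A :=
  Classical.choice (by
    obtain ⟨L, N, i, p, hL, hN, δ, hδ⟩ := h.exists_coindex A
    exact ⟨⟨L, N, i, p, δ, hL, hN, hδ⟩⟩)

namespace Cores

variable (h : X.IsCT 𝒰)

-- The composite A ⟶ B ⟶ S.L extends over R.L because Ext(R.N, S.L) = 0; ET3 supplies the third map.
include h in
theorem exists_map {A B : C} (R : Cores X 𝒰 A) (S : Cores X 𝒰 B) (t : A ⟶ B) :
    ∃ (b : R.L ⟶ S.L) (c : R.N ⟶ S.N), R.i ≫ b = t ≫ S.i ∧ R.p ≫ c = b ≫ S.p ∧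
      X.push t R.δ = X.pull c S.δ := by
  obtain ⟨b, hb⟩ := (R.real.push_eq_zero_iff (t ≫ S.i)).1 (h.ext_zero R.memN S.memL _)
  obtain ⟨c, hc, hc'⟩ := X.et3 R.real S.real t b hb
  exact ⟨b, c, hb, hc, hc'⟩

/-- The map of middle terms induced by a morphism. -/
def mapL {A B : C} (R : Cores X 𝒰 A) (S : Cores X 𝒰 B) (t : A ⟶ B) : R.L ⟶ S.L :=
  (exists_map h R S t).choose

/-- The map of third terms induced by a morphism. -/
def mapN {A B : C} (R : Cores X 𝒰 A) (S : Cores X 𝒰 B) (t : A ⟶ B) : R.N ⟶ S.N :=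
  (exists_map h R S t).choose_spec.choose

theorem i_mapL {A B : C} (R : Cores X 𝒰 A) (S : Cores X 𝒰 B) (t : A ⟶ B) :
    R.i ≫ mapL h R S t = t ≫ S.i := (exists_map h R S t).choose_spec.choose_spec.1

theorem p_mapN {A B : C} (R : Cores X 𝒰 A) (S : Cores X 𝒰 B) (t : A ⟶ B) :
    R.p ≫ mapN h R S t = mapL h R S t ≫ S.p := (exists_map h R S t).choose_spec.choose_spec.2.1

theorem push_δ {A B : C} (R : Cores X 𝒰 A) (S : Cores X 𝒰 B) (t : A ⟶ B) :
    X.push t R.δ = X.pull (mapN h R S t) S.δ := (exists_map h R S t).choose_spec.choose_spec.2.2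

variable (M : TMod K 𝒰)

/-- Two candidates for the map of third terms differ by a map through S.p, which acts as zero on the
kernel of the action of S.p. Hence the chosen maps act functorially on these kernels. -/
theorem act_mapN {A B : C} (R : Cores X 𝒰 A) (S : Cores X 𝒰 B) (t : A ⟶ B) (c : R.N ⟶ S.N)
    (hc : X.push t R.δ = X.pull c S.δ) (m : M.val S.N S.memN)
    (hm : M.act S.memL S.memN S.p m = 0) :
    M.act R.memN S.memN (mapN h R S t) m = M.act R.memN S.memN c m := by
  rw [← sub_eq_zero, ← M.act_sub]
  obtain ⟨g, hg⟩ := (S.real.pull_eq_zero_iff (mapN h R S t - c)).1 (by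
    rw [X.pull_sub, ← push_δ, hc, sub_self])
  rw [← hg, M.act_comp R.memN S.memL S.memN, hm, map_zero]

/-- Dually, two candidates on the middle terms differ by a map through R.p, which is invisible in
the cokernel of the action of R.p. -/
theorem act_mapL {A B : C} (R : Cores X 𝒰 A) (S : Cores X 𝒰 B) (t : A ⟶ B) (b : R.L ⟶ S.L)
    (hb : R.i ≫ b = t ≫ S.i) (m : M.val S.L S.memL) :
    M.act R.memL S.memL (mapL h R S t) m - M.act R.memL S.memL b m ∈
      LinearMap.range (M.act R.memL R.memN R.p) := by
  rw [← M.act_sub]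
  obtain ⟨g, hg⟩ := R.real.exists_desc (mapL h R S t - b) (by
    rw [Preadditive.comp_sub, i_mapL, hb, sub_self])
  exact ⟨M.act R.memN S.memL g m, by rw [← M.act_comp, hg]⟩

variable (𝒯 : ObjectProperty C)

/-- The module `T ↦ Ker(M(N) ⟶ M(L))` for coresolutions `T ⟶ L ⟶ N`. -/
def kerMod : TMod K 𝒯 :=
  TMod.ofActs (fun A _ => LinearMap.ker (M.act (h.cores A).memL (h.cores A).memN (h.cores A).p))
    (fun {A B} _ _ t => (M.act (h.cores A).memN (h.cores B).memN
      (mapN h (h.cores A) (h.cores B) t)).restrict (fun m hm => by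
        rw [LinearMap.mem_ker] at hm ⊢
        rw [← M.act_comp, p_mapN, M.act_comp _ (h.cores B).memL, hm, map_zero]))
    (fun _ m => Subtype.ext (by
      simp only [LinearMap.restrict_apply]
      rw [act_mapN h M _ _ _ (𝟙 _) (by rw [X.push_id, X.pull_id]) _ m.2, M.act_id]))
    (fun {A B D} _ _ _ f g m => Subtype.ext (by
      simp only [LinearMap.restrict_apply]
      rw [act_mapN h M _ _ _ (mapN h (h.cores A) (h.cores B) f ≫ mapN h (h.cores B) (h.cores D) g)
        (by rw [X.push_comp, push_δ h _ (h.cores B), X.push_pull, push_δ h _ (h.cores D),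
          X.pull_comp]) _ m.2, M.act_comp]))
    (fun {A B} _ _ f g m => Subtype.ext (by
      simp only [LinearMap.restrict_apply, Submodule.coe_add]
      rw [act_mapN h M _ _ _ (mapN h (h.cores A) (h.cores B) f + mapN h (h.cores A) (h.cores B) g)
        (by rw [X.push_add, push_δ h _ (h.cores B), push_δ h _ (h.cores B), X.pull_add]) _ m.2,
        M.act_add]))
    (fun {A B} _ _ r f m => Subtype.ext (by
      simp only [LinearMap.restrict_apply, Submodule.coe_smul]
      rw [act_mapN h M _ _ _ (r • mapN h (h.cores A) (h.cores B) f)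
        (by rw [X.push_smul, push_δ h _ (h.cores B), X.pull_smul]) _ m.2,
        M.act_smul]))

/-- The module `T ↦ Coker(M(N) ⟶ M(L))` for coresolutions `T ⟶ L ⟶ N`. -/
def cokerMod : TMod K 𝒯 :=
  TMod.ofActs (fun A _ => M.val (h.cores A).L (h.cores A).memL ⧸
      LinearMap.range (M.act (h.cores A).memL (h.cores A).memN (h.cores A).p))
    (fun {A B} _ _ t => Submodule.mapQ _ _ (M.act (h.cores A).memL (h.cores B).memL
      (mapL h (h.cores A) (h.cores B) t)) (by
        rintro _ ⟨m, rfl⟩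
        exact ⟨M.act _ _ (mapN h (h.cores A) (h.cores B) t) m, by
          rw [← M.act_comp, p_mapN, M.act_comp]⟩))
    (fun _ m => by
      obtain ⟨m, rfl⟩ := Submodule.Quotient.mk_surjective _ m
      rw [Submodule.mapQ_apply, Submodule.Quotient.eq]
      have := act_mapL h M (h.cores _) (h.cores _) (𝟙 _) (𝟙 _) (by simp) m
      rwa [M.act_id] at this)
    (fun {A B D} _ _ _ f g m => by
      obtain ⟨m, rfl⟩ := Submodule.Quotient.mk_surjective _ m
      rw [Submodule.mapQ_apply, Submodule.mapQ_apply, Submodule.mapQ_apply, Submodule.Quotient.eq]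
      have := act_mapL h M (h.cores _) (h.cores _) (f ≫ g)
        (mapL h (h.cores A) (h.cores B) f ≫ mapL h (h.cores B) (h.cores D) g)
        (by rw [← Category.assoc, i_mapL, Category.assoc, i_mapL, Category.assoc]) m
      rwa [M.act_comp _ (h.cores B).memL] at this)
    (fun {A B} _ _ f g m => by
      obtain ⟨m, rfl⟩ := Submodule.Quotient.mk_surjective _ m
      rw [Submodule.mapQ_apply, Submodule.mapQ_apply, Submodule.mapQ_apply,
        ← Submodule.Quotient.mk_add, Submodule.Quotient.eq]
      have := act_mapL h M (h.cores _) (h.cores _) (f + g)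
        (mapL h (h.cores A) (h.cores B) f + mapL h (h.cores A) (h.cores B) g)
        (by rw [Preadditive.comp_add, i_mapL, i_mapL, Preadditive.add_comp]) m
      rwa [M.act_add] at this)
    (fun {A B} _ _ r f m => by
      obtain ⟨m, rfl⟩ := Submodule.Quotient.mk_surjective _ m
      rw [Submodule.mapQ_apply, Submodule.mapQ_apply,
        ← Submodule.Quotient.mk_smul, Submodule.Quotient.eq]
      have := act_mapL h M (h.cores _) (h.cores _) (r • f) (r • mapL h (h.cores A) (h.cores B) f)
        (by rw [Linear.comp_smul, i_mapL, Linear.smul_comp]) m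
      rwa [M.act_smul] at this)

end Cores

/-- On a module M the composite with the coindex sends T to dim M(L) - dim M(N), that is, the
dimension of the cokernel of M(N) ⟶ M(L) minus that of its kernel. Both are values of locally
finite-dimensional 𝒯-modules, so the functional is represented; injectivity of the pairing makes the
choice additive. -/
theorem exists_isIndbar (h : X.IsCT 𝒰) (𝒯 : ObjectProperty C) : ∃ φ, X.IsIndbar 𝒰 𝒯 φ := by
  let Φ : K0num K 𝒰 →+ K0 𝒯 →+ ℤ :=
    { toFun := fun v => (pairing v).comp (X.coind 𝒯 𝒰)
      map_zero' := by ext; simp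
      map_add' := fun v w => by ext; simp }
  have hΦ : ∀ v, ∃ w : K0num K 𝒯, pairing w = Φ v := by
    intro v
    refine K0num_induction (P := fun v => ∃ w : K0num K 𝒯, pairing w = Φ v) ?_ ?_ ?_ ?_ v
    · intro M hM
      have h₁ : (Cores.kerMod h M 𝒯).IsLfd := by
        intro A hA
        have := hM (h.cores A).N (h.cores A).memN
        exact inferInstanceAs (FiniteDimensional K
          (LinearMap.ker (M.act (h.cores A).memL (h.cores A).memN (h.cores A).p)))
      have h₂ : (Cores.cokerMod h M 𝒯).IsLfd := by
        intro A hA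
        have := hM (h.cores A).L (h.cores A).memL
        exact inferInstanceAs (FiniteDimensional K (M.val (h.cores A).L (h.cores A).memL ⧸
          LinearMap.range (M.act (h.cores A).memL (h.cores A).memN (h.cores A).p)))
      refine ⟨K0num.cls _ h₂ - K0num.cls _ h₁, K0_hom_ext fun A hA => ?_⟩
      have := hM (h.cores A).N (h.cores A).memN
      have := hM (h.cores A).L (h.cores A).memL
      have e₁ := LinearMap.finrank_range_add_finrank_ker
        (M.act (h.cores A).memL (h.cores A).memN (h.cores A).p)
      have e₂ := Submodule.finrank_quotient_add_finrank
        (LinearMap.range (M.act (h.cores A).memL (h.cores A).memN (h.cores A).p))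
      have e₃ : Φ (K0num.cls M hM) (K0.cls A hA) =
          (Module.finrank K (M.val (h.cores A).L (h.cores A).memL) : ℤ) -
          Module.finrank K (M.val (h.cores A).N (h.cores A).memN) := by
        show pairing (K0num.cls M hM) (X.coind 𝒯 𝒰 (K0.cls A hA)) = _
        rw [coind_cls h, coindObj_eq h (h.cores A).memL (h.cores A).memN ⟨_, (h.cores A).real⟩,
          map_sub, pairing_cls, pairing_cls]
      rw [e₃, map_sub, AddMonoidHom.sub_apply, pairing_cls, pairing_cls]
      change ((Module.finrank K (M.val (h.cores A).L (h.cores A).memL ⧸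
          LinearMap.range (M.act (h.cores A).memL (h.cores A).memN (h.cores A).p)) : ℕ) : ℤ) -
        (Module.finrank K
          (LinearMap.ker (M.act (h.cores A).memL (h.cores A).memN (h.cores A).p)) : ℕ) = _
      omega
    · exact ⟨0, by rw [map_zero, map_zero]⟩
    · rintro v ⟨w, hw⟩
      exact ⟨-w, by rw [map_neg, map_neg, hw]⟩
    · rintro v v' ⟨w, hw⟩ ⟨w', hw'⟩
      exact ⟨w + w', by rw [map_add, map_add, hw, hw']⟩
  choose φ hφ using hΦ
  refine ⟨{ toFun := φ, map_zero' := ?_, map_add' := ?_ }, fun v t => ?_⟩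
  · apply pairing_injective
    rw [hφ, map_zero, map_zero]
  · intro v w
    apply pairing_injective
    rw [hφ, map_add, map_add, hφ, hφ]
  · show pairing (φ v) t = _
    rw [hφ]
    rfl

theorem isIndbar_indbar (h : X.IsCT 𝒰) (𝒯 : ObjectProperty C) :
    X.IsIndbar 𝒰 𝒯 (X.indbar 𝒰 𝒯) := by
  have := exists_isIndbar h 𝒯
  rw [Extri.indbar, dif_pos this]
  exact this.choose_spec

/-- The pairing with `indbar [S_V]` in terms of any coresolution. -/
theorem pairing_indbar_simple (hfin : ∀ A : C, FiniteDimensional K ((A ⟶ A) ⧸ rad K A A))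
    (h : X.IsCT 𝒰) (𝒯 : ObjectProperty C) (V : C) {A : C} (hA : 𝒯 A) (R : Cores X 𝒰 A) :
    pairing (X.indbar 𝒰 𝒯 (K0num.cls (simple K 𝒰 V) (simple_isLfd hfin _ _))) (K0.cls A hA) =
      (topDim K V R.L : ℤ) - topDim K V R.N := by
  rw [isIndbar_indbar h, coind_cls h, coindObj_eq h R.memL R.memN ⟨_, R.real⟩, map_sub,
    pairing_simple hfin, pairing_simple hfin]

end Coresolution

/-! ### Bounded resolutions of additive presheaves -/

section Presheaves

universe t s

variable {E : Type u₁} [Category.{v₁} E] [Preadditive E] [HasFiniteBiproducts E]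

/-- Additive presheaves on the full subcategory `Q`. -/
structure Psh (Q : ObjectProperty E) where
  val : ∀ A : E, Q A → Type t
  [grp : ∀ A hA, AddCommGroup (val A hA)]
  act : ∀ {A B : E} (hA : Q A) (hB : Q B), (A ⟶ B) → (val B hB →+ val A hA)
  act_comp : ∀ {A B D : E} (hA : Q A) (hB : Q B) (hD : Q D) (f : A ⟶ B) (g : B ⟶ D)
    (m : val D hD), act hA hD (f ≫ g) m = act hA hB f (act hB hD g m)
  act_add : ∀ {A B : E} (hA : Q A) (hB : Q B) (f g : A ⟶ B) (m : val B hB),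
    act hA hB (f + g) m = act hA hB f m + act hA hB g m

attribute [instance] Psh.grp

namespace Psh

variable {Q : ObjectProperty E}

theorem act_sub (G : Psh Q) {A B : E} (hA : Q A) (hB : Q B) (f g : A ⟶ B)
    (m : G.val B hB) : G.act hA hB (f - g) m = G.act hA hB f m - G.act hA hB g m := by
  have := G.act_add hA hB (f - g) g m
  rw [sub_add_cancel] at this
  rw [this, add_sub_cancel_right]

/-- Bounded resolutions by representable presheaves. -/
structure Res (G : Psh Q) where
  n : ℕ
  obj : ℕ → E
  mem : ∀ i, Q (obj i)
  isZero : ∀ i, n < i → IsZero (obj i)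
  d : ∀ i, obj (i + 1) ⟶ obj i
  aug : G.val (obj 0) (mem 0)
  surj : ∀ (A : E) (hA : Q A) (y : G.val A hA), ∃ a : A ⟶ obj 0, G.act hA (mem 0) a aug = y
  exact_zero : ∀ (A : E) (hA : Q A) (a : A ⟶ obj 0),
    G.act hA (mem 0) a aug = 0 ↔ ∃ b : A ⟶ obj 1, b ≫ d 0 = a
  exact_succ : ∀ (A : E) (_ : Q A) (i : ℕ) (a : A ⟶ obj (i + 1)),
    a ≫ d i = 0 ↔ ∃ b : A ⟶ obj (i + 2), b ≫ d (i + 1) = a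

/-- The objects of a complex in which the last term is moved to degree two. -/
def foldObj (obj : ℕ → E) : ℕ → E
  | 0 => obj 1
  | 1 => obj 2 ⊞ obj 0
  | i + 2 => obj (i + 3)

/-- The differential of `foldObj obj` for a section `s` of the last differential. -/
def foldD {obj : ℕ → E} (d : ∀ i, obj (i + 1) ⟶ obj i) (s : obj 0 ⟶ obj 1) :
    ∀ i, foldObj obj (i + 1) ⟶ foldObj obj i
  | 0 => biprod.desc (d 1) s
  | 1 => biprod.lift (d 2) 0
  | i + 2 => d (i + 3)

section Euler

variable {Γ : Type s} [AddCommGroup Γ] (κ : ∀ A : E, Q A → Γ)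

/-- The alternating sum of the classes of the terms of a resolution. -/
def Res.euler {G : Psh Q} (R : Res G) : Γ :=
  ∑ i ∈ Finset.range (R.n + 1), (-1 : ℤ) ^ i • κ (R.obj i) (R.mem i)

theorem sum_eq_of_le {n m : ℕ} (f : ℕ → Γ) (hf : ∀ i, n < i → f i = 0) (hnm : n ≤ m) :
    ∑ i ∈ Finset.range (m + 1), f i = ∑ i ∈ Finset.range (n + 1), f i := by
  symm
  apply Finset.sum_subset
  · intro i
    simp only [Finset.mem_range]
    omega
  · intro i _ hi
    apply hf
    simp only [Finset.mem_range] at hi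
    omega

variable (hκ : ∀ (A B D : E) (hA : Q A) (hB : Q B) (hD : Q D), (D ≅ A ⊞ B) →
  κ D hD = κ A hA + κ B hB) (hQ : ∀ A B : E, Q A → Q B → Q (A ⊞ B))

include hκ

theorem κ_zero {A : E} (hA : Q A) (h0 : IsZero A) : κ A hA = 0 := by
  have := hκ A A A hA hA hA (biprodZeroIso A h0)
  simpa using this

theorem κ_iso {A B : E} (hA : Q A) (hB : Q B) (h0 : ∃ O : E, Q O ∧ IsZero O) (e : A ≅ B) :
    κ A hA = κ B hB := by
  obtain ⟨O, hO, h0⟩ := h0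
  rw [hκ B O A hB hO hA (e ≪≫ biprodZeroIso B h0), κ_zero κ hκ hO h0, add_zero]

include hQ

/-- The Euler characteristic of a bounded exact complex vanishes. -/
theorem euler_exact (n : ℕ) : ∀ (obj : ℕ → E) (mem : ∀ i, Q (obj i))
    (_ : ∀ i, n + 1 < i → IsZero (obj i)) (d : ∀ i, obj (i + 1) ⟶ obj i)
    (_ : ∀ (A : E) (_ : Q A) (a : A ⟶ obj 0), ∃ b : A ⟶ obj 1, b ≫ d 0 = a)
    (_ : ∀ (A : E) (_ : Q A) (i : ℕ) (a : A ⟶ obj (i + 1)),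
      a ≫ d i = 0 ↔ ∃ b : A ⟶ obj (i + 2), b ≫ d (i + 1) = a),
    ∑ i ∈ Finset.range (n + 2), (-1 : ℤ) ^ i • κ (obj i) (mem i) = 0 := by
  induction n with
  | zero =>
    intro obj mem hz d hs he
    obtain ⟨s, hs⟩ := hs (obj 0) (mem 0) (𝟙 _)
    have h2 := hz 2 (by omega)
    have h₁ : d 0 ≫ s = 𝟙 _ := by
      obtain ⟨b, hb⟩ := (he (obj 1) (mem 1) 0 (d 0 ≫ s - 𝟙 _)).1 (by simp [hs])
      rw [h2.eq_of_tgt b 0, zero_comp] at hb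
      exact (sub_eq_zero.1 hb.symm)
    have := κ_iso κ hκ (mem 1) (mem 0) ⟨_, mem 2, h2⟩ ⟨d 0, s, h₁, hs⟩
    simp [Finset.sum_range_succ, this]
  | succ n ih =>
    intro obj mem hz d hs he
    obtain ⟨s, hs⟩ := hs (obj 0) (mem 0) (𝟙 _)
    have hdd : ∀ i, d (i + 1) ≫ d i = 0 := fun i =>
      (he _ (mem _) i (d (i + 1))).2 ⟨𝟙 _, by simp⟩
    -- The first differential has a section s, so `obj 0` can be moved from degree 0 to degree 2,
    -- next to `obj 2`. This keeps its parity; after a shift the complex is exact and shorter by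
    -- one, and its Euler characteristic has only changed sign.
    let obj' := foldObj obj
    let d' := foldD d s
    have mem' : ∀ i, Q (obj' i) := fun i => match i with
      | 0 => mem 1
      | 1 => hQ _ _ (mem 2) (mem 0)
      | i + 2 => mem (i + 3)
    have key := ih obj' mem' (by
      intro i hi
      match i with
      | 0 => omega
      | 1 => omega
      | i + 2 => exact hz (i + 3) (by omega)) d' (by
      intro A hA (a : A ⟶ obj 1)
      obtain ⟨b, hb⟩ := (he A hA 0 (a - a ≫ d 0 ≫ s)).1 (by simp [hs])
      exact ⟨biprod.lift b (a ≫ d 0), by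
        show biprod.lift b (a ≫ d 0) ≫ biprod.desc (d 1) s = _
        simp [hb]⟩) (by
      intro A hA i a
      match i, a with
      | 0, (a : A ⟶ obj 2 ⊞ obj 0) =>
        show a ≫ biprod.desc (d 1) s = 0 ↔ ∃ b : A ⟶ obj 3, b ≫ biprod.lift (d 2) 0 = a
        constructor
        · intro ha
          have h₁ : a ≫ biprod.snd = 0 := by
            have := congrArg (· ≫ d 0) ha
            rw [biprod.desc_eq] at this
            simpa [hdd, hs] using this
          obtain ⟨b, hb⟩ := (he A hA 1 (a ≫ biprod.fst)).1 (by
            rw [biprod.desc_eq] at ha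
            simpa [reassoc_of% h₁] using ha)
          exact ⟨b, by ext <;> simp [hb, h₁]⟩
        · rintro ⟨b, rfl⟩
          simp [hdd]
      | 1, (a : A ⟶ obj 3) =>
        show a ≫ biprod.lift (d 2) 0 = 0 ↔ ∃ b : A ⟶ obj 4, b ≫ d 3 = a
        rw [← he A hA 2 a]
        constructor
        · intro ha
          have := congrArg (· ≫ biprod.fst) ha
          simpa using this
        · intro ha
          ext <;> simp [ha]
      | i + 2, a => exact he A hA (i + 3) a)
    rw [Finset.sum_range_succ', Finset.sum_range_succ', Finset.sum_range_succ']
    rw [Finset.sum_range_succ', Finset.sum_range_succ'] at key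
    have h₁ : κ (obj' (0 + 1)) (mem' (0 + 1)) = κ (obj 2) (mem 2) + κ (obj 0) (mem 0) :=
      hκ _ _ _ _ _ _ (Iso.refl _)
    rw [h₁] at key
    have h₂ : ∑ k ∈ Finset.range n, (-1 : ℤ) ^ (k + 1 + 1 + 1) • κ (obj (k + 1 + 1 + 1)) (mem _) =
        - ∑ k ∈ Finset.range n, (-1 : ℤ) ^ (k + 1 + 1) • κ (obj' (k + 1 + 1)) (mem' _) := by
      rw [← Finset.sum_neg_distrib]
      refine Finset.sum_congr rfl fun k _ => ?_
      rw [pow_succ _ (k + 1 + 1), mul_neg_one, neg_smul]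
      rfl
    rw [h₂, ← neg_eq_zero, ← key]
    simp only [zero_add, pow_zero, pow_one, one_smul, neg_smul]
    have h₃ : κ (obj' 0) (mem' 0) = κ (obj 1) (mem 1) := rfl
    rw [h₃]
    simp
    abel

include hQ in
theorem euler_eq_zero {G : Psh Q} (R : Res G) (hG : ∀ A hA (m : G.val A hA), m = 0) :
    R.euler κ = 0 := by
  -- A vanishing term is added, since `euler_exact` concerns complexes with at least two terms.
  rw [Res.euler, ← sum_eq_of_le _ (fun i hi => by rw [κ_zero κ hκ _ (R.isZero i hi), smul_zero])
    (Nat.le_succ R.n)]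
  exact euler_exact κ hκ hQ R.n R.obj R.mem (fun i hi => R.isZero i (by omega)) R.d
    (fun A hA a => (R.exact_zero A hA a).1 (hG _ _ _)) R.exact_succ

end Euler

/-! #### Mapping cones -/

/-- Morphisms of presheaves, possibly in different universes. -/
structure Hom (G : Psh Q) (G' : Psh Q) where
  app : ∀ (A : E) (hA : Q A), G.val A hA →+ G'.val A hA
  nat : ∀ {A B : E} (hA : Q A) (hB : Q B) (f : A ⟶ B) (m : G.val B hB),
    app A hA (G.act hA hB f m) = G'.act hA hB f (app B hB m)

theorem Res.d_comp_d {G : Psh Q} (R : Res G) (i : ℕ) : R.d (i + 1) ≫ R.d i = 0 :=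
  (R.exact_succ _ (R.mem _) i (R.d (i + 1))).2 ⟨𝟙 _, by simp⟩

/-- The comparison theorem: terms of R are representable by objects of Q, so maps out of them lift
along the exact complex of R'. -/
theorem Res.exists_comparison {G : Psh Q} {G' : Psh Q} (φ : Hom G G') (R : Res G) (R' : Res G') :
    ∃ f : ∀ i, R.obj i ⟶ R'.obj i, G'.act (R.mem 0) (R'.mem 0) (f 0) R'.aug = φ.app _ _ R.aug ∧
      ∀ i, R.d i ≫ f i = f (i + 1) ≫ R'.d i := by
  obtain ⟨f₀, hf₀⟩ := R'.surj _ (R.mem 0) (φ.app _ _ R.aug)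
  have h₁ : ∃ f₁ : R.obj 1 ⟶ R'.obj 1, R.d 0 ≫ f₀ = f₁ ≫ R'.d 0 := by
    obtain ⟨b, hb⟩ := (R'.exact_zero _ (R.mem 1) (R.d 0 ≫ f₀)).1 (by
      rw [G'.act_comp _ (R.mem 0), hf₀, ← φ.nat, (R.exact_zero _ (R.mem 1) (R.d 0)).2
        ⟨𝟙 _, by simp⟩, map_zero])
    exact ⟨b, hb.symm⟩
  obtain ⟨f₁, hf₁⟩ := h₁
  have step : ∀ (i : ℕ) (a : R.obj i ⟶ R'.obj i) (b : R.obj (i + 1) ⟶ R'.obj (i + 1)),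
      R.d i ≫ a = b ≫ R'.d i →
      ∃ c : R.obj (i + 2) ⟶ R'.obj (i + 2), R.d (i + 1) ≫ b = c ≫ R'.d (i + 1) := by
    intro i a b hab
    obtain ⟨c, hc⟩ := (R'.exact_succ _ (R.mem (i + 2)) i (R.d (i + 1) ≫ b)).1 (by
      rw [Category.assoc, ← hab, ← Category.assoc, R.d_comp_d, zero_comp])
    exact ⟨c, hc.symm⟩
  choose c hc using step
  -- The recursion carries two consecutive components together with their commuting square, as the
  -- next component depends on both.
  let P : ℕ → Type _ := fun i => {ab : (R.obj i ⟶ R'.obj i) × (R.obj (i + 1) ⟶ R'.obj (i + 1)) //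
    R.d i ≫ ab.1 = ab.2 ≫ R'.d i}
  let F : ∀ i, P i := fun i => Nat.rec (motive := P) ⟨(f₀, f₁), hf₁⟩
    (fun i ab => ⟨(ab.1.2, c i ab.1.1 ab.1.2 ab.2), hc i _ _ _⟩) i
  exact ⟨fun i => (F i).1.1, hf₀, fun i => (F i).2⟩

section Cone

variable (hQ : ∀ A B : E, Q A → Q B → Q (A ⊞ B))

/-- The objects of the mapping cone. -/
def coneObj (P R : ℕ → E) : ℕ → E
  | 0 => R 0
  | i + 1 => P i ⊞ R (i + 1)

/-- The differential of the mapping cone. -/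
def coneD {P R : ℕ → E} (dP : ∀ i, P (i + 1) ⟶ P i) (dR : ∀ i, R (i + 1) ⟶ R i)
    (f : ∀ i, P i ⟶ R i) : ∀ i, coneObj P R (i + 1) ⟶ coneObj P R i
  | 0 => biprod.desc (f 0) (dR 0)
  | i + 1 => biprod.desc (biprod.lift (-dP i) (f (i + 1))) (biprod.lift 0 (dR (i + 1)))

include hQ

/-- Resolutions of the quotient in a short exact sequence. -/
theorem Res.exists_cone {G' : Psh Q} {G : Psh Q} {G'' : Psh Q} (φ : Hom G' G) (π : Hom G G'')
    (hφ : ∀ A hA, Function.Injective (φ.app A hA)) (hπ : ∀ A hA, Function.Surjective (π.app A hA))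
    (hex : ∀ A hA (m : G.val A hA), π.app A hA m = 0 ↔ ∃ m', φ.app A hA m' = m)
    (P : Res G') (R : Res G) : ∃ S : Res G'', ∀ {Γ : Type s} [AddCommGroup Γ]
      (κ : ∀ A : E, Q A → Γ) (_ : ∀ (A B D : E) (hA : Q A) (hB : Q B) (hD : Q D), (D ≅ A ⊞ B) →
        κ D hD = κ A hA + κ B hB), S.euler κ = R.euler κ - P.euler κ := by
  obtain ⟨f, hf₀, hf⟩ := Res.exists_comparison φ P R
  have mem : ∀ i, Q (coneObj P.obj R.obj i) := fun i => match i with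
    | 0 => R.mem 0
    | i + 1 => hQ _ _ (P.mem i) (R.mem (i + 1))
  -- Exactness of the cone in degree zero comes from exactness of the sequence at G, and in degree
  -- one from injectivity of φ; above that it is formal.
  let S : Res G'' :=
    { n := P.n + R.n + 1
      obj := coneObj P.obj R.obj
      mem := mem
      isZero := by
        intro i hi
        match i with
        | 0 => omega
        | i + 1 =>
          have h₁ := P.isZero i (by omega)
          have h₂ := R.isZero (i + 1) (by omega)
          rw [IsZero.iff_id_eq_zero]
          show 𝟙 (P.obj i ⊞ R.obj (i + 1)) = 0
          ext
          · simp [h₁.eq_of_src (𝟙 _) 0]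
          · simp
          · simp
          · simp [h₂.eq_of_src (𝟙 _) 0]
      d := coneD P.d R.d f
      aug := π.app _ (R.mem 0) R.aug
      surj := by
        intro A hA y
        obtain ⟨m, rfl⟩ := hπ A hA y
        obtain ⟨a, rfl⟩ := R.surj A hA m
        exact ⟨a, (π.nat _ _ _ _).symm⟩
      exact_zero := by
        intro A hA (a : A ⟶ R.obj 0)
        show G''.act hA (R.mem 0) a (π.app _ (R.mem 0) R.aug) = 0 ↔
          ∃ b : A ⟶ P.obj 0 ⊞ R.obj 1, b ≫ biprod.desc (f 0) (R.d 0) = a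
        rw [← π.nat, hex]
        constructor
        · rintro ⟨m', hm'⟩
          obtain ⟨c, rfl⟩ := P.surj A hA m'
          rw [φ.nat, ← hf₀, ← G.act_comp] at hm'
          obtain ⟨e, he⟩ := (R.exact_zero A hA (a - c ≫ f 0)).1 (by
            rw [G.act_sub, ← hm', sub_self])
          exact ⟨biprod.lift c e, by simp [he]⟩
        · rintro ⟨b, rfl⟩
          refine ⟨G'.act hA (P.mem 0) (b ≫ biprod.fst) P.aug, ?_⟩
          rw [φ.nat, ← hf₀, ← G.act_comp, biprod.desc_eq, Preadditive.comp_add, G.act_add,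
            (R.exact_zero A hA (b ≫ biprod.snd ≫ R.d 0)).2 ⟨b ≫ biprod.snd, by simp⟩, add_zero,
            Category.assoc]
      exact_succ := by
        intro A hA i a
        match i, a with
        | 0, (a : A ⟶ P.obj 0 ⊞ R.obj 1) =>
          show a ≫ biprod.desc (f 0) (R.d 0) = 0 ↔ ∃ b : A ⟶ P.obj 1 ⊞ R.obj 2,
            b ≫ biprod.desc (biprod.lift (-P.d 0) (f 1)) (biprod.lift 0 (R.d 1)) = a
          constructor
          · intro ha
            rw [biprod.desc_eq, Preadditive.comp_add] at ha
            obtain ⟨c, hc⟩ := (P.exact_zero A hA (a ≫ biprod.fst)).1 (by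
              apply hφ
              have h₁ : G.act hA (R.mem 0) (a ≫ biprod.fst ≫ f 0) R.aug =
                  G.act hA (R.mem 0) (-(a ≫ biprod.snd ≫ R.d 0)) R.aug := by
                rw [eq_neg_of_add_eq_zero_left ha]
              rw [map_zero, φ.nat, ← hf₀, ← G.act_comp, Category.assoc, h₁]
              exact (R.exact_zero A hA _).2 ⟨-(a ≫ biprod.snd), by simp⟩)
            obtain ⟨e, he⟩ := (R.exact_succ A hA 0 (a ≫ biprod.snd + c ≫ f 1)).1 (by
              rw [Preadditive.add_comp, Category.assoc c, ← hf 0, reassoc_of% hc, ← ha]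
              simp [add_comm])
            refine ⟨biprod.lift (-c) e, ?_⟩
            have he' : e ≫ R.d 1 = a ≫ biprod.snd + c ≫ f 1 := he
            ext
            · simp [hc]
            · simp [he']
          · rintro ⟨b, rfl⟩
            rw [biprod.desc_eq, biprod.desc_eq]
            simp [hf 0, R.d_comp_d 0]
        | i + 1, (a : A ⟶ P.obj (i + 1) ⊞ R.obj (i + 2)) =>
          show a ≫ biprod.desc (biprod.lift (-P.d i) (f (i + 1))) (biprod.lift 0 (R.d (i + 1))) = 0 ↔
            ∃ b : A ⟶ P.obj (i + 2) ⊞ R.obj (i + 3),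
            b ≫ biprod.desc (biprod.lift (-P.d (i + 1)) (f (i + 2))) (biprod.lift 0 (R.d (i + 2))) = a
          constructor
          · intro ha
            rw [biprod.desc_eq, Preadditive.comp_add] at ha
            have ha₁ := congrArg (· ≫ biprod.fst) ha
            have ha₂ := congrArg (· ≫ biprod.snd) ha
            simp at ha₁ ha₂
            obtain ⟨c, hc⟩ := (P.exact_succ A hA i (a ≫ biprod.fst)).1 (by simpa using ha₁)
            obtain ⟨e, he⟩ := (R.exact_succ A hA (i + 1) (a ≫ biprod.snd + c ≫ f (i + 2))).1 (by
              rw [Preadditive.add_comp, Category.assoc c, ← hf (i + 1), reassoc_of% hc, ← ha₂]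
              simp [add_comm])
            refine ⟨biprod.lift (-c) e, ?_⟩
            have he' : e ≫ R.d (i + 2) = a ≫ biprod.snd + c ≫ f (i + 2) := he
            ext
            · simp [hc]
            · simp [he']
          · rintro ⟨b, rfl⟩
            rw [biprod.desc_eq, biprod.desc_eq]
            have h₁ := P.d_comp_d i
            have h₂ := R.d_comp_d (i + 1)
            have h₃ := hf (i + 1)
            ext
            · simp [h₁]
            · simp [h₂, h₃] }
  refine ⟨S, fun κ hκ => ?_⟩
  have hP := sum_eq_of_le (m := P.n + R.n) (fun i => (-1 : ℤ) ^ i • κ (P.obj i) (P.mem i))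
    (fun i hi => by rw [κ_zero κ hκ _ (P.isZero i hi), smul_zero]) (Nat.le_add_right _ _)
  have hR := sum_eq_of_le (m := P.n + R.n + 1) (fun i => (-1 : ℤ) ^ i • κ (R.obj i) (R.mem i))
    (fun i hi => by rw [κ_zero κ hκ _ (R.isZero i hi), smul_zero]) (by omega)
  rw [Res.euler, Res.euler, Res.euler, ← hP, ← hR, Finset.sum_range_succ', Finset.sum_range_succ' _ (P.n + R.n + 1),
    add_sub_right_comm, ← Finset.sum_sub_distrib]
  congr 1
  refine Finset.sum_congr rfl fun i _ => ?_
  have h₁ : κ (S.obj (i + 1)) (S.mem (i + 1)) = κ (P.obj i) (P.mem i) +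
      κ (R.obj (i + 1)) (R.mem (i + 1)) := hκ _ _ _ _ _ _ (Iso.refl _)
  rw [h₁, pow_succ, mul_neg_one, neg_smul, neg_smul, smul_add]
  abel

end Cone

end Psh

end Presheaves

/-! ### Resolutions over an algebraic lift -/

section Beta

variable {X : Extri K C} {𝒯 : ObjectProperty C}

/-- A presentation of the `𝒯`-module `M` as the cokernel of `Hom(-, B) ⟶ Hom(-, D)`. -/
structure Pres (M : TMod K 𝒯) {B D : C} (p : B ⟶ D) where
  ψ : ∀ (T : C) (hT : 𝒯 T), (T ⟶ D) → M.val T hT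
  add : ∀ (T : C) (hT : 𝒯 T) (a b : T ⟶ D), ψ T hT (a + b) = ψ T hT a + ψ T hT b
  nat : ∀ {S T : C} (hS : 𝒯 S) (hT : 𝒯 T) (f : S ⟶ T) (a : T ⟶ D),
    ψ S hS (f ≫ a) = M.act hS hT f (ψ T hT a)
  surj : ∀ (T : C) (hT : 𝒯 T) (m : M.val T hT), ∃ a, ψ T hT a = m
  ker : ∀ (T : C) (hT : 𝒯 T) (a : T ⟶ D), ψ T hT a = 0 ↔ ∃ g : T ⟶ B, g ≫ p = a

variable (L : AlgLift.{w, v, u, v₁, u₁} X)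

instance AlgLift.additive : L.F.Additive := ⟨fun {_ _ f g} => L.F_add f g⟩

instance AlgLift.preservesBiproducts : PreservesBinaryBiproducts L.F :=
  preservesBinaryBiproducts_of_preservesBiproducts L.F

variable (𝒯) in
/-- The lift of `𝒯` to the exact category. -/
abbrev AlgLift.lift : ObjectProperty L.E := fun A => 𝒯 (L.F.obj A)

variable (𝒯) in
/-- The class in `K0 𝒯` of an object of the lift of `𝒯`. -/
def AlgLift.cls (A : L.E) (hA : L.lift 𝒯 A) : K0 𝒯 := K0.cls (L.F.obj A) hA

theorem AlgLift.lift_biprod (h : X.IsCT 𝒯) (A B : L.E) (hA : L.lift 𝒯 A) (hB : L.lift 𝒯 B) :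
    L.lift 𝒯 (A ⊞ B) :=
  h.of_iso (L.F.mapBiprod A B).symm (h.biprod hA hB)

theorem AlgLift.cls_biprod (A B D : L.E) (hA : L.lift 𝒯 A) (hB : L.lift 𝒯 B) (hD : L.lift 𝒯 D)
    (e : D ≅ A ⊞ B) : L.cls 𝒯 D hD = L.cls 𝒯 A hA + L.cls 𝒯 B hB :=
  K0.cls_biprod (𝒯 := 𝒯) (A := L.F.obj A) (B := L.F.obj B) hA hB hD (L.F.mapIso e ≪≫ L.F.mapBiprod A B)

/-- The restriction of a module to the lift of `𝒯`. -/
def AlgLift.psh (M : TMod K 𝒯) : Psh (L.lift 𝒯) where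
  val A hA := M.val (L.F.obj A) hA
  act hA hB f := (M.act hA hB (L.F.map f)).toAddMonoidHom
  act_comp hA hB hD f g m := by
    show M.act _ _ (L.F.map (f ≫ g)) m = _
    rw [L.F.map_comp]
    exact M.act_comp hA hB hD _ _ m
  act_add hA hB f g m := by
    show M.act _ _ (L.F.map (f + g)) m = _
    rw [L.F_add]
    exact M.act_add hA hB _ _ m

/-- Resolutions of a module are resolutions of the restricted presheaf. -/
def Resolution.toRes {L : AlgLift.{w, v, u, v₁, u₁} X} {M : TMod K 𝒯} (R : Resolution L M) :
    Psh.Res (L.psh M) :=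
  ⟨R.n, R.obj, R.mem, R.isZero, R.d, R.aug, R.surj, R.exact_zero, R.exact_succ⟩

/-- Resolutions of the restricted presheaf are resolutions of the module. -/
def Psh.Res.toResolution {L : AlgLift.{w, v, u, v₁, u₁} X} {M : TMod K 𝒯}
    (R : Psh.Res (L.psh M)) : Resolution L M :=
  ⟨R.n, R.obj, R.mem, R.isZero, R.d, R.aug, R.surj, R.exact_zero, R.exact_succ⟩

theorem Resolution.toRes_euler {L : AlgLift.{w, v, u, v₁, u₁} X} {M : TMod K 𝒯}
    (R : Resolution L M) : R.toRes.euler (L.cls 𝒯) = R.euler := rfl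

theorem Psh.Res.toResolution_euler {L : AlgLift.{w, v, u, v₁, u₁} X} {M : TMod K 𝒯}
    (R : Psh.Res (L.psh M)) : R.toResolution.euler = R.euler (L.cls 𝒯) := rfl

/-- Resolutions of the third term of a short exact sequence. -/
theorem exists_resolution_of_shortExact (h : X.IsCT 𝒯) {M' M M'' : TMod K 𝒯}
    (hex : M'.ShortExact M M'') (R' : Resolution L M') (R : Resolution L M) :
    ∃ S : Resolution L M'', S.euler = R.euler - R'.euler := by
  obtain ⟨f, g, hfg⟩ := hex
  let φ : Psh.Hom (L.psh M') (L.psh M) :=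
    { app := fun A hA => (f.app (op ⟨L.F.obj A, hA⟩)).hom.toAddMonoidHom
      nat := fun {A B} hA hB a m => congrArg (fun z => z.hom m) (f.naturality
        (ObjectProperty.homMk (L.F.map a) : (⟨L.F.obj A, hA⟩ : 𝒯.FullSubcategory) ⟶ ⟨L.F.obj B, hB⟩).op) }
  let π : Psh.Hom (L.psh M) (L.psh M'') :=
    { app := fun A hA => (g.app (op ⟨L.F.obj A, hA⟩)).hom.toAddMonoidHom
      nat := fun {A B} hA hB a m => congrArg (fun z => z.hom m) (g.naturality
        (ObjectProperty.homMk (L.F.map a) : (⟨L.F.obj A, hA⟩ : 𝒯.FullSubcategory) ⟶ ⟨L.F.obj B, hB⟩).op) }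
  obtain ⟨S, hS⟩ := Psh.Res.exists_cone (L.lift_biprod h) φ π (fun A hA => (hfg _).1)
    (fun A hA => (hfg _).2.2) (fun A hA m => (hfg _).2.1 m) R'.toRes R.toRes
  exact ⟨S.toResolution, hS (L.cls 𝒯) L.cls_biprod⟩

/-- The zero module. -/
def zeroMod (𝒯 : ObjectProperty C) : TMod K 𝒯 :=
  TMod.ofActs (fun _ _ => PUnit) (fun _ _ _ => 0) (fun _ _ => rfl) (fun _ _ _ _ _ _ => rfl)
    (fun _ _ _ _ _ => rfl) (fun _ _ _ _ _ => rfl)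

/-- Used to compare two resolutions of M: the cone of a lift of the identity resolves the zero
module. -/
theorem shortExact_zeroMod (M : TMod K 𝒯) : M.ShortExact M (zeroMod 𝒯) := by
  refine ⟨𝟙 _, { app := fun A => ModuleCat.ofHom 0, naturality := fun A B f => ?_ }, fun A => ⟨?_, ?_, ?_⟩⟩
  · ext m
    rfl
  · exact fun _ _ h => h
  · exact fun m => ⟨fun _ => ⟨m, rfl⟩, fun _ => rfl⟩
  · exact fun m => ⟨0, rfl⟩

/-- The Euler characteristic of a resolution is unique. -/
theorem resolution_euler_unique (h : X.IsCT 𝒯) {M : TMod K 𝒯} (R R' : Resolution L M) :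
    R.euler = R'.euler := by
  obtain ⟨S, hS⟩ := exists_resolution_of_shortExact L h (shortExact_zeroMod M) R' R
  have : S.toRes.euler (L.cls 𝒯) = 0 :=
    Psh.euler_eq_zero (L.cls 𝒯) L.cls_biprod (L.lift_biprod h) S.toRes fun _ _ _ => rfl
  rw [S.toRes_euler, hS, sub_eq_zero] at this
  exact this

/-- Representable presheaves. -/
def AlgLift.yo (Z : L.E) : Psh (L.lift 𝒯) where
  val A _ := A ⟶ Z
  act _ _ f := (Preadditive.leftComp Z f)
  act_comp _ _ _ f g m := Category.assoc f g m
  act_add _ _ f g m := Preadditive.add_comp _ _ _ f g m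

/-- The image of `Hom(-, B) ⟶ Hom(-, D)`. -/
def AlgLift.im {B D : L.E} (p : B ⟶ D) : Psh (L.lift 𝒯) where
  val A _ := (Preadditive.rightComp A p).range
  act hA hB f :=
    { toFun := fun m => ⟨f ≫ m.1, by
        obtain ⟨g, hg⟩ := m.2
        exact ⟨f ≫ g, by rw [← hg]; exact Category.assoc f g p⟩⟩
      map_zero' := Subtype.ext comp_zero
      map_add' := fun a b => Subtype.ext (Preadditive.comp_add _ _ _ f a.1 b.1) }
  act_comp _ _ _ f g m := Subtype.ext (Category.assoc f g m.1)
  act_add _ _ f g m := Subtype.ext (Preadditive.add_comp _ _ _ f g m.1)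

/-- An index conflation N ⟶ R ⟶ Z is lifted to E through the isomorphism of Ext groups. On the lift
of 𝒯 it gives a short exact sequence of Hom functors: the deflation induces surjections since Ext(𝒯,
N) = 0, and the inflation induces injections since inflations of E are monomorphisms. The latter can
fail in C, which is why the lift is needed. -/
theorem AlgLift.exists_res_yo (h : X.IsCT 𝒯) (Z : L.E) :
    ∃ R : Psh.Res (L.yo (𝒯 := 𝒯) Z), R.euler (L.cls 𝒯) = indObj h (L.F.obj Z) := by
  obtain ⟨N, R, i, p, hN, hR, δ, hδ⟩ := h.exists_index (L.F.obj Z)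
  have := L.F_essSurj
  let N' := L.F.objPreimage N
  let e : L.F.obj N' ≅ N := L.F.objObjPreimageIso N
  obtain ⟨ε, hε⟩ := (L.extEquiv Z N').surjective (X.push e.inv δ)
  obtain ⟨R', i', p', hE⟩ := L.XE.exists_realizes ε
  have hF := L.realizes _ _ _ hE
  rw [hε] at hF
  have hc := Extri.realizes_of_iso_ends hδ e (Iso.refl _)
  rw [Iso.refl_inv, X.pull_id] at hc
  obtain ⟨b, -, -⟩ := X.realizes_unique hc hF
  have hN' : 𝒯 (L.F.obj N') := h.of_iso e.symm hN
  have hR' : 𝒯 (L.F.obj R') := h.of_iso b hR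
  obtain ⟨O, hO⟩ := HasZeroObject.zero (C := L.E)
  have hFO : IsZero (L.F.obj O) := L.F.map_isZero hO
  have hmono : Mono i' := L.exact.mono i' ⟨_, _, _, hE⟩
  let obj : ℕ → L.E := fun i => match i with
    | 0 => R'
    | 1 => N'
    | _ + 2 => O
  let d : ∀ i, obj (i + 1) ⟶ obj i := fun i => match i with
    | 0 => i'
    | 1 => 0
    | _ + 2 => 0
  refine ⟨⟨1, obj, fun i => match i with
    | 0 => hR'
    | 1 => hN'
    | _ + 2 => h.of_isZero hFO, fun i hi => ?_, d, p', fun A hA y => ?_, fun A hA a => ?_,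
      fun A hA i a => ?_⟩, ?_⟩
  · match i with
    | 0 => omega
    | 1 => omega
    | i + 2 => exact hO
  · refine (hE.pull_eq_zero_iff y).1 ?_
    apply (L.extEquiv A N').injective
    rw [map_zero]
    exact h.ext_zero hA hN' _
  · show a ≫ p' = 0 ↔ ∃ b : A ⟶ N', b ≫ i' = a
    refine ⟨fun ha => hE.exists_lift a ha, ?_⟩
    rintro ⟨b, rfl⟩
    rw [Category.assoc, hE.comp_zero, comp_zero]
  · match i, a with
    | 0, (a : A ⟶ N') =>
      show a ≫ i' = 0 ↔ ∃ b : A ⟶ O, b ≫ (0 : O ⟶ N') = a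
      constructor
      · intro ha
        exact ⟨0, by rw [zero_comp]; exact ((cancel_mono i').1 (by rw [ha, zero_comp])).symm⟩
      · rintro ⟨b, rfl⟩
        simp
    | 1, (a : A ⟶ O) => exact ⟨fun _ => ⟨0, hO.eq_of_tgt _ _⟩, fun _ => comp_zero⟩
    | i + 2, (a : A ⟶ O) => exact ⟨fun _ => ⟨0, hO.eq_of_tgt _ _⟩, fun _ => comp_zero⟩
  · rw [indObj_eq h hN' hR' ⟨_, hF⟩]
    show ∑ i ∈ Finset.range 2, _ = _
    rw [Finset.sum_range_succ, Finset.sum_range_one, pow_zero, one_smul, pow_one, neg_smul,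
      one_smul, ← sub_eq_add_neg]
    rfl

/-- Resolutions of modules presented by conflations. -/
theorem Pres.exists_resolution (h : X.IsCT 𝒯) {M : TMod K 𝒯} {A B D : C} {δ : X.Ext D A}
    {i : A ⟶ B} {p : B ⟶ D} (hδ : X.Realizes δ i p) (P : Pres M p) :
    ∃ R : Resolution L M, R.euler = indObj h D - indObj h B + indObj h A := by
  have := L.F_essSurj
  have := L.F_full
  let A' := L.F.objPreimage A
  let a : L.F.obj A' ≅ A := L.F.objObjPreimageIso A
  let D' := L.F.objPreimage D
  let dd : D ≅ L.F.obj D' := (L.F.objObjPreimageIso D).symm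
  obtain ⟨ε, hε⟩ := (L.extEquiv D' A').surjective (X.push a.inv (X.pull dd.inv δ))
  obtain ⟨B', i', p', hE⟩ := L.XE.exists_realizes ε
  have hF := L.realizes _ _ _ hE
  rw [hε] at hF
  obtain ⟨b, hb₁, hb₂⟩ := X.realizes_unique hF (Extri.realizes_of_iso_ends hδ a dd)
  have hmono : Mono i' := L.exact.mono i' ⟨_, _, _, hE⟩
  obtain ⟨RA, hRA⟩ := L.exists_res_yo h A'
  obtain ⟨RB, hRB⟩ := L.exists_res_yo h B'
  obtain ⟨RD, hRD⟩ := L.exists_res_yo h D'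
  let φ₁ : Psh.Hom (L.yo (𝒯 := 𝒯) A') (L.yo B') :=
    { app := fun T _ => Preadditive.rightComp T i'
      nat := fun _ _ f m => Category.assoc f m i' }
  let π₁ : Psh.Hom (L.yo (𝒯 := 𝒯) B') (L.im p') :=
    { app := fun T _ => (Preadditive.rightComp T p').rangeRestrict
      nat := fun _ _ f m => Subtype.ext (Category.assoc f m p') }
  let φ₂ : Psh.Hom (L.im (𝒯 := 𝒯) p') (L.yo D') :=
    { app := fun T _ => AddSubgroup.subtype _
      nat := fun _ _ f m => rfl }
  have hadd : ∀ (T : L.E) (hT : 𝒯 (L.F.obj T)) (x y : T ⟶ D'),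
      P.ψ _ hT (L.F.map (x + y) ≫ dd.inv) =
        P.ψ _ hT (L.F.map x ≫ dd.inv) + P.ψ _ hT (L.F.map y ≫ dd.inv) := by
    intro T hT x y
    rw [L.F_add, Preadditive.add_comp, P.add]
  have hnat : ∀ {S T : L.E} (hS : 𝒯 (L.F.obj S)) (hT : 𝒯 (L.F.obj T)) (f : S ⟶ T) (m : T ⟶ D'),
      P.ψ _ hS (L.F.map (f ≫ m) ≫ dd.inv) =
        M.act hS hT (L.F.map f) (P.ψ _ hT (L.F.map m ≫ dd.inv)) := by
    intro S T hS hT f m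
    rw [← P.nat, L.F.map_comp, Category.assoc]
  have hker : ∀ (T : L.E) (hT : 𝒯 (L.F.obj T)) (m : T ⟶ D'),
      P.ψ _ hT (L.F.map m ≫ dd.inv) = 0 ↔ ∃ g : T ⟶ B', g ≫ p' = m := by
    intro T hT m
    rw [P.ker]
    constructor
    · rintro ⟨g, hg⟩
      obtain ⟨g', hg'⟩ := L.F.map_surjective (g ≫ b.inv)
      have h₁ : L.F.map (m - g' ≫ p') = 0 := by
        rw [L.F.map_sub, L.F.map_comp, hg', ← hb₂, Category.assoc, Iso.inv_hom_id_assoc,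
          ← Category.assoc, hg, Category.assoc, Iso.inv_hom_id, Category.comp_id, sub_self]
      -- Maps with the same image in C differ by a map through an object of P, which is projective
      -- and hence lifts along the deflation p'.
      obtain ⟨P', x, y, hP', hxy⟩ := (L.F_zero_iff _).1 h₁
      obtain ⟨z, hz⟩ := (hE.pull_eq_zero_iff y).1 (L.P_proj P' hP' _ _)
      refine ⟨x ≫ z + g', ?_⟩
      rw [Preadditive.add_comp, Category.assoc, hz, ← hxy, sub_add_cancel]
    · rintro ⟨g, rfl⟩
      refine ⟨L.F.map g ≫ b.hom, ?_⟩
      rw [L.F.map_comp, ← hb₂]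
      simp
  have hsurj : ∀ (T : L.E) (hT : 𝒯 (L.F.obj T)) (m : M.val _ hT),
      ∃ x : T ⟶ D', P.ψ _ hT (L.F.map x ≫ dd.inv) = m := by
    intro T hT m
    obtain ⟨y, hy⟩ := P.surj _ hT m
    obtain ⟨x, hx⟩ := L.F.map_surjective (y ≫ dd.hom)
    exact ⟨x, by rw [hx, Category.assoc, Iso.hom_inv_id, Category.comp_id, hy]⟩
  let π₂ : Psh.Hom (L.yo (𝒯 := 𝒯) D') (L.psh M) :=
    { app := fun T hT => AddMonoidHom.mk' (fun x => P.ψ _ hT (L.F.map x ≫ dd.inv)) (hadd T hT)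
      nat := fun {S T} hS hT f m => hnat hS hT f m }
  -- The sequence 0 ⟶ Hom(-, A') ⟶ Hom(-, B') ⟶ Hom(-, D') ⟶ M ⟶ 0 is cut at the image of p', and
  -- the cone construction is applied to the two short exact sequences.
  obtain ⟨S₁, hS₁⟩ := Psh.Res.exists_cone (L.lift_biprod h) φ₁ π₁
    (fun T hT x y hxy => (cancel_mono i').1 hxy)
    (fun T hT => AddMonoidHom.rangeRestrict_surjective _)
    (fun T hT m => by
      constructor
      · intro hm
        exact hE.exists_lift m (congrArg Subtype.val hm)
      · rintro ⟨g, rfl⟩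
        refine Subtype.ext ((Category.assoc _ i' p').trans ?_)
        rw [hE.comp_zero]
        exact comp_zero) RA RB
  obtain ⟨S₂, hS₂⟩ := Psh.Res.exists_cone (L.lift_biprod h) φ₂ π₂
    (fun T hT x y hxy => Subtype.ext hxy)
    hsurj
    (fun T hT m => (hker T hT m).trans
      ⟨fun ⟨g, hg⟩ => ⟨⟨m, g, hg⟩, rfl⟩, fun ⟨⟨_, g, hg⟩, h⟩ => ⟨g, hg.trans h⟩⟩) S₁ RD
  refine ⟨S₂.toResolution, ?_⟩
  rw [S₂.toResolution_euler, hS₂ _ L.cls_biprod, hS₁ _ L.cls_biprod, hRA, hRB, hRD,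
    indObj_iso h a, indObj_iso h b, indObj_iso h dd]
  abel

/-! ### The map `β` -/

/-- Finitely presented stable modules are presented by conflations. -/
theorem TMod.IsFpStable.exists_pres (hF : X.IsFrobenius) {M : TMod K 𝒯} (hM : M.IsFpStable X) :
    ∃ (A B D : C) (δ : X.Ext D A) (i : A ⟶ B) (p : B ⟶ D), X.Realizes δ i p ∧
      Nonempty (Pres M p) := by
  obtain ⟨T₀, T₁, h₀, h₁, f, m, hm⟩ := hM
  obtain ⟨P, q, hP, ⟨A, j, δ, hδ⟩⟩ := hF.enough_proj T₀
  -- Adding a deflation q from a projective turns f into a deflation (q, f). A map lifts along it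
  -- exactly if it lifts along f up to maps through projectives.
  obtain ⟨N, k, -, -, ⟨ε, hε⟩, -⟩ := hδ.desc_deflation f
  refine ⟨_, _, _, ε, k, _, hε, ⟨⟨fun T hT a => M.act hT h₀ a m, ?_, ?_, ?_, ?_⟩⟩⟩
  · exact fun T hT a b => M.act_add hT h₀ a b m
  · exact fun hS hT f a => M.act_comp hS hT h₀ f a m
  · exact fun T hT => (hm T hT).1
  · intro T hT a
    rw [(hm T hT).2]
    constructor
    · rintro ⟨g, Q, x, y, hQ, hxy⟩
      obtain ⟨z, hz⟩ := (hδ.pull_eq_zero_iff y).1 (hQ _ _)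
      refine ⟨biprod.lift (x ≫ z) g, ?_⟩
      rw [biprod.lift_desc, Category.assoc, hz, ← hxy, sub_add_cancel]
    · rintro ⟨g, rfl⟩
      refine ⟨g ≫ biprod.snd, P, g ≫ biprod.fst, q, hP, ?_⟩
      rw [biprod.desc_eq]
      simp

/-- The value -(ind D - ind B + ind A) on a module presented by a conflation does not involve the
lift, so it serves all lifts at once; additivity follows from cones of resolutions over one lift. -/
theorem exists_beta (hC : Extri.IsClusterCategory.{w, v, u, v₁, u₁} X) (h : X.IsCT 𝒯) :
    ∃! φ, Extri.IsBeta.{w, v, u, v₁, u₁} X 𝒯 φ := by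
  obtain ⟨L₀⟩ := hC.algebraic
  have key : ∀ (M : TMod K 𝒯) (hM : M.IsFpStable X), ∃ e : K0 𝒯,
      ∀ L : AlgLift.{w, v, u, v₁, u₁} X, Nonempty (Resolution L M) ∧
        ∀ R : Resolution L M, e = - R.euler := by
    intro M hM
    obtain ⟨A, B, D, δ, i, p, hδ, ⟨P⟩⟩ := hM.exists_pres hC.frobenius
    refine ⟨-(indObj h D - indObj h B + indObj h A), fun L => ?_⟩
    obtain ⟨R, hR⟩ := P.exists_resolution L h hδ
    exact ⟨⟨R⟩, fun R' => by rw [← hR, resolution_euler_unique L h R R']⟩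
  choose e he using key
  let φ : K0Mod (TMod.IsFpStable (𝒯 := 𝒯) X) →+ K0 𝒯 := QuotientAddGroup.lift _
    (FreeAbelianGroup.lift fun M : {M : TMod K 𝒯 // M.IsFpStable X} => e M.1 M.2) (by
      rw [AddSubgroup.closure_le]
      rintro _ ⟨M', M, M'', hex, rfl⟩
      obtain ⟨R'⟩ := (he M'.1 M'.2 L₀).1
      obtain ⟨R⟩ := (he M.1 M.2 L₀).1
      obtain ⟨S, hS⟩ := exists_resolution_of_shortExact L₀ h hex R' R
      rw [SetLike.mem_coe, AddMonoidHom.mem_ker, map_sub, map_sub, FreeAbelianGroup.lift_apply_of,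
        FreeAbelianGroup.lift_apply_of, FreeAbelianGroup.lift_apply_of,
        (he M'.1 M'.2 L₀).2 R', (he M.1 M.2 L₀).2 R, (he M''.1 M''.2 L₀).2 S, hS]
      abel)
  have hφ : ∀ M hM, φ (K0Mod.cls M hM) = e M hM := by
    intro M hM
    show FreeAbelianGroup.lift (fun M : {M : TMod K 𝒯 // M.IsFpStable X} => e M.1 M.2)
      (FreeAbelianGroup.of ⟨M, hM⟩) = _
    rw [FreeAbelianGroup.lift_apply_of]
  refine ⟨φ, fun L M hM => ⟨(he M hM L).1, fun R => by rw [hφ, (he M hM L).2 R]⟩, ?_⟩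
  intro φ' hφ'
  refine QuotientAddGroup.addMonoidHom_ext _ (FreeAbelianGroup.lift_ext _ _ ?_)
  rintro ⟨M, hM⟩
  obtain ⟨R⟩ := (hφ' L₀ M hM).1
  exact ((hφ' L₀ M hM).2 R).trans ((hφ M hM).trans ((he M hM L₀).2 R)).symm

/-- The value of `β` on a module presented by a conflation. -/
theorem beta_eq (hC : Extri.IsClusterCategory.{w, v, u, v₁, u₁} X) (h : X.IsCT 𝒯)
    {M : TMod K 𝒯} (hM : M.IsFpStable X) {A B D : C} {δ : X.Ext D A}
    {i : A ⟶ B} {p : B ⟶ D} (hδ : X.Realizes δ i p) (P : Pres M p) :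
    Extri.beta.{w, v, u, v₁, u₁} X 𝒯 (K0Mod.cls M hM) =
      - (indObj h D - indObj h B + indObj h A) := by
  have hb : Extri.IsBeta.{w, v, u, v₁, u₁} X 𝒯 (Extri.beta.{w, v, u, v₁, u₁} X 𝒯) := by
    have := (exists_beta hC h).exists
    rw [Extri.beta, dif_pos this]
    exact this.choose_spec
  obtain ⟨L⟩ := hC.algebraic
  obtain ⟨R, hR⟩ := P.exists_resolution L h hδ
  rw [(hb L M hM).2 R, hR]

end Beta

/-! ### Nakayama's lemma and actions of division algebras -/

/-- Nakayama's lemma: the one-sided inverses place J in the Jacobson radical, and N is finitely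
generated by finite dimension over K. It will be applied to End(U) acting on Ext(U', U). -/
theorem eq_bot_of_le_span_smul {R V : Type*} [Ring R] [Algebra K R] [AddCommGroup V] [Module K V]
    [FiniteDimensional K V] [Module R V] [IsScalarTower K R V] (J : Set R)
    (hJ : ∀ x ∈ J, ∀ y : R, ∃ z, z * (1 + y * x) = 1) (N : Submodule R V)
    (hN : N ≤ Submodule.span R {v | ∃ x ∈ J, ∃ n ∈ N, v = x • n}) : N = ⊥ := by
  have hfg : N.FG := by
    rw [← Submodule.fg_top, ← Module.finite_def]
    have : Module.Finite K N := FiniteDimensional.finiteDimensional_submodule (N.restrictScalars K)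
    exact Module.Finite.of_restrictScalars_finite K R N
  refine hfg.eq_bot_of_le_jacobson_smul (hN.trans (Submodule.span_le.2 ?_))
  rintro _ ⟨x, hx, n, hn, rfl⟩
  refine Submodule.smul_mem_smul ?_ hn
  rw [← Ideal.jacobson_bot, Ideal.mem_jacobson_iff]
  intro y
  obtain ⟨z, hz⟩ := hJ x hx y
  refine ⟨z, ?_⟩
  rw [Ideal.mem_bot, ← hz]
  noncomm_ring

/-- E/J acts like a division algebra, so the orbit of a nonzero vector is a copy of E/J; induction
applies to the quotient by this orbit. This shows that the divisions in `exch` are exact. -/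
theorem dvd_finrank_of_action {E : Type*} [AddCommGroup E] [Module K E] (J : Submodule K E)
    [FiniteDimensional K (E ⧸ J)] (n : ℕ) : ∀ (V : Type v) [AddCommGroup V] [Module K V]
    [FiniteDimensional K V] (ρ : E →ₗ[K] V →ₗ[K] V) (_ : ∀ e ∈ J, ρ e = 0)
    (_ : ∀ e e', ∃ e'', ρ e ∘ₗ ρ e' = ρ e'') (_ : ∀ e, e ∉ J → ∃ e', ρ e' ∘ₗ ρ e = LinearMap.id)
    (_ : ∃ e, ρ e = LinearMap.id), Module.finrank K V = n →
      Module.finrank K (E ⧸ J) ∣ Module.finrank K V := by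
  induction n using Nat.strong_induction_on with
  | _ n ih =>
  intro V _ _ _ ρ hJ hcomp hinv hone hn
  rcases subsingleton_or_nontrivial V with hV | hV
  · rw [Module.finrank_zero_of_subsingleton (M := V)]
    exact dvd_zero _
  obtain ⟨v, hv⟩ := exists_ne (0 : V)
  let φ : E →ₗ[K] V := ρ.flip v
  have hker : LinearMap.ker φ = J := by
    ext e
    rw [LinearMap.mem_ker, LinearMap.flip_apply]
    refine ⟨fun h => by_contra fun he => ?_, fun he => by rw [hJ e he, LinearMap.zero_apply]⟩
    obtain ⟨e', he'⟩ := hinv e he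
    have := LinearMap.congr_fun he' v
    rw [LinearMap.comp_apply, h, map_zero] at this
    exact hv this.symm
  let N := LinearMap.range φ
  have hNr : Module.finrank K N = Module.finrank K (E ⧸ J) := by
    rw [← (LinearMap.quotKerEquivRange φ).finrank_eq, hker]
  have hstab : ∀ e, N ≤ N.comap (ρ e) := by
    rintro e _ ⟨e', rfl⟩
    obtain ⟨e'', he⟩ := hcomp e e'
    exact ⟨e'', (LinearMap.congr_fun he v).symm⟩
  let ρ' : E →ₗ[K] (V ⧸ N) →ₗ[K] (V ⧸ N) :=
    { toFun := fun e => N.mapQ N (ρ e) (hstab e)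
      map_add' := fun a b => by
        ext x
        simp
      map_smul' := fun r a => by
        ext x
        simp }
  have hsum := N.finrank_quotient_add_finrank
  have hpos : 0 < Module.finrank K N := by
    obtain ⟨e, he⟩ := hone
    have hvN : v ∈ N := ⟨e, by simp [φ, he]⟩
    have : Nontrivial N := ⟨⟨⟨v, hvN⟩, 0, fun h => hv (congrArg Subtype.val h)⟩⟩
    exact Module.finrank_pos
  have := ih (Module.finrank K (V ⧸ N)) (by omega) (V ⧸ N) ρ' (fun e he => by
      ext x
      simp [ρ', hJ e he]) (fun e e' => by
      obtain ⟨e'', he⟩ := hcomp e e'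
      refine ⟨e'', ?_⟩
      ext x
      have := LinearMap.congr_fun he x
      rw [LinearMap.comp_apply] at this
      simp [ρ', this]) (fun e he => by
      obtain ⟨e', he⟩ := hinv e he
      refine ⟨e', ?_⟩
      ext x
      have := LinearMap.congr_fun he x
      rw [LinearMap.comp_apply] at this
      simp [ρ', this]) (by
      obtain ⟨e, he⟩ := hone
      refine ⟨e, ?_⟩
      ext x
      simp [ρ', he]) rfl
  rw [← hsum, hNr]
  exact dvd_add this dvd_rfl

/-! ### Exchange pairs -/

/-- A pair of cluster-tilting subcategories which differ in one indecomposable object, with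
exchange conflations. The notion is symmetric. -/
structure ExPair (X : Extri K C) (𝒰 𝒰' : ObjectProperty C) (U U' : C) where
  ct : X.IsCT 𝒰
  ct' : X.IsCT 𝒰'
  mem : 𝒰 U
  mem' : 𝒰' U'
  indec : Indecomposable U
  indec' : Indecomposable U'
  loc : IsLocalObj K U
  loc' : IsLocalObj K U'
  without_iff : ∀ A, without 𝒰 U A ↔ without 𝒰' U' A
  Um : C
  Up : C
  mem_m : without 𝒰 U Um
  mem_p : without 𝒰 U Up
  im : U ⟶ Um
  pm : Um ⟶ U'
  ip : U' ⟶ Up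
  pp : Up ⟶ U
  δm : X.Ext U' U
  δp : X.Ext U U'
  real_m : X.Realizes δm im pm
  real_p : X.Realizes δp ip pp
  ne_m : δm ≠ 0
  ne_p : δp ≠ 0

namespace ExPair

variable {X : Extri K C} {𝒰 𝒰' : ObjectProperty C} {U U' : C}

/-- The reverse exchange pair. -/
def symm (E : ExPair X 𝒰 𝒰' U U') : ExPair X 𝒰' 𝒰 U' U where
  ct := E.ct'
  ct' := E.ct
  mem := E.mem'
  mem' := E.mem
  indec := E.indec'
  indec' := E.indec
  loc := E.loc'
  loc' := E.loc
  without_iff A := (E.without_iff A).symm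
  Um := E.Up
  Up := E.Um
  mem_m := (E.without_iff _).1 E.mem_p
  mem_p := (E.without_iff _).1 E.mem_m
  im := E.ip
  pm := E.pp
  ip := E.im
  pp := E.pm
  δm := E.δp
  δp := E.δm
  real_m := E.real_p
  real_p := E.real_m
  ne_m := E.ne_p
  ne_p := E.ne_m

theorem isZero_retract {A B : C} (r : Retract A B) (hB : IsZero B) : IsZero A := by
  rw [IsZero.iff_id_eq_zero, ← r.retract, hB.eq_of_tgt r.i 0, zero_comp]

/-- The exchange pair of a mutation. -/
def ofExchange (hidem : IsIdempotentComplete C) (hK : X.IsCompactCat) (h : X.IsCT 𝒰)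
    (hmut : X.IsMutation 𝒰 U U') (ex : X.Exchange 𝒰 U U') :
    ExPair X 𝒰 (mutSub 𝒰 U U') U U' where
  ct := h
  ct' := hmut.ct
  mem := hmut.mem
  mem' := mem_mutSub _ _ _
  indec := hmut.indec
  indec' := hmut.indec'
  loc := isLocalObj_of_mem hidem hK h hmut.mem hmut.indec
  loc' := isLocalObj_of_mem hidem hK hmut.ct (mem_mutSub _ _ _) hmut.indec'
  -- An object of 𝒰 cannot have U' as a summand, as U' in 𝒰 would make δp zero. Conversely, the
  -- induction reduces to indecomposable objects; being local, such an object of the mutated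
  -- subcategory is a summand of an object without U or of U'.
  without_iff A := by
    have hloc := isLocalObj_of_mem hidem hK h hmut.mem hmut.indec
    constructor
    · refine fun hA => ⟨mem_addClosure (Or.inl hA), ?_⟩
      rintro ⟨r⟩
      exact ex.nonsplit_p (h.ext_zero hmut.mem (h.of_retract r hA.1) _)
    · rintro ⟨hA, hA'⟩
      refine hmut.ct.induction hK.finite (Q := fun A => ¬ Nonempty (Retract U' A) → without 𝒰 U A)
        ?_ ?_ ?_ ?_ A hA hA'
      · intro A B e hQ hB
        obtain ⟨h₁, h₂⟩ := hQ fun ⟨r⟩ => hB ⟨r.trans (Retract.ofIso e)⟩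
        exact ⟨h.of_iso e h₁, fun ⟨r⟩ => h₂ ⟨r.trans (Retract.ofIso e.symm)⟩⟩
      · exact fun A hA _ => ⟨h.of_isZero hA, fun ⟨r⟩ => hloc.not_isZero (isZero_retract r hA)⟩
      · intro A B _ _ hA hB hAB
        obtain ⟨h₁, h₂⟩ := hA fun ⟨r⟩ => hAB ⟨r.trans ⟨biprod.inl, biprod.fst, biprod.inl_fst⟩⟩
        obtain ⟨h₃, h₄⟩ := hB fun ⟨r⟩ => hAB ⟨r.trans ⟨biprod.inr, biprod.snd, biprod.inr_snd⟩⟩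
        exact ⟨h.biprod h₁ h₃, fun ⟨r⟩ => (hloc.retract_biprod r).elim h₂ h₄⟩
      · intro A hA hAi hU'
        have hAl := isLocalObj_of_mem hidem hK hmut.ct hA hAi
        obtain ⟨n, Y, hY, ⟨r⟩⟩ := hA
        obtain ⟨i, ⟨s⟩⟩ := hAl.retract_biproduct r
        rcases hY i with hi | hi
        · exact ⟨h.of_retract s hi.1, fun ⟨t⟩ => hi.2 ⟨t.trans s⟩⟩
        · rw [hi] at s
          obtain ⟨e⟩ := Retract.iso_of_indecomposable s hAl.not_isZero hmut.indec'
          exact absurd ⟨Retract.ofIso e.symm⟩ hU'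
  Um := ex.Tm
  Up := ex.Tp
  mem_m := ex.mem_m
  mem_p := ex.mem_p
  im := ex.im
  pm := ex.pm
  ip := ex.ip
  pp := ex.pp
  δm := ex.δm
  δp := ex.δp
  real_m := ex.real_m
  real_p := ex.real_p
  ne_m := ex.nonsplit_m
  ne_p := ex.nonsplit_p

variable (E : ExPair X 𝒰 𝒰' U U')

/-- The approximation property holds because Ext(U', A) vanishes inside 𝒰', so an `ExPair` need not
record it. -/
theorem exists_desc_im {A : C} (hA : without 𝒰 U A) (f : U ⟶ A) : ∃ g, E.im ≫ g = f :=
  (E.real_m.push_eq_zero_iff f).1 (E.ct'.ext_zero E.mem' ((E.without_iff A).1 hA).1 _)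

theorem exists_lift_pp {A : C} (hA : without 𝒰 U A) (f : A ⟶ U) : ∃ g, g ≫ E.pp = f :=
  (E.real_p.pull_eq_zero_iff f).1 (E.ct'.ext_zero ((E.without_iff A).1 hA).1 E.mem' _)

theorem im_mem_rad : E.im ∈ rad K U E.Um := E.loc.mem_rad_from E.mem_m.2 _

theorem pp_mem_rad : E.pp ∈ rad K E.Up U := E.loc.mem_rad_to E.mem_p.2 _

theorem pm_mem_rad : E.pm ∈ rad K E.Um U' := E.symm.pp_mem_rad

theorem ip_mem_rad : E.ip ∈ rad K U' E.Up := E.symm.im_mem_rad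

include E in
theorem without_of_not_iso [IsIdempotentComplete C] {A : C} (hA : 𝒰 A) (hi : Indecomposable A)
    (hne : ¬ Nonempty (A ≅ U)) : without 𝒰 U A := by
  refine ⟨hA, fun ⟨r⟩ => ?_⟩
  obtain ⟨e⟩ := Retract.iso_of_indecomposable r E.loc.not_isZero hi
  exact hne ⟨e.symm⟩

include E in
/-- Induction over the objects of `𝒰`, with `U` separated. -/
theorem induction [IsIdempotentComplete C]
    (hfin : ∀ A : C, FiniteDimensional K ((A ⟶ A) ⧸ rad K A A)) {Q : C → Prop}
    (iso : ∀ A B : C, (A ≅ B) → Q A → Q B)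
    (sum : ∀ A B : C, 𝒰 A → 𝒰 B → Q A → Q B → Q (A ⊞ B))
    (self : Q U) (other : ∀ A : C, without 𝒰 U A → Q A) (A : C) (hA : 𝒰 A) : Q A := by
  refine E.ct.induction hfin iso (fun A hA => other A ⟨E.ct.of_isZero hA, fun ⟨r⟩ =>
    E.loc.not_isZero (isZero_retract r hA)⟩) sum (fun A hA hi => ?_) A hA
  by_cases hne : Nonempty (A ≅ U)
  · exact iso _ _ hne.some.symm self
  · exact other A (E.without_of_not_iso hA hi hne)

/-- There is no loop at `U`: radical endomorphisms of `U` factor through the exchange inflation. -/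
def NoLoop : Prop := ∀ f ∈ rad K U U, ∃ g, E.im ≫ g = f

theorem exists_push_m (δ : X.Ext U' U) : ∃ f : U ⟶ U, X.push f E.δm = δ :=
  E.real_m.exists_push δ (E.ct.ext_zero E.mem_m.1 E.mem _)

theorem exists_pull_m (δ : X.Ext U' U) : ∃ f : U' ⟶ U', X.pull f E.δm = δ :=
  E.real_m.exists_pull δ (E.ct'.ext_zero E.mem' E.symm.mem_p.1 _)

theorem push_ne_zero {f : U ⟶ U} (hf : f ∉ rad K U U) : X.push f E.δm ≠ 0 := by
  intro h
  obtain ⟨s, hs⟩ := E.loc.exists_retraction hf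
  apply E.ne_m
  rw [← X.push_id E.δm, ← hs, X.push_comp, h, map_zero]

/-- Let N be the orbit of δm under radical endomorphisms of U. Without a loop these are sums of
products of two radical maps through 𝒰. Products through objects without U factor through the
exchange inflation and kill δm; products through U send δm into rad · N. Hence N ⊆ rad · N, so N = 0
by Nakayama, and radical endomorphisms extend along the inflation. -/
theorem noLoop_of_noLoopAt [IsIdempotentComplete C]
    (hfin : ∀ A : C, FiniteDimensional K ((A ⟶ A) ⧸ rad K A A))
    [FiniteDimensional K (X.Ext U' U)] (h : NoLoopAt K 𝒰 U) : E.NoLoop := by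
  let V := X.Ext U' U
  let _ : Module (End U) V :=
    { smul := fun f δ => X.push (f : U ⟶ U) δ
      one_smul := fun δ => X.push_id δ
      mul_smul := fun f g δ => X.push_comp (g : U ⟶ U) f δ
      smul_zero := fun f => map_zero _
      smul_add := fun f => map_add _
      add_smul := fun f g δ => X.push_add (f : U ⟶ U) g δ
      zero_smul := fun δ => X.push_zero δ }
  have : IsScalarTower K (End U) V := ⟨fun r f δ => X.push_smul r (f : U ⟶ U) δ⟩
  let N : Submodule (End U) V :=
    { carrier := {δ | ∃ f ∈ rad K U U, X.push f E.δm = δ}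
      zero_mem' := ⟨0, zero_mem _, X.push_zero _⟩
      add_mem' := by
        rintro _ _ ⟨f, hf, rfl⟩ ⟨g, hg, rfl⟩
        exact ⟨f + g, add_mem hf hg, X.push_add _ _ _⟩
      smul_mem' := by
        rintro (c : U ⟶ U) _ ⟨f, hf, rfl⟩
        exact ⟨f ≫ c, mem_rad_comp hf c, X.push_comp _ _ _⟩ }
  let S : Submodule (End U) V :=
    Submodule.span (End U) {v | ∃ x ∈ {x : End U | (x : U ⟶ U) ∈ rad K U U}, ∃ n ∈ N, v = x • n}
  have key : ∀ Z, 𝒰 Z → ∀ a ∈ rad K U Z, ∀ b ∈ rad K Z U, X.push (a ≫ b) E.δm ∈ S := by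
    refine E.induction hfin ?_ ?_ ?_ ?_
    · intro A B e hA a ha b hb
      have := hA (a ≫ e.inv) (mem_rad_comp ha _) (e.hom ≫ b) (comp_mem_rad _ hb)
      simpa using this
    · intro A B _ _ hA hB a ha b hb
      have h₁ := hA (a ≫ biprod.fst) (mem_rad_comp ha _) (biprod.inl ≫ b) (comp_mem_rad _ hb)
      have h₂ := hB (a ≫ biprod.snd) (mem_rad_comp ha _) (biprod.inr ≫ b) (comp_mem_rad _ hb)
      have h₃ : a ≫ b = (a ≫ biprod.fst) ≫ biprod.inl ≫ b + (a ≫ biprod.snd) ≫ biprod.inr ≫ b := by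
        have : a ≫ (biprod.fst ≫ biprod.inl + biprod.snd ≫ biprod.inr) ≫ b = a ≫ b := by
          rw [biprod.total, Category.id_comp]
        rw [← this]
        simp only [Preadditive.add_comp, Preadditive.comp_add, Category.assoc]
      rw [h₃, X.push_add]
      exact add_mem h₁ h₂
    · intro a ha b hb
      exact Submodule.subset_span ⟨b, hb, X.push a E.δm, ⟨a, ha, rfl⟩, X.push_comp _ _ _⟩
    · intro A hA a _ b _
      obtain ⟨g, rfl⟩ := E.exists_desc_im hA a
      rw [X.push_comp, X.push_comp, E.real_m.push_inflation, map_zero, map_zero]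
      exact zero_mem S
  have hN : N = ⊥ := by
    refine eq_bot_of_le_span_smul (K := K) {x : End U | (x : U ⟶ U) ∈ rad K U U} ?_ N ?_
    · intro x hx y
      have hi : IsIso (𝟙 U - (x : U ⟶ U) ≫ (-y : U ⟶ U)) := hx _
      rw [Preadditive.comp_neg, sub_neg_eq_add] at hi
      exact ⟨(inv (𝟙 U + (x : U ⟶ U) ≫ (y : U ⟶ U)) : U ⟶ U), IsIso.hom_inv_id _⟩
    · rintro _ ⟨f, hf, rfl⟩
      have hf2 : f ∈ radPow K 𝒰 2 U U := by
        have := (Submodule.Quotient.mk_eq_zero _).1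
          (h.elim (Submodule.Quotient.mk (⟨f, hf⟩ : rad K U U)) (0 : Irr K 𝒰 U U))
        exact this
      refine Submodule.span_induction (p := fun f _ => X.push f E.δm ∈ S) ?_ ?_ ?_ ?_ hf2
      · rintro _ ⟨Z, a, b, hZ, ha, hb, rfl⟩
        exact key Z hZ a ha b hb
      · rw [X.push_zero]
        exact zero_mem S
      · intro a b _ _ ha hb
        rw [X.push_add]
        exact add_mem ha hb
      · intro r a _ ha
        rw [X.push_smul]
        have : r • X.push a E.δm = (r • (1 : End U)) • (X.push a E.δm : V) := by
          rw [smul_assoc, one_smul]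
        rw [this]
        exact S.smul_mem _ ha
  intro f hf
  refine (E.real_m.push_eq_zero_iff f).1 ?_
  have : X.push f E.δm ∈ N := ⟨f, hf, rfl⟩
  rw [hN] at this
  exact this

variable {E}

/-- The property passes from U to U' through Ext(U', U), which δm generates on both sides: pulling
δm along f equals pushing it along some g. If g were not radical, it would split, and some 1 - f ≫ k
would kill δm, though it is invertible. -/
theorem NoLoop.exists_lift_pm (h : E.NoLoop) {f : U' ⟶ U'} (hf : f ∈ rad K U' U') :
    ∃ g, g ≫ E.pm = f := by
  refine (E.real_m.pull_eq_zero_iff f).1 ?_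
  obtain ⟨g, hg⟩ := E.exists_push_m (X.pull f E.δm)
  by_cases hgr : g ∈ rad K U U
  · obtain ⟨g', rfl⟩ := h g hgr
    rw [← hg, X.push_comp, E.real_m.push_inflation, map_zero]
  · exfalso
    obtain ⟨s, hs⟩ := E.loc.exists_retraction hgr
    obtain ⟨k, hk⟩ := E.exists_pull_m (X.push s E.δm)
    have h₁ : X.pull (f ≫ k) E.δm = E.δm := by
      rw [X.pull_comp, hk, ← X.push_pull, ← hg, ← X.push_comp, hs, X.push_id]
    have h₂ : IsIso (𝟙 U' - f ≫ k) := hf k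
    have h₃ : X.pull (𝟙 U' - f ≫ k) E.δm = 0 := by rw [X.pull_sub, X.pull_id, h₁, sub_self]
    apply E.ne_m
    rw [← X.pull_id E.δm, ← IsIso.inv_hom_id (𝟙 U' - f ≫ k), X.pull_comp, h₃, map_zero]

/-- A radical endomorphism of U' lifts to `E.Um`, and the resulting map U' ⟶ `E.Um` extends along
`E.ip` since `E.Um` avoids U'. -/
theorem NoLoop.symm (h : E.NoLoop) : E.symm.NoLoop := by
  intro f hf
  obtain ⟨g, rfl⟩ := h.exists_lift_pm hf
  obtain ⟨k, rfl⟩ := E.symm.exists_desc_im E.symm.mem_p g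
  exact ⟨k ≫ E.pm, (Category.assoc _ _ _).symm⟩

/-- `End(U)/rad` is identified with `Ext(U', U)`. -/
theorem NoLoop.dimD_eq_finrank (h : E.NoLoop) : dimD K U = Module.finrank K (X.Ext U' U) := by
  let φ : (U ⟶ U) →ₗ[K] X.Ext U' U :=
    { toFun := fun f => X.push f E.δm
      map_add' := fun f g => X.push_add f g _
      map_smul' := fun r f => X.push_smul r f _ }
  have hker : LinearMap.ker φ = rad K U U := by
    ext f
    refine ⟨fun hf => by_contra fun hr => E.push_ne_zero hr hf, fun hf => ?_⟩
    obtain ⟨g, rfl⟩ := h f hf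
    exact (E.real_m.push_eq_zero_iff _).2 ⟨g, rfl⟩
  rw [dimD, ← hker]
  exact (LinearMap.quotKerEquivOfSurjective φ E.exists_push_m).finrank_eq

/-- Acting on δm from the other side identifies Ext(U', U) with the residue algebra of U' as well.
-/
theorem NoLoop.dimD_eq (h : E.NoLoop) : dimD K U' = dimD K U := by
  rw [h.dimD_eq_finrank]
  let φ : (U' ⟶ U') →ₗ[K] X.Ext U' U :=
    { toFun := fun f => X.pull f E.δm
      map_add' := fun f g => X.pull_add f g _
      map_smul' := fun r f => X.pull_smul r f _ }
  have hker : LinearMap.ker φ = rad K U' U' := by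
    ext f
    refine ⟨fun hf => by_contra fun hr => ?_, fun hf => ?_⟩
    · obtain ⟨s, hs⟩ := E.loc'.exists_section hr
      apply E.ne_m
      have hf' : X.pull f E.δm = 0 := hf
      rw [← X.pull_id E.δm, ← hs, X.pull_comp, hf', map_zero]
    · exact (E.real_m.pull_eq_zero_iff _).2 (h.exists_lift_pm hf)
  rw [dimD, ← hker]
  exact (LinearMap.quotKerEquivOfSurjective φ E.exists_pull_m).finrank_eq

/-- Radical morphisms from `U` to `𝒰` factor through the exchange inflation. -/
theorem NoLoop.exists_desc (h : E.NoLoop) [IsIdempotentComplete C]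
    (hfin : ∀ A : C, FiniteDimensional K ((A ⟶ A) ⧸ rad K A A)) (Z : C) (hZ : 𝒰 Z) :
    ∀ f ∈ rad K U Z, ∃ g, E.im ≫ g = f := by
  refine E.induction hfin (Q := fun Z => ∀ f ∈ rad K U Z, ∃ g, E.im ≫ g = f) ?_ ?_ h
    (fun A hA f _ => E.exists_desc_im hA f) Z hZ
  · intro A B e hA f hf
    obtain ⟨g, hg⟩ := hA (f ≫ e.inv) (mem_rad_comp hf _)
    exact ⟨g ≫ e.hom, by rw [← Category.assoc, hg, Category.assoc, e.inv_hom_id, Category.comp_id]⟩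
  · intro A B _ _ hA hB f hf
    obtain ⟨g, hg⟩ := hA (f ≫ biprod.fst) (mem_rad_comp hf _)
    obtain ⟨g', hg'⟩ := hB (f ≫ biprod.snd) (mem_rad_comp hf _)
    exact ⟨biprod.lift g g', by ext <;> simp [hg, hg']⟩

/-- Radical morphisms from `𝒰` to `U` factor through the exchange deflation. -/
theorem NoLoop.exists_lift (h : E.NoLoop) [IsIdempotentComplete C]
    (hfin : ∀ A : C, FiniteDimensional K ((A ⟶ A) ⧸ rad K A A)) (Z : C) (hZ : 𝒰 Z) :
    ∀ f ∈ rad K Z U, ∃ g, g ≫ E.pp = f := by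
  refine E.induction hfin (Q := fun Z => ∀ f ∈ rad K Z U, ∃ g, g ≫ E.pp = f) ?_ ?_
    (fun f hf => h.symm.exists_lift_pm hf) (fun A hA f _ => E.exists_lift_pp hA f) Z hZ
  · intro A B e hA f hf
    obtain ⟨g, hg⟩ := hA (e.hom ≫ f) (comp_mem_rad _ hf)
    exact ⟨e.inv ≫ g, by rw [Category.assoc, hg, e.inv_hom_id_assoc]⟩
  · intro A B _ _ hA hB f hf
    obtain ⟨g, hg⟩ := hA (biprod.inl ≫ f) (comp_mem_rad _ hf)
    obtain ⟨g', hg'⟩ := hB (biprod.inr ≫ f) (comp_mem_rad _ hf)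
    exact ⟨biprod.desc g g', by ext <;> simp [hg, hg']⟩

/-! ### Irreducible morphisms -/

/-- Precomposition with the exchange inflation maps Hom(Um, V) onto irr(U, V). Maps in rad² factor
as the inflation followed by a radical map, and two maps with the same composite differ by one
through the radical map `E.pm`. So the kernel is rad(Um, V). -/
theorem NoLoop.finrank_irr_from (h : E.NoLoop) [IsIdempotentComplete C]
    (hfin : ∀ A : C, FiniteDimensional K ((A ⟶ A) ⧸ rad K A A)) {V : C} (hV : without 𝒰 U V) :
    Module.finrank K (Irr K 𝒰 U V) = topDim K V E.Um := by
  let φ : (E.Um ⟶ V) →ₗ[K] Irr K 𝒰 U V := (Submodule.mkQ _).comp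
    ((Linear.leftComp K V E.im).codRestrict (rad K U V) fun f => mem_rad_comp E.im_mem_rad f)
  have hφ : Function.Surjective φ := by
    rintro ⟨⟨f, hf⟩⟩
    obtain ⟨g, rfl⟩ := E.exists_desc_im hV f
    exact ⟨g, rfl⟩
  have hker : LinearMap.ker φ = rad K E.Um V := by
    ext g
    have h₁ : g ∈ LinearMap.ker φ ↔ E.im ≫ g ∈ radPow K 𝒰 2 U V :=
      Submodule.Quotient.mk_eq_zero _
    rw [h₁]
    constructor
    · intro hg
      have : ∃ k ∈ rad K E.Um V, E.im ≫ k = E.im ≫ g := by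
        refine Submodule.span_induction (p := fun f _ => ∃ k ∈ rad K E.Um V, E.im ≫ k = f)
          ?_ ?_ ?_ ?_ hg
        · rintro _ ⟨Z, a, b, hZ, ha, hb, rfl⟩
          obtain ⟨a', rfl⟩ := h.exists_desc hfin Z hZ a ha
          exact ⟨a' ≫ b, comp_mem_rad _ hb, (Category.assoc _ _ _).symm⟩
        · exact ⟨0, zero_mem _, comp_zero⟩
        · rintro _ _ _ _ ⟨a, ha, rfl⟩ ⟨b, hb, rfl⟩
          exact ⟨a + b, add_mem ha hb, Preadditive.comp_add _ _ _ _ _ _⟩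
        · rintro r _ _ ⟨a, ha, rfl⟩
          exact ⟨r • a, Submodule.smul_mem _ _ ha, Linear.comp_smul _ _ _ _ _ _⟩
      obtain ⟨k, hk, hk'⟩ := this
      obtain ⟨m, hm⟩ := E.real_m.exists_desc (g - k) (by rw [Preadditive.comp_sub, hk', sub_self])
      have : g = E.pm ≫ m + k := by rw [hm, sub_add_cancel]
      rw [this]
      exact add_mem (mem_rad_comp E.pm_mem_rad _) hk
    · intro hg
      exact Submodule.subset_span ⟨_, _, _, E.mem_m.1, E.im_mem_rad, hg, rfl⟩
  rw [topDim, ← hker]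
  exact (LinearMap.quotKerEquivOfSurjective φ hφ).finrank_eq.symm

theorem NoLoop.finrank_irr_to (h : E.NoLoop) [IsIdempotentComplete C]
    (hfin : ∀ A : C, FiniteDimensional K ((A ⟶ A) ⧸ rad K A A)) {V : C} (hV : without 𝒰 U V) :
    Module.finrank K (Irr K 𝒰 V U) = socDim K V E.Up := by
  let φ : (V ⟶ E.Up) →ₗ[K] Irr K 𝒰 V U := (Submodule.mkQ _).comp
    ((Linear.rightComp K V E.pp).codRestrict (rad K V U) fun f => comp_mem_rad f E.pp_mem_rad)
  have hφ : Function.Surjective φ := by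
    rintro ⟨⟨f, hf⟩⟩
    obtain ⟨g, rfl⟩ := E.exists_lift_pp hV f
    exact ⟨g, rfl⟩
  have hker : LinearMap.ker φ = rad K V E.Up := by
    ext g
    have h₁ : g ∈ LinearMap.ker φ ↔ g ≫ E.pp ∈ radPow K 𝒰 2 V U :=
      Submodule.Quotient.mk_eq_zero _
    rw [h₁]
    constructor
    · intro hg
      have : ∃ k ∈ rad K V E.Up, k ≫ E.pp = g ≫ E.pp := by
        refine Submodule.span_induction (p := fun f _ => ∃ k ∈ rad K V E.Up, k ≫ E.pp = f)
          ?_ ?_ ?_ ?_ hg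
        · rintro _ ⟨Z, a, b, hZ, ha, hb, rfl⟩
          obtain ⟨b', rfl⟩ := h.exists_lift hfin Z hZ b hb
          exact ⟨a ≫ b', mem_rad_comp ha _, Category.assoc _ _ _⟩
        · exact ⟨0, zero_mem _, zero_comp⟩
        · rintro _ _ _ _ ⟨a, ha, rfl⟩ ⟨b, hb, rfl⟩
          exact ⟨a + b, add_mem ha hb, Preadditive.add_comp _ _ _ _ _ _⟩
        · rintro r _ _ ⟨a, ha, rfl⟩
          exact ⟨r • a, Submodule.smul_mem _ _ ha, Linear.smul_comp _ _ _ _ _ _⟩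
      obtain ⟨k, hk, hk'⟩ := this
      obtain ⟨m, hm⟩ := E.real_p.exists_lift (g - k) (by rw [Preadditive.sub_comp, hk', sub_self])
      have : g = m ≫ E.ip + k := by rw [hm, sub_add_cancel]
      rw [this]
      exact add_mem (comp_mem_rad _ E.ip_mem_rad) hk
    · intro hg
      exact Submodule.subset_span ⟨_, _, _, E.mem_p.1, hg, E.pp_mem_rad, rfl⟩
  rw [socDim, ← hker]
  exact (LinearMap.quotKerEquivOfSurjective φ hφ).finrank_eq.symm

end ExPair

/-- `d_U` divides the dimension of the spaces of irreducible morphisms from `U`. -/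
theorem dimD_dvd_irr_from {𝒰 : ObjectProperty C} {U V : C} (hU : IsLocalObj K U) (hmem : 𝒰 U)
    (hfin : FiniteDimensional K ((U ⟶ U) ⧸ rad K U U)) [FiniteDimensional K (Irr K 𝒰 U V)] :
    dimD K U ∣ Module.finrank K (Irr K 𝒰 U V) := by
  let S := (radPow K 𝒰 2 U V).submoduleOf (rad K U V)
  let act : (U ⟶ U) → rad K U V →ₗ[K] rad K U V := fun e =>
    (Linear.leftComp K V e).restrict fun f hf => comp_mem_rad e hf
  have hact : ∀ e, S ≤ S.comap (act e) := fun e f hf => radPow_left 𝒰 2 e hf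
  let ρ : (U ⟶ U) →ₗ[K] Irr K 𝒰 U V →ₗ[K] Irr K 𝒰 U V :=
    { toFun := fun e => S.mapQ S (act e) (hact e)
      map_add' := fun a b => by
        ext f
        exact congrArg (Submodule.Quotient.mk (p := S)) (Subtype.ext (Preadditive.add_comp _ _ _ a b f.1))
      map_smul' := fun r a => by
        ext f
        exact congrArg (Submodule.Quotient.mk (p := S)) (Subtype.ext (Linear.smul_comp _ _ _ r a f.1)) }
  have hid : ρ (𝟙 U) = LinearMap.id := by
    ext f
    exact congrArg (Submodule.Quotient.mk (p := S)) (Subtype.ext (Category.id_comp f.1))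
  have hcomp : ∀ e e', ρ e ∘ₗ ρ e' = ρ (e ≫ e') := by
    intro e e'
    ext f
    exact congrArg (Submodule.Quotient.mk (p := S)) (Subtype.ext (Category.assoc e e' f.1).symm)
  refine dvd_finrank_of_action (rad K U U) _ (Irr K 𝒰 U V) ρ ?_ (fun e e' => ⟨_, hcomp e e'⟩) ?_
    ⟨_, hid⟩ rfl
  · intro e he
    ext f
    exact (Submodule.Quotient.mk_eq_zero S).2 (Submodule.subset_span ⟨U, e, f.1, hmem, he, f.2, rfl⟩)
  · intro e he
    obtain ⟨s, hs⟩ := hU.exists_section he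
    exact ⟨s, by rw [hcomp, hs, hid]⟩

/-- `d_U` divides the dimension of the spaces of irreducible morphisms to `U`. -/
theorem dimD_dvd_irr_to {𝒰 : ObjectProperty C} {U V : C} (hU : IsLocalObj K U) (hmem : 𝒰 U)
    (hfin : FiniteDimensional K ((U ⟶ U) ⧸ rad K U U)) [FiniteDimensional K (Irr K 𝒰 V U)] :
    dimD K U ∣ Module.finrank K (Irr K 𝒰 V U) := by
  let S := (radPow K 𝒰 2 V U).submoduleOf (rad K V U)
  let act : (U ⟶ U) → rad K V U →ₗ[K] rad K V U := fun e =>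
    (Linear.rightComp K V e).restrict fun f hf => mem_rad_comp hf e
  have hact : ∀ e, S ≤ S.comap (act e) := by
    intro e f hf
    have hf' : f.1 ∈ radPow K 𝒰 2 V U := hf
    show f.1 ≫ e ∈ radPow K 𝒰 2 V U
    refine Submodule.span_induction (p := fun f _ => f ≫ e ∈ radPow K 𝒰 2 V U) ?_ ?_ ?_ ?_ hf'
    · rintro _ ⟨Z, a, b, hZ, ha, hb, rfl⟩
      exact Submodule.subset_span ⟨Z, a, b ≫ e, hZ, ha, mem_rad_comp hb e, Category.assoc _ _ _⟩
    · rw [zero_comp]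
      exact zero_mem _
    · intro a b _ _ ha hb
      rw [Preadditive.add_comp]
      exact add_mem ha hb
    · intro r a _ ha
      rw [Linear.smul_comp]
      exact Submodule.smul_mem _ _ ha
  let ρ : (U ⟶ U) →ₗ[K] Irr K 𝒰 V U →ₗ[K] Irr K 𝒰 V U :=
    { toFun := fun e => S.mapQ S (act e) (hact e)
      map_add' := fun a b => by
        ext f
        exact congrArg (Submodule.Quotient.mk (p := S)) (Subtype.ext (Preadditive.comp_add _ _ _ f.1 a b))
      map_smul' := fun r a => by
        ext f
        exact congrArg (Submodule.Quotient.mk (p := S)) (Subtype.ext (Linear.comp_smul _ _ _ f.1 r a)) }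
  have hid : ρ (𝟙 U) = LinearMap.id := by
    ext f
    exact congrArg (Submodule.Quotient.mk (p := S)) (Subtype.ext (Category.comp_id f.1))
  have hcomp : ∀ e e', ρ e ∘ₗ ρ e' = ρ (e' ≫ e) := by
    intro e e'
    ext f
    exact congrArg (Submodule.Quotient.mk (p := S)) (Subtype.ext (Category.assoc f.1 e' e))
  refine dvd_finrank_of_action (rad K U U) _ (Irr K 𝒰 V U) ρ ?_ (fun e e' => ⟨_, hcomp e e'⟩) ?_
    ⟨_, hid⟩ rfl
  · intro e he
    ext f
    exact (Submodule.Quotient.mk_eq_zero S).2 (Submodule.subset_span ⟨U, f.1, e, hmem, f.2, he, rfl⟩)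
  · intro e he
    obtain ⟨s, hs⟩ := hU.exists_retraction he
    exact ⟨s, by rw [hcomp, hs, hid]⟩

/-! ### Duality -/

section Duality

variable {X : Extri K C}

theorem Extri.IsStablyTwoCY.finite_ext (h : X.IsStablyTwoCY) (A B : C) :
    FiniteDimensional K (X.Ext A B) := by
  obtain ⟨S, e, -⟩ := h.two_cy
  have := h.finite (X.toStab.obj A) (S.obj (X.toStab.obj B))
  exact (e A B).finiteDimensional

/-- The kernel of `Ext(T, A) ⟶ Ext(T, B)` is dual to the cokernel of `Ext(B, T) ⟶ Ext(A, T)`. -/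
theorem Extri.IsStablyTwoCY.finrank_ker_push (h : X.IsStablyTwoCY) (hF : X.IsFrobenius) {A B : C}
    (i : A ⟶ B) (T : C) : Module.finrank K (LinearMap.ker (X.push (Z := T) i)) =
      Module.finrank K (X.Ext A T ⧸ LinearMap.range (X.pull (X := T) i)) := by
  obtain ⟨S, e, D, he, hD⟩ := h.two_cy
  have hfin := h.finite
  -- S is only given as a functor. Its linearity and faithfulness are extracted from the natural
  -- isomorphism with Ext, for which each S B must be seen as the image of an object of C.
  have hex : ∀ B : C, ∃ (Z : C) (u : X.toStab.obj Z ⟶ S.obj (X.toStab.obj B)), IsIso u := fun B =>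
    ⟨(S.obj (X.toStab.obj B)).as, 𝟙 _, inferInstance⟩
  have hmap : ∀ {Z B B' : C} (u : X.toStab.obj Z ⟶ S.obj (X.toStab.obj B)) (b : B ⟶ B'),
      u ≫ S.map (X.toStab.map b) = (e Z B').symm (X.push b (e Z B u)) := by
    intro Z B B' u b
    rw [LinearEquiv.eq_symm_apply]
    have := he (𝟙 Z) b u
    rwa [X.toStab.map_id, Category.id_comp, X.pull_id] at this
  let SL : ∀ P Q : C, (X.toStab.obj P ⟶ X.toStab.obj Q) →ₗ[K]
      (S.obj (X.toStab.obj P) ⟶ S.obj (X.toStab.obj Q)) := fun P Q =>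
    { toFun := fun f => S.map f
      map_add' := fun f g => by
        obtain ⟨f, rfl⟩ := X.toStab.map_surjective f
        obtain ⟨g, rfl⟩ := X.toStab.map_surjective g
        obtain ⟨Z, u, hu⟩ := hex P
        rw [← cancel_epi u, Preadditive.comp_add, ← Functor.map_add, hmap, hmap, hmap, X.push_add,
          map_add]
      map_smul' := fun r f => by
        obtain ⟨f, rfl⟩ := X.toStab.map_surjective f
        obtain ⟨Z, u, hu⟩ := hex P
        have : r • X.toStab.map f = X.toStab.map (r • f) := rfl
        rw [← cancel_epi u, RingHom.id_apply, Linear.comp_smul, this, hmap, hmap, X.push_smul,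
          map_smul] }
  have hinj : ∀ P Q, Function.Injective (SL P Q) := by
    intro P Q
    rw [injective_iff_map_eq_zero]
    intro f hf
    obtain ⟨f, rfl⟩ := X.toStab.map_surjective f
    obtain ⟨J, j, hJ, ⟨R, q, δ, hδ⟩⟩ := hF.enough_inj P
    have h₁ : X.push f δ = 0 := by
      obtain ⟨u, rfl⟩ := (e R P).surjective δ
      rw [← (e R Q).apply_symm_apply (X.push f (e R P u)), ← hmap]
      have : S.map (X.toStab.map f) = 0 := hf
      rw [this, comp_zero, map_zero]
    obtain ⟨g, hg⟩ := (hδ.push_eq_zero_iff f).1 h₁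
    refine (CategoryTheory.Quotient.functor_map_eq_iff X.stabRel f 0).2 ?_
    exact ⟨J, j, g, (hF.proj_iff_inj J).2 hJ, by rw [sub_zero, hg]⟩
  have hrank : ∀ P Q : X.Stab, Module.finrank K (P ⟶ Q) =
      Module.finrank K (Q ⟶ S.obj (S.obj P)) := by
    intro P Q
    rw [(D P Q).finrank_eq, Subspace.dual_finrank_eq]
  -- S is full by a dimension count: dim Hom(P, Q) ≤ dim Hom(SP, SQ) ≤ dim Hom(SSP, SSQ), and the
  -- outer terms agree by duality applied twice.
  have hbij : ∀ P Q, Function.Bijective (SL P Q) := by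
    intro P Q
    have h₁ := LinearMap.finrank_le_finrank_of_injective (hinj P Q)
    have h₂ := LinearMap.finrank_le_finrank_of_injective
      (hinj (S.obj (X.toStab.obj P)).as (S.obj (X.toStab.obj Q)).as)
    have h₃ := (hrank (X.toStab.obj P) (X.toStab.obj Q)).trans
      (hrank (X.toStab.obj Q) (S.obj (S.obj (X.toStab.obj P))))
    have h₄ : Module.finrank K (X.toStab.obj P ⟶ X.toStab.obj Q) =
        Module.finrank K (S.obj (X.toStab.obj P) ⟶ S.obj (X.toStab.obj Q)) :=
      le_antisymm h₁ (h₂.trans h₃.ge)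
    exact ⟨hinj P Q, (LinearMap.injective_iff_surjective_of_finrank_eq_finrank h₄).1 (hinj P Q)⟩
  let a := X.toStab.obj A
  let b := X.toStab.obj B
  let t := X.toStab.obj T
  let t' : C := (S.obj t).as
  let si : S.obj a ⟶ S.obj b := S.map (X.toStab.map i)
  -- Identify Ext(A, T) = Hom(a, S t) with Hom(S a, S S t). Then R is the image of Ext(B, T), and
  -- under duality the kernel in Ext(T, A) = Hom(t, S a) is the annihilator of R.
  let R : Submodule K (S.obj a ⟶ S.obj (S.obj t)) :=
    LinearMap.range (Linear.leftComp K (S.obj (S.obj t)) si)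
  let Φ : X.Ext T A ≃ₗ[K] Module.Dual K (S.obj a ⟶ S.obj (S.obj t)) :=
    (e T A).symm.trans (D t (S.obj a))
  let Ψ : X.Ext A T ≃ₗ[K] (S.obj a ⟶ S.obj (S.obj t)) :=
    (e A T).symm.trans (LinearEquiv.ofBijective (SL A t') (hbij A t'))
  have hΦ : (LinearMap.ker (X.push (Z := T) i)).map (Φ : X.Ext T A →ₗ[K] _) = R.dualAnnihilator := by
    have key : ∀ f : t ⟶ S.obj a, X.push i (e T A f) = 0 ↔ D t (S.obj a) f ∈ R.dualAnnihilator := by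
      intro f
      have h₁ : X.push i (e T A f) = 0 ↔ f ≫ si = 0 := by
        show _ ↔ f ≫ S.map (X.toStab.map i) = 0
        rw [hmap, LinearEquiv.map_eq_zero_iff]
      have h₂ : f ≫ si = 0 ↔ D t (S.obj b) (f ≫ si) = 0 := (LinearEquiv.map_eq_zero_iff _).symm
      have h₃ : ∀ g : S.obj b ⟶ S.obj (S.obj t), D t (S.obj b) (f ≫ si) g = D t (S.obj a) f (si ≫ g) := by
        intro g
        have := hD (𝟙 t) f si g
        simpa using this
      rw [h₁, h₂, Submodule.mem_dualAnnihilator]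
      constructor
      · rintro hz _ ⟨g, rfl⟩
        exact (h₃ g).symm.trans (by rw [hz]; rfl)
      · intro hz
        ext g
        rw [h₃]
        exact hz _ ⟨g, rfl⟩
    ext d
    constructor
    · rintro ⟨δ, hδ, rfl⟩
      obtain ⟨f, rfl⟩ := (e T A).surjective δ
      have := (key f).1 hδ
      simpa [Φ] using this
    · intro hd
      obtain ⟨f, rfl⟩ := (D t (S.obj a)).surjective d
      refine ⟨e T A f, (key f).2 hd, ?_⟩
      simp [Φ]
  have hΨ : (LinearMap.range (X.pull (X := T) i)).map (Ψ : X.Ext A T →ₗ[K] _) = R := by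
    have key : ∀ g : b ⟶ S.obj t, Ψ (X.pull i (e B T g)) = si ≫ S.map g := by
      intro g
      have h₁ : X.pull i (e B T g) = e A T (X.toStab.map i ≫ g) := by
        have := he i (𝟙 T) g
        rw [X.push_id, X.toStab.map_id, S.map_id, Category.comp_id] at this
        exact this.symm
      rw [h₁]
      show S.map ((e A T).symm (e A T (X.toStab.map i ≫ g))) = _
      rw [LinearEquiv.symm_apply_apply, S.map_comp]
    ext r
    constructor
    · rintro ⟨_, ⟨ε, rfl⟩, rfl⟩
      obtain ⟨g, rfl⟩ := (e B T).surjective ε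
      exact ⟨S.map g, (key g).symm⟩
    · rintro ⟨g, rfl⟩
      obtain ⟨g, rfl⟩ := (hbij B t').2 g
      exact ⟨_, ⟨e B T g, rfl⟩, key g⟩
  have h₁ := LinearEquiv.finrank_map_eq Φ (LinearMap.ker (X.push (Z := T) i))
  have h₂ := (Submodule.Quotient.equiv _ _ Ψ hΨ).finrank_eq
  rw [hΦ] at h₁
  rw [← h₁, h₂]
  have h₃ := Subspace.finrank_add_finrank_dualAnnihilator_eq R
  have h₄ := R.finrank_quotient_add_finrank
  omega

end Duality

namespace ExPair

variable {X : Extri K C} {𝒰 𝒰' : ObjectProperty C} {U U' : C} (E : ExPair X 𝒰 𝒰' U U')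

/-! ### Coresolutions of rigid objects -/

-- Suppose U is a summand of both L and N. As Ext(T, T) = 0, the map L ⟶ U ⟶ N becomes a sum of a
-- map through p on the right and one through p on the left. Its component at U is the identity, so
-- by locality p has an invertible component U ⟶ U. This component is cancelled, and the count of U
-- in L drops.
include E in
theorem exists_cores [IsIdempotentComplete C]
    (hfin : ∀ A : C, FiniteDimensional K ((A ⟶ A) ⧸ rad K A A)) {T : C}
    (hT : ∀ δ : X.Ext T T, δ = 0) : ∃ R : Cores X 𝒰 T,
      ¬ Nonempty (Retract U R.L) ∨ ¬ Nonempty (Retract U R.N) := by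
  suffices H : ∀ (n : ℕ) (R : Cores X 𝒰 T), topDim K U R.L = n → ∃ R : Cores X 𝒰 T,
      ¬ Nonempty (Retract U R.L) ∨ ¬ Nonempty (Retract U R.N) from H _ (E.ct.cores T) rfl
  intro n
  induction n using Nat.strong_induction_on with
  | _ n ih =>
  intro R hR
  by_contra hno
  push Not at hno
  obtain ⟨⟨r⟩, ⟨s⟩⟩ := hno R
  obtain ⟨s₁, hs₁⟩ := (R.real.pull_eq_zero_iff (R.i ≫ r.r ≫ s.i)).1 (hT _)
  obtain ⟨s₂, hs₂⟩ := (R.real.push_eq_zero_iff s₁).1 (E.ct.ext_zero R.memN R.memL _)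
  obtain ⟨t, ht⟩ := R.real.exists_desc (r.r ≫ s.i - s₂ ≫ R.p) (by
    rw [Preadditive.comp_sub, ← Category.assoc R.i s₂, hs₂, hs₁, sub_self])
  have hid : 𝟙 U = (r.i ≫ s₂) ≫ R.p ≫ s.r + r.i ≫ R.p ≫ t ≫ s.r := by
    have : r.r ≫ s.i = s₂ ≫ R.p + R.p ≫ t := by rw [ht]; abel
    have h₁ : r.i ≫ (r.r ≫ s.i) ≫ s.r = 𝟙 U := by
      rw [Category.assoc, s.retract, Category.comp_id, r.retract]
    rw [← h₁, this]
    simp only [Preadditive.add_comp, Preadditive.comp_add, Category.assoc]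
  have hex : ∃ (α : U ⟶ R.L) (β : R.N ⟶ U), α ≫ R.p ≫ β = 𝟙 U := by
    by_cases h₁ : (r.i ≫ s₂) ≫ R.p ≫ s.r ∈ rad K U U
    · have h₂ : r.i ≫ R.p ≫ t ≫ s.r ∉ rad K U U := fun h₂ =>
        E.loc.id_notMem (hid ▸ add_mem h₁ h₂)
      obtain ⟨q, hq⟩ := E.loc.exists_retraction h₂
      exact ⟨r.i, t ≫ s.r ≫ q, by simpa using hq⟩
    · obtain ⟨q, hq⟩ := E.loc.exists_retraction h₁
      exact ⟨r.i ≫ s₂, s.r ≫ q, by simpa using hq⟩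
  obtain ⟨α, β, hαβ⟩ := hex
  -- N' is the complement in R.N of the copy of U hit isomorphically through p. The class of R is
  -- pulled back from N', so the coresolution is that of N' plus the trivial conflation 0 ⟶ U = U.
  obtain ⟨N', j, q, hβj, hjq, hqβ⟩ : ∃ (N' : C) (j : N' ⟶ R.N) (q : R.N ⟶ N'), j ≫ β = 0 ∧
      j ≫ q = 𝟙 N' ∧ q ≫ j + β ≫ α ≫ R.p = 𝟙 R.N := by
    have hidem : (𝟙 R.N - β ≫ α ≫ R.p) ≫ (𝟙 R.N - β ≫ α ≫ R.p) = 𝟙 R.N - β ≫ α ≫ R.p := by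
      have : (β ≫ α ≫ R.p) ≫ β ≫ α ≫ R.p = β ≫ α ≫ R.p := by
        have : β ≫ (α ≫ R.p ≫ β) ≫ α ≫ R.p = β ≫ α ≫ R.p := by rw [hαβ, Category.id_comp]
        simpa using this
      rw [Preadditive.sub_comp, Preadditive.comp_sub, Preadditive.comp_sub, this]
      simp
    obtain ⟨N', j, q, h₁, h₂⟩ := IsIdempotentComplete.idempotents_split _ _ hidem
    refine ⟨N', j, q, ?_, h₁, by rw [h₂, sub_add_cancel]⟩
    have : j ≫ β = j ≫ (q ≫ j) ≫ β := by
      rw [Category.assoc, ← Category.assoc j q, h₁, Category.id_comp]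
    rw [this, h₂, Preadditive.sub_comp, Category.assoc, Category.assoc, hαβ]
    simp
  obtain ⟨M, x, y, hM⟩ := X.exists_realizes (X.pull j R.δ)
  have hδ : X.pull q (X.pull j R.δ) = R.δ := by
    rw [← X.pull_comp]
    have h₀ : X.pull (β ≫ α ≫ R.p) R.δ = 0 := by
      rw [X.pull_comp, X.pull_comp, R.real.pull_deflation, map_zero, map_zero]
    rw [← add_zero (X.pull (q ≫ j) R.δ), ← h₀, ← X.pull_add, hqβ, X.pull_id]
  have hpq : (α ≫ R.p) ≫ q = 0 := by
    have h₁ : (q ≫ j + β ≫ α ≫ R.p) ≫ q = q := by rw [hqβ, Category.id_comp]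
    rw [Preadditive.add_comp, Category.assoc, hjq, Category.comp_id] at h₁
    have h₂ : β ≫ (α ≫ R.p) ≫ q = 0 := by
      have := add_eq_left.1 h₁
      simpa using this
    have h₃ : (α ≫ R.p ≫ β) ≫ (α ≫ R.p) ≫ q = 0 := by
      rw [Category.assoc, Category.assoc, h₂, comp_zero, comp_zero]
    rwa [hαβ, Category.id_comp] at h₃
  rw [Category.assoc] at hpq
  let d : N' ⊞ U ≅ R.N :=
    { hom := biprod.desc j (α ≫ R.p)
      inv := biprod.lift q β
      hom_inv_id := by ext <;> simp [hjq, hβj, hpq, hαβ]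
      inv_hom_id := by rw [biprod.lift_desc]; exact hqβ }
  obtain ⟨O, hO⟩ := HasZeroObject.zero (C := C)
  have hsum := X.realizes_sum hM (show X.Realizes (0 : X.Ext U O) (0 : O ⟶ U) (𝟙 U) from
    Extri.realizes_split _ _ 0 (𝟙 U) (hO.eq_of_tgt _ _) (by simp) (by simp) (by simp))
  have h₁ := Extri.realizes_of_iso_ends hsum (biprodZeroIso T hO) d
  have h₂ : X.push (biprodZeroIso T hO).inv (X.pull d.inv
      (X.push biprod.inl (X.pull biprod.fst (X.pull j R.δ)) +
        X.push biprod.inr (X.pull biprod.snd (0 : X.Ext U O)))) = R.δ := by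
    have h₃ : biprod.inl ≫ (biprodZeroIso T hO).inv = 𝟙 T := by simp [biprodZeroIso]
    have h₄ : d.inv ≫ biprod.fst = q := by simp [d]
    rw [map_zero, map_zero, add_zero, X.push_pull, ← X.push_comp, h₃, X.push_id, ← X.pull_comp,
      h₄, hδ]
  rw [h₂] at h₁
  obtain ⟨b, -, -⟩ := X.realizes_unique R.real h₁
  have hMm : 𝒰 M := E.ct.of_retract ⟨biprod.inl ≫ b.inv, b.hom ≫ biprod.fst, by simp⟩ R.memL
  have hNm : 𝒰 N' := E.ct.of_retract ⟨j, q, hjq⟩ R.memN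
  have hlt : topDim K U M < n := by
    rw [← hR, topDim_biprod hfin U b]
    exact Nat.lt_add_of_pos_right (dimD_pos hfin E.loc)
  obtain ⟨R', hR'⟩ := ih _ hlt ⟨M, N', x, y, _, hMm, hNm, hM⟩ rfl
  obtain ⟨⟨r'⟩, ⟨s'⟩⟩ := hno R'
  exact hR'.elim (fun h => h ⟨r'⟩) (fun h => h ⟨s'⟩)

include E in
theorem topDim_without {A : C} (hA : without 𝒰 U A) : topDim K U A = 0 :=
  topDim_eq_zero (E.loc.mem_rad_to hA.2)

include E in
theorem topDim_self_without {V : C} (hV : without 𝒰 U V) : topDim K V U = 0 :=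
  topDim_eq_zero (E.loc.mem_rad_from hV.2)

include E in
theorem socDim_without {A : C} (hA : without 𝒰 U A) : socDim K U A = 0 :=
  socDim_eq_zero (E.loc.mem_rad_from hA.2)

include E in
theorem without_biprod {A B : C} (hA : without 𝒰 U A) (hB : without 𝒰 U B) :
    without 𝒰 U (A ⊞ B) :=
  ⟨E.ct.biprod hA.1 hB.1, fun ⟨r⟩ => (E.loc.retract_biprod r).elim hA.2 hB.2⟩

include E in
theorem without_of_isZero {A : C} (hA : IsZero A) : without 𝒰 U A :=
  ⟨E.ct.of_isZero hA, fun ⟨r⟩ => E.loc.not_isZero (isZero_retract r hA)⟩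

/-- Resolution of an object of `𝒰` in `𝒰'`. -/
theorem exists_plus [IsIdempotentComplete C]
    (hfin : ∀ A : C, FiniteDimensional K ((A ⟶ A) ⧸ rad K A A)) (N : C) (hN : 𝒰 N) :
    ∃ (a : ℕ) (N₁ Np : C) (i : N₁ ⟶ Np) (p : Np ⟶ N), X.Conflation i p ∧ 𝒰' N₁ ∧
      without 𝒰 U Np ∧ topDim K U N = a * dimD K U ∧ socDim K U N = a * dimD K U ∧
      topDim K U' N₁ = a * dimD K U' ∧ ∀ V, without 𝒰 U V →
        topDim K V N₁ = 0 ∧ topDim K V Np = topDim K V N + a * topDim K V E.Up := by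
  refine E.induction hfin (Q := fun N => ∃ (a : ℕ) (N₁ Np : C) (i : N₁ ⟶ Np) (p : Np ⟶ N),
      X.Conflation i p ∧ 𝒰' N₁ ∧ without 𝒰 U Np ∧ topDim K U N = a * dimD K U ∧
      socDim K U N = a * dimD K U ∧ topDim K U' N₁ = a * dimD K U' ∧ ∀ V, without 𝒰 U V →
        topDim K V N₁ = 0 ∧ topDim K V Np = topDim K V N + a * topDim K V E.Up) ?_ ?_ ?_ ?_ N hN
  · rintro A B e ⟨a, N₁, Np, i, p, hc, h₁, h₂, h₃, h₄, h₅, h₆⟩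
    have hc' := hc.of_iso_ends (Iso.refl _) e
    refine ⟨a, N₁, Np, _, _, hc', h₁, h₂, by rw [← topDim_iso e, h₃], by rw [← socDim_iso e, h₄], h₅,
      fun V hV => ?_⟩
    rw [← topDim_iso (V := V) e]
    exact h₆ V hV
  · rintro A B _ _ ⟨a, N₁, Np, i, p, hc, h₁, h₂, h₃, h₄, h₅, h₆⟩
      ⟨a', N₁', Np', i', p', hc', h₁', h₂', h₃', h₄', h₅', h₆'⟩
    refine ⟨a + a', _, _, _, _, hc.biprod hc', E.ct'.biprod h₁ h₁', E.without_biprod h₂ h₂', ?_, ?_,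
      ?_, fun V hV => ⟨?_, ?_⟩⟩
    · rw [topDim_biprod hfin U (Iso.refl _), h₃, h₃', add_mul]
    · rw [socDim_biprod hfin, h₄, h₄', add_mul]
    · rw [topDim_biprod hfin U' (Iso.refl _), h₅, h₅', add_mul]
    · rw [topDim_biprod hfin V (Iso.refl _), (h₆ V hV).1, (h₆' V hV).1]
    · rw [topDim_biprod hfin V (Iso.refl _), topDim_biprod hfin V (Iso.refl (A ⊞ B)),
        (h₆ V hV).2, (h₆' V hV).2]
      ring
  · refine ⟨1, U', E.Up, E.ip, E.pp, ⟨_, E.real_p⟩, E.mem', E.mem_p, (one_mul _).symm,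
      (one_mul _).symm, (one_mul _).symm, fun V hV => ⟨?_, ?_⟩⟩
    · exact E.symm.topDim_self_without ((E.without_iff V).1 hV)
    · rw [E.topDim_self_without hV, one_mul, zero_add]
  · intro A hA
    obtain ⟨O, hO⟩ := HasZeroObject.zero (C := C)
    refine ⟨0, O, A, 0, 𝟙 A, Extri.conflation_zero_id A hO, E.ct'.of_isZero hO, hA, ?_, ?_, ?_,
      fun V hV => ⟨?_, by rw [zero_mul, add_zero]⟩⟩
    · rw [zero_mul, E.topDim_without hA]
    · rw [zero_mul, E.socDim_without hA]
    · rw [zero_mul, E.symm.topDim_without (E.symm.without_of_isZero hO)]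
    · refine topDim_eq_zero fun f => ?_
      rw [hO.eq_of_src f 0]
      exact zero_mem _

/-- Coresolution of an object of `𝒰` in `𝒰'`. -/
theorem exists_minus [IsIdempotentComplete C]
    (hfin : ∀ A : C, FiniteDimensional K ((A ⟶ A) ⧸ rad K A A)) (L : C) (hL : 𝒰 L) :
    ∃ (a : ℕ) (Lm L₁ : C) (i : L ⟶ Lm) (p : Lm ⟶ L₁), X.Conflation i p ∧ 𝒰' L₁ ∧
      without 𝒰 U Lm ∧ topDim K U L = a * dimD K U ∧
      topDim K U' L₁ = a * dimD K U' ∧ ∀ V, without 𝒰 U V →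
        topDim K V L₁ = 0 ∧ topDim K V Lm = topDim K V L + a * topDim K V E.Um := by
  refine E.induction hfin (Q := fun L => ∃ (a : ℕ) (Lm L₁ : C) (i : L ⟶ Lm) (p : Lm ⟶ L₁),
      X.Conflation i p ∧ 𝒰' L₁ ∧ without 𝒰 U Lm ∧ topDim K U L = a * dimD K U ∧
      topDim K U' L₁ = a * dimD K U' ∧ ∀ V, without 𝒰 U V →
        topDim K V L₁ = 0 ∧ topDim K V Lm = topDim K V L + a * topDim K V E.Um) ?_ ?_ ?_ ?_ L hL
  · rintro A B e ⟨a, Lm, L₁, i, p, hc, h₁, h₂, h₃, h₅, h₆⟩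
    have hc' := hc.of_iso_ends e.symm (Iso.refl _)
    refine ⟨a, Lm, L₁, _, _, hc', h₁, h₂, by rw [← topDim_iso e, h₃], h₅, fun V hV => ?_⟩
    rw [← topDim_iso (V := V) e]
    exact h₆ V hV
  · rintro A B _ _ ⟨a, Lm, L₁, i, p, hc, h₁, h₂, h₃, h₅, h₆⟩
      ⟨a', Lm', L₁', i', p', hc', h₁', h₂', h₃', h₅', h₆'⟩
    refine ⟨a + a', _, _, _, _, hc.biprod hc', E.ct'.biprod h₁ h₁', E.without_biprod h₂ h₂', ?_,
      ?_, fun V hV => ⟨?_, ?_⟩⟩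
    · rw [topDim_biprod hfin U (Iso.refl _), h₃, h₃', add_mul]
    · rw [topDim_biprod hfin U' (Iso.refl _), h₅, h₅', add_mul]
    · rw [topDim_biprod hfin V (Iso.refl _), (h₆ V hV).1, (h₆' V hV).1]
    · rw [topDim_biprod hfin V (Iso.refl _), topDim_biprod hfin V (Iso.refl (A ⊞ B)),
        (h₆ V hV).2, (h₆' V hV).2]
      ring
  · refine ⟨1, E.Um, U', E.im, E.pm, ⟨_, E.real_m⟩, E.mem', E.mem_m, (one_mul _).symm,
      (one_mul _).symm, fun V hV => ⟨?_, ?_⟩⟩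
    · exact E.symm.topDim_self_without ((E.without_iff V).1 hV)
    · rw [E.topDim_self_without hV, one_mul, zero_add]
  · intro A hA
    obtain ⟨O, hO⟩ := HasZeroObject.zero (C := C)
    refine ⟨0, A, O, 𝟙 A, 0, Extri.conflation_id_zero A hO, E.ct'.of_isZero hO, hA, ?_, ?_,
      fun V hV => ⟨?_, by rw [zero_mul, add_zero]⟩⟩
    · rw [zero_mul, E.topDim_without hA]
    · rw [zero_mul, E.symm.topDim_without (E.symm.without_of_isZero hO)]
    · refine topDim_eq_zero fun f => ?_
      rw [hO.eq_of_src f 0]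
      exact zero_mem _

/-- By duality the dimension is that of the cokernel of Ext(Um, T) ⟶ Ext(U, T). Ext(U, T) is a
quotient of Hom(U, R.N). Maps U ⟶ R.L are radical as R.L avoids U, and exactly the radical maps to
R.N become zero in the cokernel. -/
theorem finrank_ker_push_eq_socDim (hF : X.IsFrobenius) (hCY : X.IsStablyTwoCY)
    [IsIdempotentComplete C] (hfin : ∀ A : C, FiniteDimensional K ((A ⟶ A) ⧸ rad K A A))
    (hnl : E.NoLoop) {T : C} (R : Cores X 𝒰 T) (hR : ¬ Nonempty (Retract U R.L)) :
    Module.finrank K (LinearMap.ker (X.push (Z := T) E.im)) = socDim K U R.N := by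
  rw [hCY.finrank_ker_push hF]
  let φ : (U ⟶ R.N) →ₗ[K] X.Ext U T ⧸ LinearMap.range (X.pull (X := T) E.im) :=
    (Submodule.mkQ _).comp
      ({ toFun := fun n => X.pull n R.δ
         map_add' := fun f g => X.pull_add f g _
         map_smul' := fun r f => X.pull_smul r f _ } : (U ⟶ R.N) →ₗ[K] X.Ext U T)
  have hφ : Function.Surjective φ := by
    rintro ⟨ε⟩
    obtain ⟨n, rfl⟩ := R.real.exists_pull ε (E.ct.ext_zero E.mem R.memL _)
    exact ⟨n, rfl⟩
  have hker : LinearMap.ker φ = rad K U R.N := by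
    ext n
    have h₁ : n ∈ LinearMap.ker φ ↔ X.pull n R.δ ∈ LinearMap.range (X.pull (X := T) E.im) :=
      Submodule.Quotient.mk_eq_zero _
    rw [h₁]
    constructor
    · rintro ⟨ε, hε⟩
      obtain ⟨n', rfl⟩ := R.real.exists_pull ε (E.ct.ext_zero E.mem_m.1 R.memL _)
      obtain ⟨l, hl⟩ := (R.real.pull_eq_zero_iff (n - E.im ≫ n')).1 (by
        rw [X.pull_sub, X.pull_comp, hε, sub_self])
      have : n = l ≫ R.p + E.im ≫ n' := by rw [hl, sub_add_cancel]
      rw [this]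
      exact add_mem (mem_rad_comp (E.loc.mem_rad_from hR l) _) (mem_rad_comp E.im_mem_rad _)
    · intro hn
      obtain ⟨n', rfl⟩ := hnl.exists_desc hfin _ R.memN n hn
      exact ⟨X.pull n' R.δ, (X.pull_comp _ _ _).symm⟩
  rw [socDim, ← hker]
  exact (LinearMap.quotKerEquivOfSurjective φ hφ).finrank_eq.symm

/-- If R.N avoids U, every map U ⟶ R.N extends over the exchange inflation, and the dual cokernel
vanishes. -/
theorem finrank_ker_push_eq_zero (hF : X.IsFrobenius) (hCY : X.IsStablyTwoCY) {T : C}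
    (R : Cores X 𝒰 T) (hR : ¬ Nonempty (Retract U R.N)) :
    Module.finrank K (LinearMap.ker (X.push (Z := T) E.im)) = 0 := by
  rw [hCY.finrank_ker_push hF]
  have : Subsingleton (X.Ext U T ⧸ LinearMap.range (X.pull (X := T) E.im)) := by
    rw [Submodule.Quotient.subsingleton_iff, eq_top_iff]
    rintro ε -
    obtain ⟨n, rfl⟩ := R.real.exists_pull ε (E.ct.ext_zero E.mem R.memL _)
    obtain ⟨n', rfl⟩ := E.exists_desc_im ⟨R.memN, hR⟩ n
    exact ⟨X.pull n' R.δ, (X.pull_comp _ _ _).symm⟩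
  exact Module.finrank_zero_of_subsingleton

/-- The change of coresolutions of a rigid object under an exchange. -/
theorem exists_cores_change (hF : X.IsFrobenius) (hCY : X.IsStablyTwoCY)
    [IsIdempotentComplete C] (hfin : ∀ A : C, FiniteDimensional K ((A ⟶ A) ⧸ rad K A A))
    (hnl : E.NoLoop) {T : C} (hT : ∀ δ : X.Ext T T, δ = 0) :
    ∃ (R : Cores X 𝒰 T) (R' : Cores X 𝒰' T) (a : ℕ),
      (topDim K U R.L = 0 ∧ topDim K U R.N = a * dimD K U ∧
        topDim K U' R'.L = a * dimD K U ∧ topDim K U' R'.N = 0 ∧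
        Module.finrank K (LinearMap.ker (X.push (Z := T) E.im)) = a * dimD K U ∧
        ∀ V, without 𝒰 U V → topDim K V R'.L = topDim K V R.L ∧
          topDim K V R'.N = topDim K V R.N + a * topDim K V E.Up) ∨
      (topDim K U R.L = a * dimD K U ∧ topDim K U R.N = 0 ∧
        topDim K U' R'.L = 0 ∧ topDim K U' R'.N = a * dimD K U ∧
        Module.finrank K (LinearMap.ker (X.push (Z := T) E.im)) = 0 ∧
        ∀ V, without 𝒰 U V → topDim K V R'.L = topDim K V R.L + a * topDim K V E.Um ∧
          topDim K V R'.N = topDim K V R.N) := by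
  obtain ⟨R, hR⟩ := E.exists_cores hfin hT
  have hd := hnl.dimD_eq
  rcases hR with hR | hR
  · have hL : without 𝒰 U R.L := ⟨R.memL, hR⟩
    have hL' := (E.without_iff _).1 hL
    obtain ⟨a, N₁, Np, i, p, ⟨δ', hδ'⟩, h₁, h₂, h₃, h₄, h₅, h₆⟩ := E.exists_plus hfin R.N R.memN
    have h₂' := (E.without_iff _).1 h₂
    -- The coresolution is pulled back along Np ⟶ R.N. The other pullback N₁ ⟶ M ⟶ R.L splits, so M
    -- lies in 𝒰' and T ⟶ M ⟶ Np is the new coresolution.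
    obtain ⟨M, x, y, x', y', hM, hM'⟩ := Extri.pullback_conflations R.real hδ'
    rw [E.ct'.ext_zero hL'.1 h₁ (X.pull R.p δ')] at hM'
    obtain ⟨e⟩ := hM'.iso_biprod
    refine ⟨R, ⟨M, Np, x, y, _, E.ct'.of_iso e.symm (E.ct'.biprod h₁ hL'.1), h₂'.1, hM⟩, a,
      Or.inl ⟨E.topDim_without hL, h₃, ?_, E.symm.topDim_without h₂', ?_, fun V hV => ⟨?_, (h₆ V hV).2⟩⟩⟩
    · show topDim K U' M = _
      rw [topDim_biprod hfin U' e, h₅, E.symm.topDim_without hL', hd, add_zero]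
    · rw [E.finrank_ker_push_eq_socDim hF hCY hfin hnl R hR, h₄]
    · show topDim K V M = _
      rw [topDim_biprod hfin V e, (h₆ V hV).1, zero_add]
  · have hN : without 𝒰 U R.N := ⟨R.memN, hR⟩
    have hN' := (E.without_iff _).1 hN
    obtain ⟨a, Lm, L₁, i, p, ⟨δ', hδ'⟩, h₁, h₂, h₃, h₅, h₆⟩ := E.exists_minus hfin R.L R.memL
    have h₂' := (E.without_iff _).1 h₂
    -- Here the inflations T ⟶ R.L ⟶ Lm are composed by ET4; the cokernel is an extension of L₁ by
    -- R.N, which splits.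
    obtain ⟨M, x, y, z, δ'', hM, -, -, hM', -⟩ := X.et4 R.real hδ'
    rw [E.ct'.ext_zero h₁ hN'.1 (X.push R.p δ')] at hM'
    obtain ⟨e⟩ := hM'.iso_biprod
    refine ⟨R, ⟨Lm, M, _, z, _, h₂'.1, E.ct'.of_iso e.symm (E.ct'.biprod hN'.1 h₁), hM⟩, a,
      Or.inr ⟨h₃, E.topDim_without hN, E.symm.topDim_without h₂', ?_,
        E.finrank_ker_push_eq_zero hF hCY R hR, fun V hV => ⟨(h₆ V hV).2, ?_⟩⟩⟩
    · show topDim K U' M = _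
      rw [topDim_biprod hfin U' e, h₅, E.symm.topDim_without hN', hd, zero_add]
    · show topDim K V M = _
      rw [topDim_biprod hfin V e, (h₆ V hV).1, add_zero]

end ExPair

/-! ### Error modules -/

section KerExt

variable {X : Extri K C} {𝒯 : ObjectProperty C} {A B D : C} {δ : X.Ext D A} {i : A ⟶ B} {p : B ⟶ D}

/-- The error module of a conflation is the cokernel of its deflation on representables. -/
def kerExtPres (hδ : X.Realizes δ i p) : Pres (kerExt X 𝒯 i) p where
  ψ T _ a := ⟨X.pull a δ, by
    rw [LinearMap.mem_ker, X.push_pull, hδ.push_inflation, map_zero]⟩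
  add T _ a b := Subtype.ext (X.pull_add a b δ)
  nat _ _ f a := Subtype.ext (X.pull_comp f a δ)
  surj T _ m := by
    obtain ⟨a, ha⟩ := hδ.exists_pull m.1 m.2
    exact ⟨a, Subtype.ext ha⟩
  ker T _ a := by
    rw [← hδ.pull_eq_zero_iff]
    exact ⟨fun h => congrArg Subtype.val h, fun h => Subtype.ext h⟩

/-- Replacing D and B by index approximations R' and R, with N' the kernel of R' ⟶ D, writes M as
the cokernel of Hom(-, R ⊞ N') ⟶ Hom(-, R'). Maps through projectives act as zero since they lift
along p. -/
theorem isFpStable_of_pres (h : X.IsCT 𝒯) {M : TMod K 𝒯} (P : Pres M p)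
    (hP : ∀ Q : C, X.IsProj Q → ∀ f : Q ⟶ D, ∃ g, g ≫ p = f) : M.IsFpStable X := by
  obtain ⟨N', R', i', r', hN', hR', ⟨ε', hε'⟩⟩ := h.exists_index D
  obtain ⟨N, R, j, r, hN, hR, ⟨ε, hε⟩⟩ := h.exists_index B
  obtain ⟨l, hl⟩ := (hε'.pull_eq_zero_iff (r ≫ p)).1 (h.ext_zero hR hN' _)
  have hact : ∀ (T : C) (hT : 𝒯 T) (a : T ⟶ R'), M.act hT hR' a (P.ψ R' hR' r') = P.ψ T hT (a ≫ r') :=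
    fun T hT a => (P.nat hT hR' a r').symm
  refine ⟨R', R ⊞ N', hR', h.biprod hR hN', biprod.desc l i', P.ψ R' hR' r', fun T hT => ⟨?_, ?_⟩⟩
  · intro y
    obtain ⟨a, rfl⟩ := P.surj T hT y
    obtain ⟨a', rfl⟩ := (hε'.pull_eq_zero_iff a).1 (h.ext_zero hT hN' _)
    exact ⟨a', hact T hT a'⟩
  · intro a
    rw [hact, P.ker]
    constructor
    · rintro ⟨b, hb⟩
      obtain ⟨b', rfl⟩ := (hε.pull_eq_zero_iff b).1 (h.ext_zero hT hN _)
      obtain ⟨c, hc⟩ := hε'.exists_lift (a - b' ≫ l) (by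
        rw [Preadditive.sub_comp, Category.assoc, hl, ← hb, Category.assoc, sub_self])
      refine ⟨biprod.lift b' c, ?_⟩
      rw [biprod.lift_desc, hc, add_sub_cancel, sub_self]
      exact X.factors_zero _ _
    · rintro ⟨g, Q, x, y, hQ, hxy⟩
      obtain ⟨z, hz⟩ := hP Q hQ (y ≫ r')
      refine ⟨x ≫ z + (g ≫ biprod.fst) ≫ r, ?_⟩
      have h₁ : a = x ≫ y + g ≫ biprod.desc l i' := by rw [← hxy, sub_add_cancel]
      have h₂ : biprod.desc l i' ≫ r' = biprod.fst ≫ r ≫ p := by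
        rw [biprod.desc_eq, Preadditive.add_comp, Category.assoc, Category.assoc, hl,
          hε'.comp_zero, comp_zero, add_zero]
      rw [h₁, Preadditive.add_comp, Preadditive.add_comp, Category.assoc, hz, Category.assoc,
        Category.assoc, Category.assoc, Category.assoc, h₂]

theorem kerExt_isFpStable (h : X.IsCT 𝒯) (hδ : X.Realizes δ i p) :
    (kerExt X 𝒯 i).IsFpStable X :=
  isFpStable_of_pres h (kerExtPres hδ) fun _ hQ f => (hδ.pull_eq_zero_iff f).1 (hQ _ _)

theorem kerExt_isLfd (hCY : X.IsStablyTwoCY) (𝒯 : ObjectProperty C) {A B : C} (i : A ⟶ B) :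
    (kerExt X 𝒯 i).IsLfd := fun T _ => by
  have := hCY.finite_ext T A
  exact FiniteDimensional.finiteDimensional_submodule (LinearMap.ker (X.push (Z := T) i))

theorem beta_kerExt (hC : Extri.IsClusterCategory.{w, v, u, v₁, u₁} X) (h : X.IsCT 𝒯)
    (hδ : X.Realizes δ i p) (hM : (kerExt X 𝒯 i).IsFpStable X) :
    Extri.beta.{w, v, u, v₁, u₁} X 𝒯 (K0Mod.cls (kerExt X 𝒯 i) hM) =
      - (indObj h D - indObj h B + indObj h A) :=
  beta_eq hC h hM hδ (kerExtPres hδ)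

end KerExt

/-- Both sides are additive and agree on indecomposables. This turns the count of irreducible maps
to U into one comparable with the pairing. -/
theorem topDim_eq_socDim {X : Extri K C} {𝒯 : ObjectProperty C} (hidem : IsIdempotentComplete C)
    (hK : X.IsCompactCat) (h : X.IsCT 𝒯) {V : C} (hV : 𝒯 V) (hVi : Indecomposable V) (A : C)
    (hA : 𝒯 A) : topDim K V A = socDim K V A := by
  have hloc := isLocalObj_of_mem hidem hK h hV hVi
  refine h.induction hK.finite (Q := fun A => topDim K V A = socDim K V A) ?_ ?_ ?_ ?_ A hA
  · intro A B e hAB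
    rw [← topDim_iso e, ← socDim_iso e, hAB]
  · intro A hA
    rw [topDim_eq_zero, socDim_eq_zero]
    · intro f
      rw [hA.eq_of_tgt f 0]
      exact zero_mem _
    · intro f
      rw [hA.eq_of_src f 0]
      exact zero_mem _
  · intro A B _ _ hA hB
    rw [topDim_biprod hK.finite V (Iso.refl _), socDim_biprod hK.finite, hA, hB]
  · intro A hA hAi
    by_cases hr : Nonempty (Retract V A)
    · obtain ⟨e⟩ := Retract.iso_of_indecomposable hr.some hloc.not_isZero hAi
      rw [← topDim_iso e, ← socDim_iso e]
      rfl
    · rw [topDim_eq_zero (hloc.mem_rad_to hr), socDim_eq_zero (hloc.mem_rad_from hr)]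

namespace ExPair

variable {X : Extri K C} {𝒯 𝒰 𝒰' : ObjectProperty C} {U U' : C} (E : ExPair X 𝒰 𝒰' U U')

/-! ### Mutation of indices -/

-- P is coresolved by P = P ⟶ 0, and it does not contain U, because U is not projective as δp ≠ 0.
include E in
theorem pairing_isProj (hfin : ∀ A : C, FiniteDimensional K ((A ⟶ A) ⧸ rad K A A)) (P : C)
    (hP : 𝒯 P) (hproj : X.IsProj P) :
    pairing (X.indbar 𝒰 𝒯 (K0num.cls (simple K 𝒰 U) (simple_isLfd hfin _ _))) (K0.cls P hP) = 0 := by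
  obtain ⟨O, hO⟩ := HasZeroObject.zero (C := C)
  obtain ⟨δ, hδ⟩ := Extri.conflation_id_zero (X := X) P hO
  rw [pairing_indbar_simple hfin E.ct 𝒯 U hP
    ⟨P, O, 𝟙 P, 0, δ, E.ct.of_isProj hproj, E.ct.of_isZero hO, hδ⟩]
  have h₁ : without 𝒰 U P := by
    refine ⟨E.ct.of_isProj hproj, fun ⟨r⟩ => E.ne_p ?_⟩
    rw [← X.pull_id E.δp, ← r.retract, X.pull_comp, hproj _ (X.pull r.r E.δp), map_zero]
  rw [E.topDim_without h₁, E.topDim_without (E.without_of_isZero hO), sub_self]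

section

variable (hF : X.IsFrobenius) (hCY : X.IsStablyTwoCY) [IsIdempotentComplete C]
  (hfin : ∀ A : C, FiniteDimensional K ((A ⟶ A) ⧸ rad K A A)) (hnl : E.NoLoop) (h𝒯 : X.IsCT 𝒯)
include hF hCY hnl h𝒯

/-- The count of U in one term of a cancelled coresolution becomes the count of U' in the other
term, which reverses the sign. -/
theorem indbar_simple_exchange :
    X.indbar 𝒰' 𝒯 (K0num.cls (simple K 𝒰' U') (simple_isLfd hfin _ _)) =
      - X.indbar 𝒰 𝒯 (K0num.cls (simple K 𝒰 U) (simple_isLfd hfin _ _)) := by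
  refine K0num_ext fun T hT => ?_
  obtain ⟨R, R', a, h⟩ := E.exists_cores_change hF hCY hfin hnl (h𝒯.ext_zero hT hT)
  rw [map_neg, AddMonoidHom.neg_apply, pairing_indbar_simple hfin E.ct 𝒯 U hT R,
    pairing_indbar_simple hfin E.ct' 𝒯 U' hT R']
  rcases h with ⟨h₁, h₂, h₃, h₄, -⟩ | ⟨h₁, h₂, h₃, h₄, -⟩ <;> rw [h₁, h₂, h₃, h₄] <;> ring

/-- Since U occurs on one side only, the value of c at T is a single signed dimension; the error
module sees it exactly when U lies in the third term. -/
theorem pairing_kerExt (T : C) (hT : 𝒯 T) :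
    pairing (K0num.cls (kerExt X 𝒯 E.im) (kerExt_isLfd hCY 𝒯 _)) (K0.cls T hT) =
      max (- pairing (X.indbar 𝒰 𝒯 (K0num.cls (simple K 𝒰 U) (simple_isLfd hfin _ _)))
        (K0.cls T hT)) 0 := by
  obtain ⟨R, R', a, h⟩ := E.exists_cores_change hF hCY hfin hnl (h𝒯.ext_zero hT hT)
  rw [pairing_cls, pairing_indbar_simple hfin E.ct 𝒯 U hT R]
  have hval : Module.finrank K ((kerExt X 𝒯 E.im).val T hT) =
    Module.finrank K (LinearMap.ker (X.push (Z := T) E.im)) := rfl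
  rw [hval]
  rcases h with ⟨h₁, h₂, -, -, h₃, -⟩ | ⟨h₁, h₂, -, -, h₃, -⟩ <;> rw [h₁, h₂, h₃]
  · rw [max_eq_left] <;> simp
    positivity
  · rw [max_eq_right] <;> simp
    positivity

/-- At T the correction is q [c]_+ - q' [c]_-: copies of U in L add Um to L, copies in N add Up to
N. Written with c and [c]_- this is q c + (q - q') [c]_-. -/
theorem indbar_simple_other {V : C} (hV : without 𝒰 U V) {q q' : ℕ}
    (hq : topDim K V E.Um = q * dimD K U) (hq' : topDim K V E.Up = q' * dimD K U) :
    X.indbar 𝒰' 𝒯 (K0num.cls (simple K 𝒰' V) (simple_isLfd hfin _ _)) =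
      X.indbar 𝒰 𝒯 (K0num.cls (simple K 𝒰 V) (simple_isLfd hfin _ _))
      + (q : ℤ) • X.indbar 𝒰 𝒯 (K0num.cls (simple K 𝒰 U) (simple_isLfd hfin _ _))
      + ((q : ℤ) - q') • K0num.cls (kerExt X 𝒯 E.im) (kerExt_isLfd hCY 𝒯 _) := by
  refine K0num_ext fun T hT => ?_
  obtain ⟨R, R', a, h⟩ := E.exists_cores_change hF hCY hfin hnl (h𝒯.ext_zero hT hT)
  rw [map_add, map_add, AddMonoidHom.add_apply, AddMonoidHom.add_apply, map_zsmul, map_zsmul,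
    AddMonoidHom.zsmul_apply, AddMonoidHom.zsmul_apply, pairing_cls,
    pairing_indbar_simple hfin E.ct 𝒯 U hT R,
    pairing_indbar_simple hfin E.ct 𝒯 V hT R, pairing_indbar_simple hfin E.ct' 𝒯 V hT R']
  have hval : Module.finrank K ((kerExt X 𝒯 E.im).val T hT) =
    Module.finrank K (LinearMap.ker (X.push (Z := T) E.im)) := rfl
  rw [hval]
  rcases h with ⟨h₁, h₂, -, -, h₃, h₄⟩ | ⟨h₁, h₂, -, -, h₃, h₄⟩ <;>
    rw [h₁, h₂, h₃, (h₄ V hV).1, (h₄ V hV).2] <;> simp only [hq, hq'] <;> push_cast <;>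
    simp only [smul_eq_mul] <;> ring

end

/-- The exchange matrix entries in column `k` are the differences of the multiplicities in the
middle terms of the exchange conflations. -/
theorem exists_exch_column (hidem : IsIdempotentComplete C) (hK : X.IsCompactCat) {I : Type*}
    {W : I → C} (hW : IsIndecFamily 𝒰 W) {k : I} (E : ExPair X 𝒰 𝒰' (W k) U') (hnl : E.NoLoop) :
    ∃ p m : I →₀ ℕ,
      K0.cls E.Up E.mem_p.1 = p.sum (fun i n => n • K0.cls (W i) (hW.mem i)) ∧
      K0.cls E.Um E.mem_m.1 = m.sum (fun i n => n • K0.cls (W i) (hW.mem i)) ∧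
      p k = 0 ∧ m k = 0 ∧ (∀ i, exch K 𝒰 (W i) (W k) = (p i : ℤ) - m i) ∧
      (NoTwoCycleAt K 𝒰 (W k) → ∀ i, p i = 0 ∨ m i = 0) := by
  have hfin := hK.finite
  obtain ⟨p, hp, -, hp'⟩ := hW.exists_cls hidem hK E.ct E.Up E.mem_p.1
  obtain ⟨m, hm, hm', -⟩ := hW.exists_cls hidem hK E.ct E.Um E.mem_m.1
  have hd : ∀ i, 0 < dimD K (W i) := fun i =>
    dimD_pos hfin (isLocalObj_of_mem hidem hK E.ct (hW.mem i) (hW.indec i))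
  have hpk : p k = 0 := by
    have := hp' k
    rw [E.socDim_without E.mem_p] at this
    exact (mul_eq_zero.1 this.symm).resolve_right (hd k).ne'
  have hmk : m k = 0 := by
    have := hm' k
    rw [E.topDim_without E.mem_m] at this
    exact (mul_eq_zero.1 this.symm).resolve_right (hd k).ne'
  have hwo : ∀ i, i ≠ k → without 𝒰 (W k) (W i) := fun i hi =>
    E.without_of_not_iso (hW.mem i) (hW.indec i) fun h => hi (hW.inj i k h)
  have hfrom : ∀ i, i ≠ k → Module.finrank K (Irr K 𝒰 (W k) (W i)) = m i * dimD K (W i) :=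
    fun i hi => by rw [hnl.finrank_irr_from hfin (hwo i hi), hm']
  have hto : ∀ i, i ≠ k → Module.finrank K (Irr K 𝒰 (W i) (W k)) = p i * dimD K (W i) :=
    fun i hi => by rw [hnl.finrank_irr_to hfin (hwo i hi), hp']
  refine ⟨p, m, hp, hm, hpk, hmk, fun i => ?_, fun h2 i => ?_⟩
  · by_cases hi : i = k
    · subst hi
      rw [exch, sub_self, hpk, hmk]
      simp
    · rw [exch, hfrom i hi, hto i hi, Nat.mul_div_cancel _ (hd i), Nat.mul_div_cancel _ (hd i)]
  · by_cases hi : i = k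
    · exact Or.inl (hi ▸ hpk)
    · rcases h2 (W i) (hW.mem i) (hW.indec i) with hs | hs
      · have := hfrom i hi
        rw [Module.finrank_zero_of_subsingleton] at this
        exact Or.inr ((mul_eq_zero.1 this.symm).resolve_right (hd i).ne')
      · have := hto i hi
        rw [Module.finrank_zero_of_subsingleton] at this
        exact Or.inl ((mul_eq_zero.1 this.symm).resolve_right (hd i).ne')

/-- The exchange matrix entries in the row of `U`. -/
theorem exists_exch_row (hidem : IsIdempotentComplete C) (hK : X.IsCompactCat) (hnl : E.NoLoop)
    {V : C} (hV : without 𝒰 U V) (hVi : Indecomposable V) :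
    ∃ q q' : ℕ, topDim K V E.Um = q * dimD K U ∧ topDim K V E.Up = q' * dimD K U ∧
      exch K 𝒰 U V = (q : ℤ) - q' ∧ (NoTwoCycleAt K 𝒰 U → q = 0 ∨ q' = 0) := by
  have hfin := hK.finite
  have hd := dimD_pos hfin E.loc
  have h₁ := hnl.finrank_irr_from hfin hV
  have h₂ := hnl.finrank_irr_to hfin hV
  -- For infinite-dimensional spaces `Module.finrank` is zero, so divisibility is trivial.
  have hdvd : ∀ (M : Type v) [AddCommGroup M] [Module K M],
      (FiniteDimensional K M → dimD K U ∣ Module.finrank K M) → dimD K U ∣ Module.finrank K M := by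
    intro M _ _ hM
    by_cases hf : FiniteDimensional K M
    · exact hM hf
    · rw [Module.finrank_of_not_finite hf]
      exact dvd_zero _
  obtain ⟨q, hq⟩ := hdvd _ fun _ => dimD_dvd_irr_from (V := V) E.loc E.mem (hfin U)
  obtain ⟨q', hq'⟩ := hdvd _ fun _ => dimD_dvd_irr_to (V := V) E.loc E.mem (hfin U)
  refine ⟨q, q', by rw [← h₁, hq, mul_comm], ?_, ?_, fun h => ?_⟩
  · rw [topDim_eq_socDim hidem hK E.ct hV.1 hVi _ E.mem_p.1, ← h₂, hq', mul_comm]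
  · rw [exch, hq, hq', Nat.mul_div_cancel_left _ hd, Nat.mul_div_cancel_left _ hd]
  · rcases h V hV.1 hVi with hs | hs
    · rw [Module.finrank_zero_of_subsingleton] at hq
      exact Or.inl ((mul_eq_zero.1 hq.symm).resolve_left hd.ne')
    · rw [Module.finrank_zero_of_subsingleton] at hq'
      exact Or.inr ((mul_eq_zero.1 hq'.symm).resolve_left hd.ne')

end ExPair

/-- The mutation formulae for indices. -/
theorem mutation_formulae {X : Extri K C} (hC : Extri.IsClusterCategory.{w, v, u, v₁, u₁} X)
    (hK : X.IsCompactCat) {𝒯 𝒰 𝒰' : ObjectProperty C} (h𝒯 : X.IsCT 𝒯) {I : Type*} {W : I → C}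
    (hW : IsIndecFamily 𝒰 W) {k : I} {U' : C} (E : ExPair X 𝒰 𝒰' (W k) U')
    (h₁ : NoLoopAt K 𝒰 (W k)) (h₂ : NoTwoCycleAt K 𝒰 (W k)) :
    let c := X.indbar 𝒰 𝒯 (K0num.cls (simple K 𝒰 (W k)) (simple_isLfd hK.finite _ _))
    {i | exch K 𝒰 (W i) (W k) ≠ 0}.Finite ∧
    (∀ (P : C) (hP : 𝒯 P), X.IsProj P → pairing c (K0.cls P hP) = 0) ∧
    ∃ (hfp : (kerExt X 𝒯 E.im).IsFpStable X) (hfd : (kerExt X 𝒯 E.im).IsLfd),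
      IsNegPart c (K0num.cls (kerExt X 𝒯 E.im) hfd) ∧
      X.ind 𝒰' 𝒯 (K0.cls U' E.mem') =
        - X.ind 𝒰 𝒯 (K0.cls (W k) (hW.mem k))
        + (∑ᶠ (i : I) (_ : i ≠ k),
            max (- exch K 𝒰 (W i) (W k)) 0 • X.ind 𝒰 𝒯 (K0.cls (W i) (hW.mem i)))
        - Extri.beta.{w, v, u, v₁, u₁} X 𝒯 (K0Mod.cls (kerExt X 𝒯 E.im) hfp) ∧
      X.indbar 𝒰' 𝒯 (K0num.cls (simple K 𝒰' U') (simple_isLfd hK.finite _ _)) = - c ∧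
      ∀ (V : C) (hV' : 𝒰' V), Indecomposable V → ¬ Nonempty (V ≅ U') →
        (∃ hV : 𝒰 V, X.ind 𝒰' 𝒯 (K0.cls V hV') = X.ind 𝒰 𝒯 (K0.cls V hV)) ∧
        X.indbar 𝒰' 𝒯 (K0num.cls (simple K 𝒰' V) (simple_isLfd hK.finite _ _)) =
          X.indbar 𝒰 𝒯 (K0num.cls (simple K 𝒰 V) (simple_isLfd hK.finite _ _))
          + max (exch K 𝒰 (W k) V) 0 • c
          + exch K 𝒰 (W k) V • K0num.cls (kerExt X 𝒯 E.im) hfd := by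
  classical
  intro c
  have hidem := hC.idem
  have hfin := hK.finite
  have hCY := hC.twoCY
  have := hCY.finite_ext U' (W k)
  have hnl : E.NoLoop := E.noLoop_of_noLoopAt hfin h₁
  obtain ⟨p, m, -, hm, -, hmk, hex, h2⟩ := E.exists_exch_column hidem hK hW hnl
  refine ⟨?_, fun P hP hproj => E.pairing_isProj hfin P hP hproj, kerExt_isFpStable h𝒯 E.real_m,
    kerExt_isLfd hCY 𝒯 _, fun T hT _ => E.pairing_kerExt hC.frobenius hCY hfin hnl h𝒯 T hT, ?_,
    E.indbar_simple_exchange hC.frobenius hCY hfin hnl h𝒯, fun V hV' hVi hne => ?_⟩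
  · refine (p.support ∪ m.support).finite_toSet.subset fun i hi => ?_
    rw [Finset.mem_coe, Finset.mem_union, Finsupp.mem_support_iff, Finsupp.mem_support_iff]
    by_contra hno
    push Not at hno
    exact hi (by rw [hex, hno.1, hno.2]; simp)
  -- Without 2-cycles p and m have disjoint supports, so [b]_- is m and the sum is the index of
  -- `E.Um`.
  · have hsum : (∑ᶠ (i : I) (_ : i ≠ k),
        max (- exch K 𝒰 (W i) (W k)) 0 • X.ind 𝒰 𝒯 (K0.cls (W i) (hW.mem i))) = indObj h𝒯 E.Um := by
      have hfun : (fun i => ∑ᶠ (_ : i ≠ k),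
          max (- exch K 𝒰 (W i) (W k)) 0 • X.ind 𝒰 𝒯 (K0.cls (W i) (hW.mem i))) =
          fun i => m i • X.ind 𝒰 𝒯 (K0.cls (W i) (hW.mem i)) := by
        funext i
        by_cases hi : i = k
        · rw [finsum_eq_if (p := i ≠ k), if_neg (not_not.2 hi), hi, hmk, zero_smul]
        · rw [finsum_eq_if (p := i ≠ k), if_pos hi, hex, ← natCast_zsmul]
          congr 1
          rcases h2 h₂ i with h | h <;> rw [h] <;> simp
      rw [hfun, finsum_eq_sum_of_support_subset (s := m.support), ← ind_cls h𝒯 _ E.mem_m.1, hm,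
        Finsupp.sum, map_sum]
      · simp only [map_nsmul]
      · intro i hi
        rw [Finset.mem_coe, Finsupp.mem_support_iff]
        rintro h0
        exact hi (by simp [h0])
    rw [hsum, beta_kerExt hC h𝒯 E.real_m, ind_cls h𝒯, ind_cls h𝒯]
    abel
  · have hV : without 𝒰 (W k) V :=
      (E.without_iff V).2 (E.symm.without_of_not_iso hV' hVi hne)
    refine ⟨⟨hV.1, by rw [ind_cls h𝒯, ind_cls h𝒯]⟩, ?_⟩
    obtain ⟨q, q', hq, hq', hqe, hqq⟩ := E.exists_exch_row hidem hK hnl hV hVi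
    rw [E.indbar_simple_other hC.frobenius hCY hfin hnl h𝒯 hV hq hq', hqe]
    congr 3
    rcases hqq h₂ with h | h <;> rw [h] <;> simp

/-! ### The defect of a conflation -/

section Defect

variable {X : Extri K C} {𝒯 : ObjectProperty C}

/-- The defect `ind B - ind A - ind D` of a conflation depends only on the module it presents. -/
theorem defect_unique (hC : Extri.IsClusterCategory.{w, v, u, v₁, u₁} X) (h : X.IsCT 𝒯)
    {M : TMod K 𝒯} {A B D A' B' D' : C} {δ : X.Ext D A} {i : A ⟶ B} {p : B ⟶ D}
    {δ' : X.Ext D' A'} {i' : A' ⟶ B'} {p' : B' ⟶ D'} (hδ : X.Realizes δ i p)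
    (hδ' : X.Realizes δ' i' p') (P : Pres M p) (P' : Pres M p') :
    indObj h B - indObj h A - indObj h D = indObj h B' - indObj h A' - indObj h D' := by
  obtain ⟨L⟩ := hC.algebraic
  obtain ⟨R, hR⟩ := P.exists_resolution L h hδ
  obtain ⟨R', hR'⟩ := P'.exists_resolution L h hδ'
  have := resolution_euler_unique L h R R'
  rw [hR, hR'] at this
  have h₁ : indObj h B - indObj h A - indObj h D = -(indObj h D - indObj h B + indObj h A) := by
    abel
  rw [h₁, this]
  abel

/-- If all morphisms from `𝒯` lift along the deflation of a conflation, then its defect is zero. -/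
theorem defect_eq_zero (hC : Extri.IsClusterCategory.{w, v, u, v₁, u₁} X) (h : X.IsCT 𝒯)
    {A B D : C} {δ : X.Ext D A} {i : A ⟶ B} {p : B ⟶ D} (hδ : X.Realizes δ i p)
    (hp : ∀ T, 𝒯 T → ∀ f : T ⟶ D, ∃ g, g ≫ p = f) :
    indObj h B - indObj h A - indObj h D = 0 := by
  have hpres : ∀ {B' : C} (p' : B' ⟶ D), (∀ T, 𝒯 T → ∀ f : T ⟶ D, ∃ g, g ≫ p' = f) →
      Nonempty (Pres (zeroMod (K := K) 𝒯) p') := fun p' hp' =>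
    ⟨⟨fun _ _ _ => PUnit.unit, fun _ _ _ _ => rfl, fun _ _ _ _ => rfl,
      fun _ _ _ => ⟨0, rfl⟩, fun T hT f => ⟨fun _ => hp' T hT f, fun _ => rfl⟩⟩⟩
  obtain ⟨P⟩ := hpres p hp
  -- The split conflation presents the zero module too, and its defect vanishes by additivity of the
  -- index.
  obtain ⟨P'⟩ := hpres (biprod.snd : A ⊞ D ⟶ D) fun T _ f => ⟨f ≫ biprod.inr, by simp⟩
  rw [defect_unique hC h hδ (X.realizes_zero A D) P P', indObj_biprod h (Iso.refl _)]
  abel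

/-- A simple module is presented by a conflation through which exactly the radical morphisms
factor. -/
def simplePres {B D : C} {p : B ⟶ D}
    (hp : ∀ T, 𝒯 T → ∀ f : T ⟶ D, f ∈ rad K T D ↔ ∃ g, g ≫ p = f) : Pres (simple K 𝒯 D) p where
  ψ _ _ a := Submodule.Quotient.mk a
  add _ _ _ _ := rfl
  nat _ _ _ _ := rfl
  surj _ _ m := Submodule.Quotient.mk_surjective _ m
  ker T hT a := (Submodule.Quotient.mk_eq_zero (rad K T D)).trans (hp T hT a)

/-- The defect of conflations which present the simple module of `U`. -/
theorem ExPair.defect_simple {𝒯' : ObjectProperty C} {U U' : C}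
    (hC : Extri.IsClusterCategory.{w, v, u, v₁, u₁} X)
    (hfin : ∀ A : C, FiniteDimensional K ((A ⟶ A) ⧸ rad K A A)) (E : ExPair X 𝒯 𝒯' U U')
    (hnl : E.NoLoop) {A B : C} {δ : X.Ext U A} {i : A ⟶ B} {p : B ⟶ U} (hδ : X.Realizes δ i p)
    (hp : ∀ T, 𝒯 T → ∀ f : T ⟶ U, f ∈ rad K T U ↔ ∃ g, g ≫ p = f) :
    indObj E.ct B - indObj E.ct A - indObj E.ct U =
      K0.cls E.Up E.mem_p.1 - K0.cls E.Um E.mem_m.1 := by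
  have := hC.idem
  -- The exchange conflation ending in U is one presentation of the simple module; the index of its
  -- first term U' is read off from the other exchange conflation.
  have hp' : ∀ T, 𝒯 T → ∀ f : T ⟶ U, f ∈ rad K T U ↔ ∃ g, g ≫ E.pp = f := fun T hT f =>
    ⟨fun hf => hnl.exists_lift hfin T hT f hf, fun ⟨g, hg⟩ => hg ▸ comp_mem_rad g E.pp_mem_rad⟩
  rw [defect_unique hC E.ct hδ E.real_p (simplePres hp) (simplePres hp'),
    indObj_self E.ct E.mem_p.1, indObj_self E.ct E.mem,
    indObj_eq E.ct E.mem E.mem_m.1 ⟨_, E.real_m⟩]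
  abel

variable (K) in
/-- The dimension of the cokernel of `Hom(T, B) ⟶ Hom(T, D)`. -/
def cokerDim {B D : C} (p : B ⟶ D) (T : C) : ℕ :=
  Module.finrank K ((T ⟶ D) ⧸ LinearMap.range (Linear.rightComp K T p))

section

variable {A B D : C} {δ : X.Ext D A} {i : A ⟶ B} {p : B ⟶ D}

theorem mem_range_rightComp {T : C} (f : T ⟶ D) :
    f ∈ LinearMap.range (Linear.rightComp K T p) ↔ ∃ g, g ≫ p = f := Iff.rfl

theorem cokerDim_eq (hδ : X.Realizes δ i p) (T : C) :
    cokerDim K p T = Module.finrank K (LinearMap.ker (X.push (Z := T) i)) := by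
  let φ : (T ⟶ D) →ₗ[K] LinearMap.ker (X.push (Z := T) i) :=
    { toFun := fun a => ⟨X.pull a δ, by
        rw [LinearMap.mem_ker, X.push_pull, hδ.push_inflation, map_zero]⟩
      map_add' := fun a b => Subtype.ext (X.pull_add a b δ)
      map_smul' := fun r a => Subtype.ext (X.pull_smul r a δ) }
  have hφ : Function.Surjective φ := fun m => by
    obtain ⟨a, ha⟩ := hδ.exists_pull m.1 m.2
    exact ⟨a, Subtype.ext ha⟩
  have hker : LinearMap.ker φ = LinearMap.range (Linear.rightComp K T p) := by
    ext a
    rw [mem_range_rightComp, ← hδ.pull_eq_zero_iff]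
    exact ⟨fun h => congrArg Subtype.val h, fun h => Subtype.ext h⟩
  rw [cokerDim, ← hker]
  exact (LinearMap.quotKerEquivOfSurjective φ hφ).finrank_eq

theorem finite_coker (hCY : X.IsStablyTwoCY) (hδ : X.Realizes δ i p) (T : C) :
    FiniteDimensional K ((T ⟶ D) ⧸ LinearMap.range (Linear.rightComp K T p)) := by
  let φ : (T ⟶ D) →ₗ[K] X.Ext T A :=
    { toFun := fun a => X.pull a δ
      map_add' := fun a b => X.pull_add a b δ
      map_smul' := fun r a => X.pull_smul r a δ }
  have hker : LinearMap.ker φ = LinearMap.range (Linear.rightComp K T p) := by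
    ext a
    rw [mem_range_rightComp, ← hδ.pull_eq_zero_iff]
    rfl
  have := hCY.finite_ext T A
  rw [← hker]
  exact (LinearMap.quotKerEquivRange φ).symm.finiteDimensional

/-- The subspace of classes of `Hom(S, D)` generated by `a : T ⟶ D`. -/
def genBy (p : B ⟶ D) {T : C} (a : T ⟶ D) (S : C) :
    Submodule K ((S ⟶ D) ⧸ LinearMap.range (Linear.rightComp K S p)) :=
  (LinearMap.range (Linear.rightComp K S a)).map (Submodule.mkQ _)

theorem mem_genBy {S T : C} {a : T ⟶ D} {f : S ⟶ D} :
    Submodule.Quotient.mk f ∈ genBy (K := K) p a S ↔ ∃ g h, f = g ≫ p + h ≫ a := by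
  constructor
  · rintro ⟨_, ⟨h, rfl⟩, hf⟩
    obtain ⟨g, hg⟩ := (Submodule.Quotient.eq _).1 hf.symm
    exact ⟨g, h, eq_add_of_sub_eq hg.symm⟩
  · rintro ⟨g, h, rfl⟩
    exact ⟨h ≫ a, ⟨h, rfl⟩, (Submodule.Quotient.eq _).2 ⟨-g, by simp⟩⟩

/-- Existence of an element of the socle of the cokernel of `Hom(-, B) ⟶ Hom(-, D)`. -/
theorem exists_socle (hCY : X.IsStablyTwoCY) (hδ : X.Realizes δ i p) {J : Type*} (T : J → C)
    (F : Finset J) (hF : ∀ t, t ∉ F → ∀ f : T t ⟶ D, ∃ g, g ≫ p = f) (t₀ : J) (a₀ : T t₀ ⟶ D)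
    (ha₀ : ¬ ∃ g, g ≫ p = a₀) : ∃ (t : J) (a : T t ⟶ D), (¬ ∃ g, g ≫ p = a) ∧
      ∀ (s : J) (r : T s ⟶ T t), r ∈ rad K (T s) (T t) → ∃ g, g ≫ p = r ≫ a := by
  suffices H : ∀ (n : ℕ) (t : J) (a : T t ⟶ D), (¬ ∃ g, g ≫ p = a) →
      ∑ s ∈ F, Module.finrank K (genBy (K := K) p a (T s)) = n → ∃ (t : J) (a : T t ⟶ D),
        (¬ ∃ g, g ≫ p = a) ∧
        ∀ (s : J) (r : T s ⟶ T t), r ∈ rad K (T s) (T t) → ∃ g, g ≫ p = r ≫ a from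
    H _ t₀ a₀ ha₀ rfl
  intro n
  induction n using Nat.strong_induction_on with
  | _ n ih =>
  intro t a ha hn
  by_contra hno
  push Not at hno
  obtain ⟨s, r, hr, hra⟩ := hno t a (fun g hg => ha ⟨g, hg⟩)
  have hra' : ¬ ∃ g, g ≫ p = r ≫ a := fun ⟨g, hg⟩ => hra g hg
  have hle : ∀ q, genBy (K := K) p (r ≫ a) (T q) ≤ genBy p a (T q) := by
    rintro q _ ⟨_, ⟨h, rfl⟩, rfl⟩
    exact ⟨_, ⟨h ≫ r, rfl⟩, by simp⟩
  have hfd : ∀ q, FiniteDimensional K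
      ((q ⟶ D) ⧸ LinearMap.range (Linear.rightComp K q p)) := finite_coker hCY hδ
  have htF : t ∈ F := by_contra fun htF => ha (hF t htF a)
  -- If r ≫ a generated the same subspace as a, then (1 - h ≫ r) ≫ a would lift along p for some h,
  -- and so would a, since 1 - h ≫ r is invertible.
  have hlt : genBy (K := K) p (r ≫ a) (T t) < genBy p a (T t) := by
    refine lt_of_le_of_ne (hle t) fun heq => ha ?_
    have h₁ : Submodule.Quotient.mk a ∈ genBy (K := K) p a (T t) :=
      mem_genBy.2 ⟨0, 𝟙 _, by simp⟩
    rw [← heq] at h₁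
    obtain ⟨g, h, hgh⟩ := mem_genBy.1 h₁
    have h₂ : IsIso (𝟙 (T t) - h ≫ r) := rad_ext_iso hr h
    refine ⟨inv (𝟙 (T t) - h ≫ r) ≫ g, ?_⟩
    rw [Category.assoc, IsIso.inv_comp_eq, Preadditive.sub_comp, Category.id_comp, Category.assoc]
    exact eq_sub_of_add_eq hgh.symm
  obtain ⟨t', a', h₁, h₂⟩ := ih _ (by
    rw [← hn]
    exact Finset.sum_lt_sum (fun q _ => Submodule.finrank_mono (hle q))
      ⟨t, htF, Submodule.finrank_lt_finrank_of_lt hlt⟩) s (r ≫ a) hra' rfl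
  obtain ⟨s', r', hr', hn'⟩ := hno t' a' (fun g hg => h₁ ⟨g, hg⟩)
  obtain ⟨g, hg⟩ := h₂ s' r' hr'
  exact hn' g hg

end

/-- The defect of a conflation is determined by the dimension vector of the module which it
presents. -/
theorem defect_eq_sum (hC : Extri.IsClusterCategory.{w, v, u, v₁, u₁} X) (hK : X.IsCompactCat)
    (h : X.IsCT 𝒯) {I : Type*} {T : I → C} (hT : IsIndecFamily 𝒯 T)
    (b : {i // ¬ X.IsProj (T i)} → K0 𝒯)
    (hb : ∀ (t : {i // ¬ X.IsProj (T i)}) {A B : C} {δ : X.Ext (T t) A} {i : A ⟶ B} {p : B ⟶ T t},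
      X.Realizes δ i p → (∀ S, 𝒯 S → ∀ f : S ⟶ T t, f ∈ rad K S (T t) ↔ ∃ g, g ≫ p = f) →
        indObj h B - indObj h A - indObj h (T t) = b t)
    (F : Finset {i // ¬ X.IsProj (T i)}) (n : ℕ) : ∀ {A B D : C} {δ : X.Ext D A} {i : A ⟶ B}
    {p : B ⟶ D} (_ : X.Realizes δ i p) (_ : ∀ t, t ∉ F → cokerDim K p (T t) = 0)
    (_ : ∑ t ∈ F, cokerDim K p (T t) = n),
      indObj h B - indObj h A - indObj h D = ∑ t ∈ F, (cokerDim K p (T t) / dimD K (T t)) • b t := by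
  classical
  have hidem := hC.idem
  induction n using Nat.strong_induction_on with
  | _ n ih =>
  intro A B D δ i p hδ hF hn
  have hfd := fun T => finite_coker (K := K) hC.twoCY hδ T
  have hlift : ∀ {S : C}, cokerDim K p S = 0 → ∀ f : S ⟶ D, ∃ g, g ≫ p = f := by
    intro S hS f
    have hs := Module.finrank_zero_iff.1 hS
    exact (Submodule.Quotient.mk_eq_zero _).1
      (hs.elim (Submodule.Quotient.mk f) 0)
  have hproj : ∀ S, X.IsProj S → ∀ f : S ⟶ D, ∃ g, g ≫ p = f := fun S hS f =>
    (hδ.pull_eq_zero_iff f).1 (hS _ _)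
  -- reduction to the members of the family
  have hind : ∀ (Q : ∀ S : C, (S ⟶ D) → Prop), (∀ {S S' : C} (e : S ⟶ S') f, Q S' f → Q S (e ≫ f)) →
      (∀ i f, Q (T i) f → ∃ g, g ≫ p = f) → ∀ S, 𝒯 S → ∀ f, Q S f → ∃ g, g ≫ p = f := by
    intro Q hQ hQT S hS
    refine h.induction hK.finite (Q := fun S => ∀ f, Q S f → ∃ g, g ≫ p = f) ?_ ?_ ?_ ?_ S hS
    · intro S S' e hS f hf
      obtain ⟨g, hg⟩ := hS _ (hQ e.hom f hf)
      exact ⟨e.inv ≫ g, by rw [Category.assoc, hg, e.inv_hom_id_assoc]⟩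
    · exact fun S hS f _ => ⟨0, hS.eq_of_src _ _⟩
    · intro S S' _ _ hS hS' f hf
      obtain ⟨g, hg⟩ := hS _ (hQ biprod.inl f hf)
      obtain ⟨g', hg'⟩ := hS' _ (hQ biprod.inr f hf)
      exact ⟨biprod.desc g g', by ext <;> simp [hg, hg']⟩
    · intro S hS hSi f hf
      obtain ⟨j, ⟨e⟩⟩ := hT.complete S hS hSi
      obtain ⟨g, hg⟩ := hQT j _ (hQ e.inv f hf)
      exact ⟨e.hom ≫ g, by rw [Category.assoc, hg, e.hom_inv_id_assoc]⟩
  by_cases hall : ∀ (t : {i // ¬ X.IsProj (T i)}) (f : T t ⟶ D), ∃ g, g ≫ p = f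
  · rw [defect_eq_zero hC h hδ, Finset.sum_eq_zero]
    · intro t _
      have : cokerDim K p (T t) = 0 := by
        rw [cokerDim, LinearMap.range_eq_top.2
          (show Function.Surjective (Linear.rightComp K (T t) p) from hall t)]
        exact Module.finrank_zero_of_subsingleton
      rw [this, Nat.zero_div, zero_smul]
    · intro S hS f
      refine hind (fun _ _ => True) (fun _ _ _ => trivial) (fun j f _ => ?_) S hS f trivial
      by_cases hj : X.IsProj (T j)
      · exact hproj _ hj f
      · exact hall ⟨j, hj⟩ f
  push Not at hall
  obtain ⟨t₀, a₀, ha₀⟩ := hall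
  obtain ⟨t, a, ha, hsoc⟩ := exists_socle hC.twoCY hδ
    (fun t : {i // ¬ X.IsProj (T i)} => T t) F (fun t ht => hlift (hF t ht)) t₀ a₀ (fun ⟨g, hg⟩ => ha₀ g hg)
  have hloc := isLocalObj_of_mem hidem hK h (hT.mem t) (hT.indec t)
  have hrad : ∀ S, 𝒯 S → ∀ r ∈ rad K S (T t), ∃ g, g ≫ p = r ≫ a := by
    intro S hS r hr
    refine hind (fun S f => ∃ r ∈ rad K S (T t), f = r ≫ a) ?_ ?_ S hS _ ⟨r, hr, rfl⟩
    · rintro S S' e _ ⟨r, hr, rfl⟩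
      exact ⟨e ≫ r, comp_mem_rad e hr, (Category.assoc _ _ _).symm⟩
    · rintro j _ ⟨r, hr, rfl⟩
      by_cases hj : X.IsProj (T j)
      · exact hproj _ hj _
      · exact hsoc ⟨j, hj⟩ r hr
  have hunit : ∀ S (f : S ⟶ T t), f ∉ rad K S (T t) → ¬ ∃ g, g ≫ p = f ≫ a := by
    rintro S f hf ⟨g, hg⟩
    obtain ⟨s, hs⟩ := hloc.exists_section hf
    exact ha ⟨s ≫ g, by rw [Category.assoc, hg, ← Category.assoc, hs, Category.id_comp]⟩
  -- Replacing p by (p, a) divides the cokernel by the simple submodule generated by a. The pullback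
  -- along a shares the kernel A' and presents this simple module, so the defect of p is the sum of
  -- the two defects.
  obtain ⟨A', k, d, e, ⟨ε, hε⟩, hA'⟩ := hδ.desc_deflation a
  have hsimple := hb t hA' (fun S hS f => by
    rw [← hA'.pull_eq_zero_iff, ← X.pull_comp, hδ.pull_eq_zero_iff]
    exact ⟨fun hf => hrad S hS f hf, fun hg => by_contra fun hf => hunit S f hf hg⟩)
  have htF : t ∈ F := by_contra fun htF => ha (hlift (hF t htF) a)
  have hdim : ∀ s : {i // ¬ X.IsProj (T i)}, cokerDim K p (T s) =
      cokerDim K (biprod.desc p a) (T s) + if s = t then dimD K (T t) else 0 := by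
    intro s
    let V := (T s ⟶ D) ⧸ LinearMap.range (Linear.rightComp K (T s) p)
    let φ : (T s ⟶ T t) →ₗ[K] V := (Submodule.mkQ _).comp (Linear.rightComp K (T s) a)
    have hker : LinearMap.ker φ = rad K (T s) (T t) := by
      ext f
      have h₁ : f ∈ LinearMap.ker φ ↔ ∃ g, g ≫ p = f ≫ a := Submodule.Quotient.mk_eq_zero _
      rw [h₁]
      exact ⟨fun hg => by_contra fun hf => hunit _ f hf hg, fun hf => hrad _ (hT.mem s) f hf⟩
    have hrange : LinearMap.range φ = genBy (K := K) p a (T s) := by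
      ext x
      constructor
      · rintro ⟨f, rfl⟩
        exact ⟨_, ⟨f, rfl⟩, rfl⟩
      · rintro ⟨_, ⟨f, rfl⟩, rfl⟩
        exact ⟨f, rfl⟩
    have h₁ : Module.finrank K (LinearMap.range φ) = if s = t then dimD K (T t) else 0 := by
      rw [← (LinearMap.quotKerEquivRange φ).finrank_eq, hker]
      split_ifs with hst
      · rw [hst]
        rfl
      · exact (IsIndecFamily.topDim_ne hidem hK h hT fun h => hst (Subtype.ext h.symm)).1
    let π : (T s ⟶ D) →ₗ[K] V ⧸ LinearMap.range φ := (Submodule.mkQ _).comp (Submodule.mkQ _)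
    have hπ : Function.Surjective π :=
      (Submodule.mkQ_surjective _).comp (Submodule.mkQ_surjective _)
    have hkerπ : LinearMap.ker π =
        LinearMap.range (Linear.rightComp K (T s) (biprod.desc p a)) := by
      ext f
      have h₂ : f ∈ LinearMap.ker π ↔ Submodule.Quotient.mk f ∈ genBy (K := K) p a (T s) := by
        rw [← hrange]
        exact Submodule.Quotient.mk_eq_zero _
      rw [h₂, mem_genBy, mem_range_rightComp]
      constructor
      · rintro ⟨g, h, rfl⟩
        exact ⟨biprod.lift g h, biprod.lift_desc⟩
      · rintro ⟨g, rfl⟩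
        exact ⟨g ≫ biprod.fst, g ≫ biprod.snd, by
          rw [biprod.desc_eq, Preadditive.comp_add, Category.assoc, Category.assoc]⟩
    have h₂ : cokerDim K (biprod.desc p a) (T s) = Module.finrank K (V ⧸ LinearMap.range φ) := by
      rw [cokerDim, ← hkerπ]
      exact (LinearMap.quotKerEquivOfSurjective π hπ).finrank_eq
    rw [h₂, ← h₁]
    exact (Submodule.finrank_quotient_add_finrank _).symm
  have hdpos : 0 < dimD K (T t) := dimD_pos hK.finite hloc
  have hlt : ∑ s ∈ F, cokerDim K (biprod.desc p a) (T s) < n := by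
    rw [← hn]
    refine Finset.sum_lt_sum (fun s _ => by rw [hdim s]; exact Nat.le_add_right _ _) ⟨t, htF, ?_⟩
    rw [hdim t, if_pos rfl]
    exact Nat.lt_add_of_pos_right hdpos
  have hrec := ih _ hlt hε (fun s hs => by
    have := hdim s
    rw [hF s hs] at this
    omega) rfl
  have hquot : ∀ s : {i // ¬ X.IsProj (T i)}, cokerDim K p (T s) / dimD K (T s) =
      cokerDim K (biprod.desc p a) (T s) / dimD K (T s) + if s = t then 1 else 0 := by
    intro s
    rw [hdim s]
    split_ifs with hst
    · subst hst
      rw [Nat.add_div_right _ hdpos]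
    · rw [add_zero, add_zero]
  rw [Finset.sum_congr rfl fun s _ => by rw [hquot s, add_smul], Finset.sum_add_distrib, ← hrec,
    indObj_biprod h (Iso.refl (B ⊞ T t))]
  have hone : ∑ s ∈ F, (if s = t then 1 else 0 : ℕ) • b s = b t := by
    rw [Finset.sum_eq_single t]
    · rw [if_pos rfl, one_smul]
    · intro s _ hs
      rw [if_neg hs, zero_smul]
    · exact fun hn => absurd htF hn
  rw [hone, ← hsimple]
  abel

end Defect

/-! ### Homogeneous elements of the ambient field -/

section Homogeneous

variable {I : Type*} {p : I → Prop} {B : I → {i // p i} → ℤ}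

/-- Quotients of homogeneous polynomials which are positive at `(1, …, 1)`. -/
def IsPosHom (B : I → {i // p i} → ℤ) (z : Ambient p) (g : I → ℤ) : Prop :=
  ∃ (P Q : MvPolynomial (I ⊕ {i // p i}) ℚ) (a b : I → ℤ),
    0 < MvPolynomial.eval (fun _ => 1) P ∧ 0 < MvPolynomial.eval (fun _ => 1) Q ∧
    MvPolynomial.IsWeightedHomogeneous (gWeight B) P a ∧
    MvPolynomial.IsWeightedHomogeneous (gWeight B) Q b ∧
    z * algebraMap _ _ Q = algebraMap _ _ P ∧ g = a - b

theorem ne_zero_of_eval_pos {σ : Type*} {P : MvPolynomial σ ℚ}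
    (h : 0 < MvPolynomial.eval (fun _ => 1) P) : P ≠ 0 := by
  rintro rfl
  simp at h

theorem algebraMap_ambient_ne_zero {P : MvPolynomial (I ⊕ {i // p i}) ℚ} (h : P ≠ 0) :
    algebraMap (MvPolynomial (I ⊕ {i // p i}) ℚ) (Ambient p) P ≠ 0 :=
  (map_ne_zero_iff _ (IsFractionRing.injective _ _)).2 h

namespace IsPosHom

theorem isGVector {z : Ambient p} {g : I → ℤ} (h : IsPosHom B z g) : IsGVector B z g := by
  obtain ⟨P, Q, a, b, hP, hQ, h⟩ := h
  exact ⟨P, Q, a, b, ne_zero_of_eval_pos hP, ne_zero_of_eval_pos hQ, h⟩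

theorem var (j : I ⊕ {i // p i}) :
    IsPosHom B (algebraMap (MvPolynomial (I ⊕ {i // p i}) ℚ) _ (MvPolynomial.X j)) (gWeight B j) :=
  ⟨MvPolynomial.X j, 1, gWeight B j, 0, by simp, by simp,
    MvPolynomial.isWeightedHomogeneous_X _ _ _, MvPolynomial.isWeightedHomogeneous_one _ _, by simp,
    (sub_zero _).symm⟩

theorem one : IsPosHom B 1 0 :=
  ⟨1, 1, 0, 0, by simp, by simp, MvPolynomial.isWeightedHomogeneous_one _ _,
    MvPolynomial.isWeightedHomogeneous_one _ _, by simp, (sub_zero _).symm⟩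

theorem mul {z z' : Ambient p} {g g' : I → ℤ} (h : IsPosHom B z g) (h' : IsPosHom B z' g') :
    IsPosHom B (z * z') (g + g') := by
  obtain ⟨P, Q, a, b, hP, hQ, ha, hb, hz, rfl⟩ := h
  obtain ⟨P', Q', a', b', hP', hQ', ha', hb', hz', rfl⟩ := h'
  refine ⟨P * P', Q * Q', a + a', b + b', ?_, ?_, ha.mul ha', hb.mul hb', ?_, by abel⟩
  · rw [map_mul]
    exact mul_pos hP hP'
  · rw [map_mul]
    exact mul_pos hQ hQ'
  · rw [map_mul, map_mul, ← hz, ← hz']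
    ring

theorem pow {z : Ambient p} {g : I → ℤ} (h : IsPosHom B z g) (n : ℕ) :
    IsPosHom B (z ^ n) (n • g) := by
  induction n with
  | zero => simpa using one
  | succ n ih =>
    rw [pow_succ, add_smul, one_smul]
    exact ih.mul h

theorem prod {ι : Type*} (s : Finset ι) {z : ι → Ambient p} {g : ι → I → ℤ}
    (h : ∀ i, IsPosHom B (z i) (g i)) : IsPosHom B (∏ i ∈ s, z i) (∑ i ∈ s, g i) := by
  classical
  induction s using Finset.induction_on with
  | empty => simpa using one
  | insert i s hi ih =>
    rw [Finset.prod_insert hi, Finset.sum_insert hi]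
    exact (h i).mul ih

/-- Positivity at (1, …, 1) survives sums, so numerators never cancel to zero along exchange
relations and later divisions are legitimate. -/
theorem add {z z' : Ambient p} {g : I → ℤ} (h : IsPosHom B z g) (h' : IsPosHom B z' g) :
    IsPosHom B (z + z') g := by
  obtain ⟨P, Q, a, b, hP, hQ, ha, hb, hz, hg⟩ := h
  obtain ⟨P', Q', a', b', hP', hQ', ha', hb', hz', hg'⟩ := h'
  have hab : a' + b = a + b' := by
    have := hg.symm.trans hg'
    rw [sub_eq_sub_iff_add_eq_add] at this
    exact this.symm
  have h₁ := ha'.mul hb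
  rw [hab] at h₁
  refine ⟨P * Q' + P' * Q, Q * Q', a + b', b + b', ?_, ?_, (ha.mul hb').add h₁, hb.mul hb', ?_, ?_⟩
  · rw [map_add, map_mul, map_mul]
    positivity
  · rw [map_mul]
    positivity
  · rw [map_add, map_mul, map_mul, map_mul, ← hz, ← hz']
    ring
  · rw [hg]
    abel

theorem div {z z' : Ambient p} {g g' : I → ℤ} (h : IsPosHom B z g) (h' : IsPosHom B z' g') :
    IsPosHom B (z / z') (g - g') := by
  obtain ⟨P, Q, a, b, hP, hQ, ha, hb, hz, rfl⟩ := h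
  obtain ⟨P', Q', a', b', hP', hQ', ha', hb', hz', rfl⟩ := h'
  have hne : z' ≠ 0 := by
    rintro rfl
    rw [zero_mul] at hz'
    exact algebraMap_ambient_ne_zero (ne_zero_of_eval_pos hP') hz'.symm
  refine ⟨P * Q', Q * P', a + b', b + a', ?_, ?_, ha.mul hb', hb.mul ha', ?_, by abel⟩
  · rw [map_mul]
    exact mul_pos hP hQ'
  · rw [map_mul]
    exact mul_pos hQ hP'
  · rw [map_mul, map_mul, ← hz, ← hz']
    field_simp

/-- Finitely supported products of powers. -/
theorem finprod_pow {ι : Type*} {z : ι → Ambient p} {g : ι → I → ℤ}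
    (h : ∀ i, IsPosHom B (z i) (g i)) (n : ι → ℕ) (s : Finset ι) (hs : ∀ i, i ∉ s → n i = 0) :
    IsPosHom B (∏ᶠ i, z i ^ n i) (∑ i ∈ s, n i • g i) := by
  rw [finprod_eq_prod_of_mulSupport_subset (s := s)]
  · exact prod s fun i => (h i).pow (n i)
  · intro i hi
    by_contra hi'
    exact hi (by simp [hs i (by simpa using hi')])

end IsPosHom

/-- The cluster variable created by a mutation is homogeneous if both monomials of the exchange
relation have the same degree. -/
theorem isPosHom_mutate {s : Seed p} {k : {i // p i}} {g : I → I → ℤ}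
    (hx : ∀ i, IsPosHom B (s.x i) (g i)) (F : Finset {i // p i}) (S : Finset I)
    (hF : ∀ j, j ∉ F → s.Cm j k = 0) (hS : ∀ i, i ∉ S → s.B i k = 0)
    (hdeg : ∑ j ∈ F, (s.Cm j k).toNat • gWeight B (Sum.inr j) + ∑ i ∈ S, (s.B i k).toNat • g i =
      ∑ j ∈ F, (- s.Cm j k).toNat • gWeight B (Sum.inr j) + ∑ i ∈ S, (- s.B i k).toNat • g i) :
    IsPosHom B ((s.mutate k).x k) (∑ j ∈ F, (- s.Cm j k).toNat • gWeight B (Sum.inr j) +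
      ∑ i ∈ S, (- s.B i k).toNat • g i - g k) := by
  have hy : ∀ j : {i // p i}, IsPosHom B (yVar j) (gWeight B (Sum.inr j)) := fun j => IsPosHom.var _
  have h₁ := (IsPosHom.finprod_pow hy (fun j => (s.Cm j k).toNat) F
    (fun j hj => by rw [hF j hj]; rfl)).mul (IsPosHom.finprod_pow hx (fun i => (s.B i k).toNat) S
    (fun i hi => by rw [hS i hi]; rfl))
  have h₂ := (IsPosHom.finprod_pow hy (fun j => (- s.Cm j k).toNat) F
    (fun j hj => by rw [hF j hj]; rfl)).mul (IsPosHom.finprod_pow hx (fun i => (- s.B i k).toNat) S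
    (fun i hi => by rw [hS i hi]; rfl))
  rw [hdeg] at h₁
  have h₃ := (h₁.add h₂).div (hx k)
  simpa [Seed.mutate] using h₃

end Homogeneous

/-! ### Labelled mutations -/

section Transport

variable {X : Extri K C} {𝒰 : ObjectProperty C} {U V U' : C}

theorem without_congr (e : U ≅ V) : without 𝒰 U = without 𝒰 V := by
  funext A
  exact propext ⟨fun h => ⟨h.1, fun ⟨r⟩ => h.2 ⟨(Retract.ofIso e).trans r⟩⟩,
    fun h => ⟨h.1, fun ⟨r⟩ => h.2 ⟨(Retract.ofIso e.symm).trans r⟩⟩⟩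

theorem mutSub_congr (e : U ≅ V) : mutSub 𝒰 U U' = mutSub 𝒰 V U' := by
  rw [mutSub, mutSub, without_congr e]

/-- A mutation in `Extri.Reachable` exchanges an object which is only isomorphic to a member of the
labelled family, so mutations must be moved along isomorphisms. -/
theorem isMutation_congr (h : X.IsCT 𝒰) (e : U ≅ V) (hm : X.IsMutation 𝒰 U U') :
    X.IsMutation 𝒰 V U' := by
  obtain ⟨ex⟩ := hm.exchange
  have hp := Extri.realizes_of_iso_ends ex.real_p (Iso.refl U') e
  have hm' := Extri.realizes_of_iso_ends ex.real_m e.symm (Iso.refl U')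
  rw [Iso.refl_inv, X.push_id] at hp
  rw [Iso.refl_inv, X.pull_id] at hm'
  have hw := without_congr (𝒰 := 𝒰) e
  refine ⟨h.of_iso e hm.mem, Indecomposable.of_iso hm.indec e, hm.indec',
    fun ⟨f⟩ => hm.not_iso ⟨e ≪≫ f⟩, mutSub_congr (𝒰 := 𝒰) (U' := U') e ▸ hm.ct,
    ⟨⟨ex.Tp, ex.Tm, hw ▸ ex.mem_p, hw ▸ ex.mem_m, _, _, _, _, _, _, hp, hm', fun h0 => ?_,
      fun h0 => ?_, fun A hA f => ?_, fun A hA f => ?_⟩⟩⟩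
  · apply ex.nonsplit_p
    rw [← X.pull_id ex.δp, ← e.hom_inv_id, X.pull_comp, h0, map_zero]
  · apply ex.nonsplit_m
    have h1 : X.push e.hom ex.δm = 0 := h0
    rw [← X.push_id ex.δm, ← e.hom_inv_id, X.push_comp, h1, map_zero]
  · obtain ⟨g, hg⟩ := ex.approx_p A (hw ▸ hA) (f ≫ e.inv)
    exact ⟨g, by rw [← Category.assoc, hg, Category.assoc, e.inv_hom_id, Category.comp_id]⟩
  · obtain ⟨g, hg⟩ := ex.approx_m A (hw ▸ hA) (e.hom ≫ f)
    exact ⟨g, by rw [Category.assoc, hg, Iso.symm_hom, e.inv_hom_id_assoc]⟩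

theorem ExPair.not_isProj {𝒰' : ObjectProperty C} (E : ExPair X 𝒰 𝒰' U U') : ¬ X.IsProj U :=
  fun h => E.ne_p (h _ _)

/-- Replacing the exchanged object in a family of representatives. -/
theorem ExPair.isIndecFamily {𝒰' : ObjectProperty C} [IsIdempotentComplete C] {I : Type*}
    {Y Y' : I → C} {k : I} (E : ExPair X 𝒰 𝒰' (Y k) (Y' k)) (hY : IsIndecFamily 𝒰 Y)
    (hY' : ∀ i, i ≠ k → Y' i = Y i) : IsIndecFamily 𝒰' Y' := by
  have hwo : ∀ i, i ≠ k → without 𝒰' (Y' k) (Y' i) := fun i hi => by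
    rw [hY' i hi, ← E.without_iff]
    exact E.without_of_not_iso (hY.mem i) (hY.indec i) fun h => hi (hY.inj i k h)
  have hne : ∀ i, i ≠ k → ¬ Nonempty (Y' k ≅ Y' i) := fun i hi ⟨e⟩ =>
    (hwo i hi).2 ⟨Retract.ofIso e⟩
  refine ⟨fun i => ?_, fun i => ?_, fun i j hij => ?_, fun A hA hAi => ?_⟩
  · by_cases hi : i = k
    · exact hi ▸ E.mem'
    · exact (hwo i hi).1
  · by_cases hi : i = k
    · exact hi ▸ E.indec'
    · exact hY' i hi ▸ hY.indec i
  · by_cases hi : i = k <;> by_cases hj : j = k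
    · rw [hi, hj]
    · exact absurd (hi ▸ hij) (hne j hj)
    · obtain ⟨e⟩ := hij
      exact absurd ⟨(hj ▸ e).symm⟩ (hne i hi)
    · rw [hY' i hi, hY' j hj] at hij
      exact hY.inj i j hij
  · by_cases hU : Nonempty (A ≅ Y' k)
    · exact ⟨k, hU⟩
    · have hw := (E.without_iff A).2 (E.symm.without_of_not_iso hA hAi hU)
      obtain ⟨i, ⟨e⟩⟩ := hY.complete A hw.1 hAi
      have hi : i ≠ k := by
        rintro rfl
        exact hw.2 ⟨Retract.ofIso e.symm⟩
      exact ⟨i, by rw [hY' i hi]; exact ⟨e⟩⟩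

end Transport

/-! ### Coordinates with respect to a family of indecomposables. -/

section Family

variable {X : Extri K C} {𝒯 : ObjectProperty C} {I : Type*} {T : I → C}

theorem K0num_ext_family (hidem : IsIdempotentComplete C) (hK : X.IsCompactCat) (h : X.IsCT 𝒯)
    (hT : IsIndecFamily 𝒯 T) {v w : K0num K 𝒯}
    (hvw : ∀ i, pairing v (K0.cls (T i) (hT.mem i)) = pairing w (K0.cls (T i) (hT.mem i))) :
    v = w := by
  refine K0num_ext fun A hA => ?_
  obtain ⟨m, hm, -⟩ := hT.exists_cls hidem hK h A hA
  rw [hm, Finsupp.sum, map_sum, map_sum]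
  refine Finset.sum_congr rfl fun i _ => ?_
  rw [map_nsmul, map_nsmul, hvw]

/-- The class in `K0 𝒯` with given coordinates. -/
def famCls (hT : IsIndecFamily 𝒯 T) : (I →₀ ℤ) →ₗ[ℤ] K0 𝒯 :=
  Finsupp.linearCombination ℤ fun t => K0.cls (T t) (hT.mem t)

open Classical in
theorem topDim_family (hidem : IsIdempotentComplete C) (hK : X.IsCompactCat) (h : X.IsCT 𝒯)
    (hT : IsIndecFamily 𝒯 T) (s t : I) :
    topDim K (T s) (T t) = if s = t then dimD K (T s) else 0 := by
  split_ifs with hst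
  · subst hst
    rfl
  · exact (hT.topDim_ne hidem hK h hst).1

/-- Pairing with the simple module of T s recovers the coordinate at s times the positive number
`dimD K (T s)`. -/
theorem famCls_injective (hidem : IsIdempotentComplete C) (hK : X.IsCompactCat) (h : X.IsCT 𝒯)
    (hT : IsIndecFamily 𝒯 T) : Function.Injective (famCls hT) := by
  classical
  rw [injective_iff_map_eq_zero]
  intro g hg
  ext s
  have h₁ : pairing (K0num.cls (simple K 𝒯 (T s)) (simple_isLfd hK.finite _ _)) (famCls hT g) =
      g s * dimD K (T s) := by
    rw [famCls, Finsupp.linearCombination_apply, Finsupp.sum, map_sum, Finset.sum_eq_single s]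
    · rw [map_zsmul, pairing_simple hK.finite, topDim_family hidem hK h hT, if_pos rfl, smul_eq_mul]
    · intro t _ hts
      rw [map_zsmul, pairing_simple hK.finite, topDim_family hidem hK h hT, if_neg hts.symm]
      simp
    · intro hs
      rw [Finsupp.notMem_support_iff.1 hs, zero_smul, map_zero]
  rw [hg, map_zero] at h₁
  have h₂ := dimD_pos hK.finite (isLocalObj_of_mem hidem hK h (hT.mem s) (hT.indec s))
  have h₃ : (dimD K (T s) : ℤ) ≠ 0 := by exact_mod_cast h₂.ne'
  exact (mul_eq_zero.1 h₁.symm).resolve_right h₃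

/-- The columns of the exchange matrix are the defects of the conflations which present the simple
modules. -/
theorem exists_column (hC : Extri.IsClusterCategory.{w, v, u, v₁, u₁} X) (hK : X.IsCompactCat)
    (h : X.IsCT 𝒯) (hcs : X.HasClusterStructure 𝒯) (hT : IsIndecFamily 𝒯 T)
    (t : {i // ¬ X.IsProj (T i)}) : ∃ col : I →₀ ℤ, (∀ i, col i = exch K 𝒯 (T i) (T t)) ∧
      ∀ {A B : C} {δ : X.Ext (T t) A} {i : A ⟶ B} {p : B ⟶ T t}, X.Realizes δ i p →
        (∀ S, 𝒯 S → ∀ f : S ⟶ T t, f ∈ rad K S (T t) ↔ ∃ g, g ≫ p = f) →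
        indObj h B - indObj h A - indObj h (T t) = famCls hT col := by
  obtain ⟨U', hmut⟩ := hcs.weak 𝒯 h (T t) (hT.mem t) (hT.indec t) t.2
  obtain ⟨ex⟩ := hmut.exchange
  let E := ExPair.ofExchange hC.idem hK h hmut ex
  have hidem := hC.idem
  have := hC.twoCY.finite_ext U' (T t)
  have hnl : E.NoLoop := E.noLoop_of_noLoopAt hK.finite
    (hcs.no_loop 𝒯 Extri.Reachable.refl (T t) (hT.mem t) (hT.indec t) t.2).1
  obtain ⟨p, m, hp, hm, -, -, hex, -⟩ := E.exists_exch_column hidem hK hT hnl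
  have hcast : ∀ n : I →₀ ℕ, n.sum (fun i n => n • K0.cls (T i) (hT.mem i)) =
      famCls hT (n.mapRange (Nat.cast : ℕ → ℤ) Nat.cast_zero) := by
    intro n
    rw [famCls, Finsupp.linearCombination_apply, Finsupp.sum_mapRange_index]
    · simp only [natCast_zsmul]
    · simp
  refine ⟨p.mapRange (Nat.cast : ℕ → ℤ) Nat.cast_zero - m.mapRange (Nat.cast : ℕ → ℤ) Nat.cast_zero,
    fun i => ?_, fun hδ hrad => ?_⟩
  · rw [hex]
    rfl
  · have := E.defect_simple hC hK.finite hnl hδ hrad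
    rw [map_sub, ← hcast, ← hcast, ← hp, ← hm]
    exact this

end Family

/-! ### Comparison with seeds -/

section Seeds

variable {X : Extri K C} {𝒯 : ObjectProperty C} {I : Type*} {T : I → C}

variable (X T) in
/-- The indices of non-projective objects. -/
abbrev NonProj := {i // ¬ X.IsProj (T i)}

variable (X 𝒯 T) in
/-- The exchange matrix of `𝒯`. -/
def exchMat : I → NonProj X T → ℤ := fun i j => exch K 𝒯 (T i) (T j)

/-- The relation between a labelled cluster-tilting subcategory and a seed. -/
structure SeedInv (hK : X.IsCompactCat) (h : X.IsCT 𝒯) (hT : IsIndecFamily 𝒯 T)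
    (s : Seed fun i => ¬ X.IsProj (T i)) (𝒰 : ObjectProperty C) (Y : I → C) : Prop where
  reach : X.Reachable 𝒯 𝒰
  ct : X.IsCT 𝒰
  fam : IsIndecFamily 𝒰 Y
  proj : ∀ i, X.IsProj (Y i) ↔ X.IsProj (T i)
  exch_eq : ∀ (i : I) (j : NonProj X T), s.B i j = exch K 𝒰 (Y i) (Y j)
  c_finite : ∀ j, {t | s.Cm t j ≠ 0}.Finite
  c_eq : ∀ j t : NonProj X T, pairing (X.indbar 𝒰 𝒯 (K0num.cls (simple K 𝒰 (Y j))
    (simple_isLfd hK.finite _ _))) (K0.cls (T t) (hT.mem t)) = s.Cm t j * dimD K (T t)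
  g_eq : ∀ i, ∃ g : I →₀ ℤ, IsPosHom (exchMat X 𝒯 T) (s.x i) g ∧ indObj h (Y i) = famCls hT g

variable (hC : Extri.IsClusterCategory.{w, v, u, v₁, u₁} X) (hK : X.IsCompactCat) (h : X.IsCT 𝒯)
  (hT : IsIndecFamily 𝒯 T)

include hC in
theorem seedInv_initial : SeedInv hK h hT (Seed.initial (exchMat X 𝒯 T)) 𝒯 T where
  reach := Extri.Reachable.refl
  ct := h
  fam := hT
  proj _ := Iff.rfl
  exch_eq _ _ := rfl
  c_finite j := by
    classical
    refine (Set.finite_singleton j).subset fun t ht => ?_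
    by_contra hne
    exact ht (if_neg hne)
  c_eq j t := by
    classical
    obtain ⟨O, hO⟩ := HasZeroObject.zero (C := C)
    obtain ⟨δ, hδ⟩ := Extri.conflation_id_zero (X := X) (T t) hO
    rw [pairing_indbar_simple hK.finite h 𝒯 (T j) (hT.mem t)
      ⟨T t, O, 𝟙 _, 0, δ, hT.mem t, h.of_isZero hO, hδ⟩]
    have h₁ : topDim K (T j) O = 0 := topDim_eq_zero fun f => by
      rw [hO.eq_of_src f 0]
      exact zero_mem _
    rw [h₁, topDim_family hC.idem hK h hT]
    by_cases htj : t = j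
    · subst htj
      simp [Seed.initial]
    · have : (j : I) ≠ t := fun h => htj (Subtype.ext h.symm)
      simp [Seed.initial, htj, this]
  g_eq i := by
    classical
    refine ⟨Finsupp.single i 1, ?_, ?_⟩
    · have := IsPosHom.var (B := exchMat X 𝒯 T) (Sum.inl i)
      have hg : gWeight (exchMat X 𝒯 T) (Sum.inl i) = ⇑(Finsupp.single i (1 : ℤ)) := by
        rw [Finsupp.single_eq_pi_single]
        simp only [gWeight]
      rw [hg] at this
      exact this
    · rw [indObj_self h (hT.mem i), famCls, Finsupp.linearCombination_single, one_smul]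

theorem max_neg_mul_nat (x : ℤ) (d : ℕ) : max (-(x * d)) 0 = max (-x) 0 * d := by
  rw [max_mul_of_nonneg _ _ (Nat.cast_nonneg d), neg_mul, zero_mul]

include hC in
/-- The relation between labelled cluster-tilting subcategories and seeds is preserved by
mutation. -/
theorem SeedInv.mutate (hcs : X.HasClusterStructure 𝒯) {s : Seed fun i => ¬ X.IsProj (T i)}
    {𝒰 : ObjectProperty C} {Y Y' : I → C} (inv : SeedInv hK h hT s 𝒰 Y) (k : NonProj X T)
    (hmut : X.IsMutation 𝒰 (Y k) (Y' k)) (hY' : ∀ i, i ≠ k.1 → Y' i = Y i) :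
    SeedInv hK h hT (s.mutate k) (mutSub 𝒰 (Y k) (Y' k)) Y' := by
  classical
  have hidem := hC.idem
  have hfin := hK.finite
  have hF := hC.frobenius
  have hCY := hC.twoCY
  obtain ⟨ex⟩ := hmut.exchange
  let E := ExPair.ofExchange hidem hK inv.ct hmut ex
  have hnp : ∀ j : NonProj X T, ¬ X.IsProj (Y j) := fun j hj => j.2 ((inv.proj j).1 hj)
  have hno := hcs.no_loop 𝒰 inv.reach (Y k) (inv.fam.mem k) (inv.fam.indec k) (hnp k)
  have := hCY.finite_ext (Y' k) (Y k)
  have hnl : E.NoLoop := E.noLoop_of_noLoopAt hfin hno.1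
  have hni : ∀ i, i ≠ k.1 → ¬ Nonempty (Y i ≅ Y k) := fun i hi hn => hi (inv.fam.inj i k hn)
  have hd : ∀ t, 0 < dimD K (T t) := fun t =>
    dimD_pos hfin (isLocalObj_of_mem hidem hK h (hT.mem t) (hT.indec t))
  have hpc := inv.c_eq k
  -- The modules presented by the two exchange conflations have coordinates [c]_- and, by the
  -- reversed exchange pair, [c]_+. The factor `dimD` appears because the pairing counts dimensions
  -- rather than multiplicities.
  have hker : ∀ t : NonProj X T, cokerDim K E.pm (T t) = (- s.Cm t k).toNat * dimD K (T t) := by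
    intro t
    have h₁ := E.pairing_kerExt hF hCY hfin hnl h (T t) (hT.mem t)
    rw [hpc t, pairing_cls, max_neg_mul_nat] at h₁
    have h₂ : (cokerDim K E.pm (T t) : ℤ) = max (- s.Cm t k) 0 * dimD K (T t) := by
      rw [cokerDim_eq E.real_m]
      exact h₁
    zify
    rw [Int.toNat_eq_max, h₂]
  have hker' : ∀ t : NonProj X T, cokerDim K E.pp (T t) = (s.Cm t k).toNat * dimD K (T t) := by
    intro t
    have h₁ := E.symm.pairing_kerExt hF hCY hfin hnl.symm h (T t) (hT.mem t)
    rw [E.indbar_simple_exchange hF hCY hfin hnl h, map_neg, AddMonoidHom.neg_apply, hpc t,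
      pairing_cls, ← neg_mul, max_neg_mul_nat, neg_neg] at h₁
    have h₂ : (cokerDim K E.pp (T t) : ℤ) = max (s.Cm t k) 0 * dimD K (T t) := by
      rw [cokerDim_eq E.real_p]
      exact h₁
    zify
    rw [Int.toNat_eq_max, h₂]
  refine ⟨inv.reach.step hmut, hmut.ct, E.isIndecFamily inv.fam hY', fun i => ?_, fun i j => ?_,
    fun j => ?_, fun j t => ?_, fun i => ?_⟩
  · by_cases hi : i = k.1
    · subst hi
      exact ⟨fun hp => absurd hp E.symm.not_isProj, fun hp => absurd hp k.2⟩
    · rw [hY' i hi, inv.proj]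
  · by_cases hi : i = k.1 <;> by_cases hj : j = k
    · subst hi hj
      simp only [Seed.mutate, true_or, if_true, inv.exch_eq]
      rw [exch, exch, sub_self, sub_self, neg_zero]
    · subst hi
      have hj' : j.1 ≠ k.1 := fun h => hj (Subtype.ext h)
      simp only [Seed.mutate, true_or, if_true, inv.exch_eq]
      rw [hY' j hj', hcs.exch_left 𝒰 inv.reach _ _ hmut _ (inv.fam.mem j) (inv.fam.indec j) (hnp j)
        (hni j hj')]
    · subst hj
      simp only [Seed.mutate, or_true, if_true, inv.exch_eq]
      rw [hY' i hi, hcs.exch_right 𝒰 inv.reach _ _ hmut _ (inv.fam.mem i) (inv.fam.indec i) (hni i hi)]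
    · have hj' : j.1 ≠ k.1 := fun h => hj (Subtype.ext h)
      simp only [Seed.mutate, hi, hj, or_self, if_false, inv.exch_eq]
      rw [hY' i hi, hY' j hj', hcs.exch_other 𝒰 inv.reach _ _ hmut _ _ (inv.fam.mem i)
        (inv.fam.indec i) (hni i hi) (inv.fam.mem j) (inv.fam.indec j) (hnp j) (hni j hj')]
  · refine ((inv.c_finite j).union (inv.c_finite k)).subset fun t ht => ?_
    by_contra hnt
    simp only [Set.mem_union, Set.mem_ofPred_eq, not_or, not_not] at hnt
    apply ht
    simp [Seed.mutate, hnt.1, hnt.2]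
  · by_cases hj : j = k
    · subst hj
      rw [E.indbar_simple_exchange hF hCY hfin hnl h, map_neg, AddMonoidHom.neg_apply, hpc t]
      simp [Seed.mutate]
    · have hj' : j.1 ≠ k.1 := fun h => hj (Subtype.ext h)
      have hV := E.without_of_not_iso (inv.fam.mem j) (inv.fam.indec j) (hni j hj')
      obtain ⟨q, q', hq, hq', hqe, hqq⟩ := E.exists_exch_row hidem hK hnl hV (inv.fam.indec j)
      have hb : s.B k j = (q : ℤ) - q' := by rw [inv.exch_eq, hqe]
      have hb₁ : max (s.B k j) 0 = q := by
        rw [hb]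
        rcases hqq hno.2 with h0 | h0 <;> rw [h0] <;> simp
      have hb₂ : max (- s.B k j) 0 = q' := by
        rw [hb]
        rcases hqq hno.2 with h0 | h0 <;> rw [h0] <;> simp
      -- The Fomin–Zelevinsky recursion and the formula for the adjoint differ by the identity x =
      -- [x]_+ - [x]_- applied to each coordinate of the c-vector at k.
      have hx := max_zero_sub_max_neg_zero_eq_self (s.Cm t k)
      rw [hY' j hj', E.indbar_simple_other hF hCY hfin hnl h hV hq hq', map_add, map_add,
        AddMonoidHom.add_apply, AddMonoidHom.add_apply, map_zsmul, map_zsmul,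
        AddMonoidHom.zsmul_apply, AddMonoidHom.zsmul_apply,
        E.pairing_kerExt hF hCY hfin hnl h, inv.c_eq, hpc t, max_neg_mul_nat]
      simp only [Seed.mutate, hj, if_false, hb₁, hb₂, smul_eq_mul]
      linear_combination (-(q : ℤ) * dimD K (T t)) * hx
  · by_cases hi : i = k.1
    · subst hi
      choose g hg hg' using inv.g_eq
      choose col hcol hcol' using exists_column hC hK h hcs hT
      obtain ⟨p, m, hp, hm, -, -, hex, h2⟩ := E.exists_exch_column hidem hK inv.fam hnl
      have hexp : ∀ i, (s.B i k).toNat = p i := fun i => by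
        rw [inv.exch_eq, hex]
        rcases h2 hno.2 i with h0 | h0 <;> rw [h0] <;> simp
      have hexm : ∀ i, (- s.B i k).toNat = m i := fun i => by
        rw [inv.exch_eq, hex]
        rcases h2 hno.2 i with h0 | h0 <;> rw [h0] <;> simp
      let F := (inv.c_finite k).toFinset
      have hFz : ∀ t, t ∉ F → s.Cm t k = 0 := fun t ht => by
        by_contra hne
        exact ht ((Set.Finite.mem_toFinset _).2 hne)
      let S := p.support ∪ m.support
      have hSz : ∀ i, i ∉ S → p i = 0 ∧ m i = 0 := fun i hi => by
        simpa [S] using hi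
      have hind : ∀ (A : C) (hA : 𝒰 A) (n : I →₀ ℕ),
          K0.cls A hA = n.sum (fun i n => n • K0.cls (Y i) (inv.fam.mem i)) →
          (∀ i, i ∉ S → n i = 0) → indObj h A = ∑ i ∈ S, n i • famCls hT (g i) := by
        intro A hA n hn hS
        rw [← ind_cls h A hA, hn, Finsupp.sum, map_sum]
        refine (Finset.sum_subset (fun i hi => ?_) fun i _ hi => ?_).trans
          (Finset.sum_congr rfl fun i _ => ?_)
        · by_contra hiS
          exact Finsupp.mem_support_iff.1 hi (hS i hiS)
        · rw [Finsupp.notMem_support_iff.1 hi, zero_smul, map_zero]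
        · rw [map_nsmul, ind_cls h, hg']
      have hUp := hind E.Up E.mem_p.1 p hp fun i hi => (hSz i hi).1
      have hUm := hind E.Um E.mem_m.1 m hm fun i hi => (hSz i hi).2
      have hdm := defect_eq_sum hC hK h hT _ hcol' F _ E.real_m (fun t ht => by
        rw [hker, hFz t ht, neg_zero, Int.toNat_zero, zero_mul]) rfl
      have hdp := defect_eq_sum hC hK h hT _ hcol' F _ E.real_p (fun t ht => by
        rw [hker', hFz t ht, Int.toNat_zero, zero_mul]) rfl
      have hdiv : ∀ (n : ℕ) (t : NonProj X T), n * dimD K (T t) / dimD K (T t) = n :=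
        fun n t => Nat.mul_div_cancel _ (hd t)
      simp only [hker, hdiv, hUm] at hdm
      simp only [hker', hdiv, hUp] at hdp
      -- Dm and Dp are the degrees of the two monomials of the exchange relation, as y_j has degree
      -- minus column j. The defects of the two exchange conflations show that both represent ind (Y
      -- k) + ind (Y' k), so they coincide.
      let Dm : I →₀ ℤ := ∑ j ∈ F, (- s.Cm j k).toNat • (- col j) + ∑ i ∈ S, m i • g i
      let Dp : I →₀ ℤ := ∑ j ∈ F, (s.Cm j k).toNat • (- col j) + ∑ i ∈ S, p i • g i
      have hDm : famCls hT Dm = indObj h (Y k) + indObj h (Y' k) := by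
        simp only [Dm, map_add, map_sum, map_nsmul, map_neg, smul_neg, Finset.sum_neg_distrib]
        rw [← hdm]
        abel
      have hDp : famCls hT Dp = indObj h (Y k) + indObj h (Y' k) := by
        simp only [Dp, map_add, map_sum, map_nsmul, map_neg, smul_neg, Finset.sum_neg_distrib]
        rw [← hdp]
        abel
      have hDD : Dp = Dm := famCls_injective hidem hK h hT (hDp.trans hDm.symm)
      have hw : ∀ j, gWeight (exchMat X 𝒯 T) (Sum.inr j) = ⇑(- col j) := by
        intro j
        funext i
        rw [Finsupp.neg_apply, hcol]
        rfl
      have hDm' : ⇑Dm = ∑ j ∈ F, (- s.Cm j k).toNat • gWeight (exchMat X 𝒯 T) (Sum.inr j) +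
          ∑ i ∈ S, (- s.B i k).toNat • ⇑(g i) := by
        simp only [hw, hexm, Dm, Finsupp.coe_add, Finsupp.coe_finsetSum, Finsupp.coe_smul]
      have hDp' : ⇑Dp = ∑ j ∈ F, (s.Cm j k).toNat • gWeight (exchMat X 𝒯 T) (Sum.inr j) +
          ∑ i ∈ S, (s.B i k).toNat • ⇑(g i) := by
        simp only [hw, hexp, Dp, Finsupp.coe_add, Finsupp.coe_finsetSum, Finsupp.coe_smul]
      refine ⟨Dm - g k, ?_, ?_⟩
      · have := isPosHom_mutate hg F S (k := k) hFz (fun i hi => by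
          rw [inv.exch_eq, hex, (hSz i hi).1, (hSz i hi).2]
          simp) (by rw [← hDp', ← hDm', hDD])
        rw [← hDm', ← Finsupp.coe_sub] at this
        exact this
      · rw [map_sub, hDm, ← hg']
        abel
    · obtain ⟨g, hg, hg'⟩ := inv.g_eq i
      refine ⟨g, ?_, by rw [hY' i hi, hg']⟩
      simpa [Seed.mutate, hi] using hg

end Seeds

/-! ### Realization of index sequences and of reachable subcategories. -/

section Reachable

variable {X : Extri K C} {𝒯 : ObjectProperty C} {I : Type*} {T : I → C}
  (hC : Extri.IsClusterCategory.{w, v, u, v₁, u₁} X) (hK : X.IsCompactCat) (h : X.IsCT 𝒯)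
  (hcs : X.HasClusterStructure 𝒯) (hT : IsIndecFamily 𝒯 T)

include hC hcs

theorem seedInv_of_labelledReach {l : List (NonProj X T)} {𝒰 : ObjectProperty C} {Y : I → C}
    (hl : X.LabelledReach (fun i => ¬ X.IsProj (T i)) 𝒯 T l 𝒰 Y) :
    SeedInv hK h hT (seedAt (exchMat X 𝒯 T) l) 𝒰 Y := by
  induction hl with
  | nil => exact seedInv_initial hC hK h hT
  | cons k _ hmut hY' ih => exact ih.mutate hC hK h hT hcs k hmut hY'

include hK h hT

/-- The invariant keeps objects at indices in J non-projective, so the next mutation always exists.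
-/
theorem exists_labelledReach (l : List (NonProj X T)) : ∃ (𝒰 : ObjectProperty C) (Y : I → C),
    X.LabelledReach (fun i => ¬ X.IsProj (T i)) 𝒯 T l 𝒰 Y := by
  classical
  induction l with
  | nil => exact ⟨𝒯, T, .nil⟩
  | cons k l ih =>
    obtain ⟨𝒰, Y, hl⟩ := ih
    have inv := seedInv_of_labelledReach hC hK h hcs hT hl
    obtain ⟨U', hmut⟩ := hcs.weak 𝒰 inv.ct (Y k) (inv.fam.mem k) (inv.fam.indec k)
      fun hp => k.2 ((inv.proj k).1 hp)
    refine ⟨_, Function.update Y k U', .cons k hl ?_ fun i hi => Function.update_of_ne hi _ _⟩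
    rwa [Function.update_self]

theorem exists_labelledReach_of_reachable {𝒰 : ObjectProperty C} (hr : X.Reachable 𝒯 𝒰) :
    ∃ (l : List (NonProj X T)) (Y : I → C),
      X.LabelledReach (fun i => ¬ X.IsProj (T i)) 𝒯 T l 𝒰 Y := by
  classical
  induction hr with
  | refl => exact ⟨[], T, .nil⟩
  | @step 𝒰 T₀ T₁ hr hmut ih =>
    obtain ⟨l, Y, hl⟩ := ih
    have inv := seedInv_of_labelledReach hC hK h hcs hT hl
    -- The exchanged object is replaced by the isomorphic family member `Y k`; this changes neither
    -- the mutability nor the mutated subcategory.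
    obtain ⟨k, ⟨e⟩⟩ := inv.fam.complete T₀ hmut.mem hmut.indec
    have hmut' := isMutation_congr inv.ct e hmut
    obtain ⟨ex⟩ := hmut'.exchange
    have hk : ¬ X.IsProj (T k) := fun hp => ex.nonsplit_p ((inv.proj k).2 hp _ _)
    have hl' := Extri.LabelledReach.cons (Y' := Function.update Y k T₁) ⟨k, hk⟩ hl
      (by rwa [Function.update_self]) fun i hi => Function.update_of_ne hi _ _
    refine ⟨⟨k, hk⟩ :: l, Function.update Y k T₁, ?_⟩
    rw [mutSub_congr e]
    simpa only [Function.update_self] using hl'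

end Reachable

section

variable {X : Extri K C} {𝒯 : ObjectProperty C} {I : Type*} {T : I → C}

/-- The `c`-vectors of a seed compute the classes of the adjoint of the coindex. -/
theorem SeedInv.indbar_eq (hC : Extri.IsClusterCategory.{w, v, u, v₁, u₁} X) {hK : X.IsCompactCat}
    {h : X.IsCT 𝒯} {hT : IsIndecFamily 𝒯 T} (hcs : X.HasClusterStructure 𝒯)
    {s : Seed fun i => ¬ X.IsProj (T i)} {𝒰 : ObjectProperty C} {Y : I → C}
    (inv : SeedInv hK h hT s 𝒰 Y) (j : NonProj X T) :
    X.indbar 𝒰 𝒯 (K0num.cls (simple K 𝒰 (Y j)) (simple_isLfd hK.finite _ _)) =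
      ∑ᶠ t : NonProj X T, s.Cm t j •
        K0num.cls (simple K 𝒯 (T t)) (simple_isLfd hK.finite _ _) := by
  classical
  have hidem := hC.idem
  rw [finsum_eq_sum_of_support_subset (s := (inv.c_finite j).toFinset)]
  · refine K0num_ext_family hidem hK h hT fun i => ?_
    have hs : ∀ t : NonProj X T, pairing (s.Cm t j • K0num.cls (simple K 𝒯 (T t))
        (simple_isLfd hK.finite _ _)) (K0.cls (T i) (hT.mem i)) =
          if t.1 = i then s.Cm t j * dimD K (T t) else 0 := by
      intro t
      rw [map_zsmul, AddMonoidHom.zsmul_apply, pairing_simple hK.finite, topDim_family hidem hK h hT]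
      split_ifs <;> simp
    rw [map_sum, AddMonoidHom.finsetSum_apply, Finset.sum_congr rfl fun t _ => hs t]
    -- At projective objects both sides vanish; elsewhere only the summand with index i pairs
    -- non-trivially.
    by_cases hi : X.IsProj (T i)
    · have hj : ¬ X.IsProj (Y j) := fun hp => j.2 ((inv.proj j).1 hp)
      obtain ⟨U', hmut⟩ := hcs.weak 𝒰 inv.ct (Y j) (inv.fam.mem j) (inv.fam.indec j) hj
      obtain ⟨ex⟩ := hmut.exchange
      rw [(ExPair.ofExchange hidem hK inv.ct hmut ex).pairing_isProj hK.finite _ _ hi,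
        Finset.sum_eq_zero]
      intro t _
      rw [if_neg]
      rintro rfl
      exact t.2 hi
    · rw [Finset.sum_eq_single (⟨i, hi⟩ : NonProj X T), if_pos rfl]
      · exact inv.c_eq j ⟨i, hi⟩
      · intro t _ ht
        rw [if_neg]
        rintro rfl
        exact ht rfl
      · intro ht
        rw [if_pos rfl]
        have : s.Cm ⟨i, hi⟩ j = 0 := by
          by_contra hne
          exact ht ((Set.Finite.mem_toFinset _).2 hne)
        rw [this, zero_mul]
  · intro t ht
    rw [Finset.mem_coe, Set.Finite.mem_toFinset]
    intro h0
    exact ht (by simp [h0])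

end

end ClusterCat

end

theorem theoremt {K : Type w} [Field K] [PerfectField K] {C : Type u} [Category.{v} C]
    [Preadditive C] [Linear K C] [HasFiniteBiproducts C] (X : Extri K C)
    (hC : Extri.IsClusterCategory.{w, v, u, v₁, u₁} X) (hK : X.IsCompactCat)
    (𝒯 : ObjectProperty C) (h𝒯 : X.IsCT 𝒯) :
    -- the maps `β`, index, coindex and its adjoint are well defined
    (∃! φ, Extri.IsBeta.{w, v, u, v₁, u₁} X 𝒯 φ) ∧
    (∀ 𝒰 : ObjectProperty C, X.IsCT 𝒰 → X.IsIndex 𝒰 𝒯 (X.ind 𝒰 𝒯) ∧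
      X.IsCoindex 𝒯 𝒰 (X.coind 𝒯 𝒰) ∧ X.IsIndbar 𝒰 𝒯 (X.indbar 𝒰 𝒯)) ∧
    -- the mutation formulae
    (∀ (𝒰 : ObjectProperty C) (_ : X.IsCT 𝒰) (I : Type x) (W : I → C) (hW : IsIndecFamily 𝒰 W)
      (k : I) (U' : C) (_ : X.IsMutation 𝒰 (W k) U') (ex : X.Exchange 𝒰 (W k) U'),
      NoLoopAt K 𝒰 (W k) → NoTwoCycleAt K 𝒰 (W k) →
      let 𝒰' := mutSub 𝒰 (W k) U'
      let c := X.indbar 𝒰 𝒯 (K0num.cls (simple K 𝒰 (W k)) (simple_isLfd hK.finite _ _))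
      {i | exch K 𝒰 (W i) (W k) ≠ 0}.Finite ∧
      (∀ (P : C) (hP : 𝒯 P), X.IsProj P → pairing c (K0.cls P hP) = 0) ∧
      ∃ (hfp : (kerExt X 𝒯 ex.im).IsFpStable X) (hfd : (kerExt X 𝒯 ex.im).IsLfd),
        IsNegPart c (K0num.cls (kerExt X 𝒯 ex.im) hfd) ∧
        X.ind 𝒰' 𝒯 (K0.cls U' (mem_mutSub 𝒰 (W k) U')) =
          - X.ind 𝒰 𝒯 (K0.cls (W k) (hW.mem k))
          + (∑ᶠ (i : I) (_ : i ≠ k),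
              max (- exch K 𝒰 (W i) (W k)) 0 • X.ind 𝒰 𝒯 (K0.cls (W i) (hW.mem i)))
          - Extri.beta.{w, v, u, v₁, u₁} X 𝒯 (K0Mod.cls (kerExt X 𝒯 ex.im) hfp) ∧
        X.indbar 𝒰' 𝒯 (K0num.cls (simple K 𝒰' U') (simple_isLfd hK.finite _ _)) = - c ∧
        ∀ (V : C) (hV' : 𝒰' V), Indecomposable V → ¬ Nonempty (V ≅ U') →
          (∃ hV : 𝒰 V, X.ind 𝒰' 𝒯 (K0.cls V hV') = X.ind 𝒰 𝒯 (K0.cls V hV)) ∧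
          X.indbar 𝒰' 𝒯 (K0num.cls (simple K 𝒰' V) (simple_isLfd hK.finite _ _)) =
            X.indbar 𝒰 𝒯 (K0num.cls (simple K 𝒰 V) (simple_isLfd hK.finite _ _))
            + max (exch K 𝒰 (W k) V) 0 • c
            + exch K 𝒰 (W k) V • K0num.cls (kerExt X 𝒯 ex.im) hfd) ∧
    -- comparison with the cluster algebra with initial exchange matrix `B_𝒯`
    (X.HasClusterStructure 𝒯 → ∀ (I : Type x) (T : I → C) (hT : IsIndecFamily 𝒯 T),
      let p : I → Prop := fun i => ¬ X.IsProj (T i)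
      let B : I → {i // p i} → ℤ := fun i j => exch K 𝒯 (T i) (T j)
      (∀ l : List {i // p i}, ∃ (𝒰 : ObjectProperty C) (Y : I → C),
        X.LabelledReach p 𝒯 T l 𝒰 Y) ∧
      (∀ 𝒰 : ObjectProperty C, X.Reachable 𝒯 𝒰 → ∃ (l : List {i // p i}) (Y : I → C),
        X.LabelledReach p 𝒯 T l 𝒰 Y) ∧
      ∀ (l : List {i // p i}) (𝒰 : ObjectProperty C) (Y : I → C), X.LabelledReach p 𝒯 T l 𝒰 Y →
        ∃ hY : IsIndecFamily 𝒰 Y,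
          (∀ i : I, ∃ g : I →₀ ℤ, IsGVector B ((seedAt B l).x i) g ∧
            X.ind 𝒰 𝒯 (K0.cls (Y i) (hY.mem i)) =
              g.sum fun t n => n • K0.cls (T t) (hT.mem t)) ∧
          ∀ j : {i // p i}, {t | (seedAt B l).Cm t j ≠ 0}.Finite ∧
            X.indbar 𝒰 𝒯 (K0num.cls (simple K 𝒰 (Y j)) (simple_isLfd hK.finite _ _)) =
              ∑ᶠ t, (seedAt B l).Cm t j •
                K0num.cls (simple K 𝒯 (T t)) (simple_isLfd hK.finite _ _)) := by
  have hidem := hC.idem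
  refine ⟨exists_beta hC h𝒯, fun 𝒰 h𝒰 => ⟨isIndex_ind h𝒯 𝒰, isCoindex_coind h𝒰 𝒯,
    isIndbar_indbar h𝒰 𝒯⟩, fun 𝒰 h𝒰 I W hW k U' hmut ex h₁ h₂ =>
      mutation_formulae hC hK h𝒯 hW (ExPair.ofExchange hidem hK h𝒰 hmut ex) h₁ h₂,
    fun hcs I T hT => ⟨exists_labelledReach hC hK h𝒯 hcs hT,
      fun 𝒰 => exists_labelledReach_of_reachable hC hK h𝒯 hcs hT, fun l 𝒰 Y hl => ?_⟩⟩
  have inv := seedInv_of_labelledReach hC hK h𝒯 hcs hT hl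
  refine ⟨inv.fam, fun i => ?_, fun j => ⟨inv.c_finite j, inv.indbar_eq hC hcs j⟩⟩
  obtain ⟨g, hg, hg'⟩ := inv.g_eq i
  refine ⟨g, hg.isGVector, ?_⟩
  rw [ind_cls h𝒯, hg', famCls, Finsupp.linearCombination_apply]
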